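/- Let $n\ge 0$ and let $\mathcal N=\mathbb R^n\times \mathrm{Sym}^+(n,\mathbb R)$ be the manifold of $n$-variate normal distributions with mean $\mu$ and covariance matrix $\Sigma$, an open subset of the vector space $\mathbb R^n\times \mathrm{Sym}(n,\mathbb R)$. Write $\theta=(\mu,\Sigma)$ and $$p(x,\theta)=\frac{1}{\sqrt{(2\pi)^n\det\Sigma}}\exp\Bigl(-\tfrac12 (x-\mu)^T\Sigma^{-1}(x-\mu)\Bigr).$$ For tangent vectors $X,Y,Z$ at $\theta$ let $$g^F(X,Y)=\int_{\mathbb R^n}p\,(X\log p)(Y\log p)\,dx,\qquad C^A(X,Y,Z)=\int_{\mathbb R^n}p\,(X\log p)(Y\log p)(Z\log p)\,dx$$ be the Fisher metric and the Amari–Chentsov cubic form, and let $\widehat\nabla$ be the Levi-Civita connection of $g^F$. Let $R$ be the group of upper triangular real $n\times n$ matrices with positive diagonal entries, and let $\mathrm{Aff}^s(n,\mathbb R)=R\ltimes\mathbb R^n$ with the product $(A,b)(A',b')=(AA',Ab'+b)$. The map $\phi(A,b)=(b,AA^T)$ is a bijection $\mathrm{Aff}^s(n,\mathbb R)\to\mathcal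 N$; give $\mathcal N$ the group structure for which $\phi$ is an isomorphism. Then $\mathcal N$ is a solvable Lie group, and $g^F$ is a smooth left-invariant Riemannian metric on it, with a Levi-Civita connection $\widehat\nabla$. Let moreover $\nabla$ be a smooth left-invariant torsion-free affine connection on $\mathcal N$ such that $(\mathcal N,g^F,\nabla)$ is a statistical manifold, i.e. the cubic form $C(X,Y,Z)=(\nabla_Xg^F)(Y,Z)$ is totally symmetric. Let $K(X,Y)=\nabla_XY-\widehat\nabla_XY$, let $\nabla^*$ be the conjugate connection of $\nabla$, defined by $Xg^F(Y,Z)=g^F(\nabla_XY,Z)+g^F(Y,\nabla^*_XZ)$, and let $R^\nabla$, $R^{\nabla^*}$ be the curvature tensors of $\nabla$ and $\nabla^*$. Then the following are equivalent: 1. $\nabla$ is an Amari–Chentsov $\alpha$-connection: there is $\alpha\in\mathbb R$ such that $g^F(\nabla_XY,Z)=g^F(\widehat\nabla_XY,Z)-\frac{\alpha}{2}C^A(X,Y,Z)$ for all vector fields $X,Y,Z$; 2. $(\mathcal N,g^F,\nabla)$ is conjugate symmetric: $R^\nabla=R^{\nabla^*}$; 3. $\nabla C$ is totally symmetric, i.e.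 $(\nabla_WC)(X,Y,Z)$ is symmetric in $W,X,Y,Z$; 4. $\widehat\nabla C$ is totally symmetric, i.e. $(\widehat\nabla_WC)(X,Y,Z)$ is symmetric in $W,X,Y,Z$; 5. $\widehat\nabla K$ is totally symmetric, i.e. $(\widehat\nabla_XK)(Y,Z)$ is symmetric in $X,Y,Z$. -/

import Mathlib

open Matrix MeasureTheory
open scoped Manifold ContDiff Topology

noncomputable section

namespace NormalDist

section Geometry

variable {E : Type*} [NormedAddCommGroup E] [NormedSpace ℝ E]
  {M : Type*} [TopologicalSpace M] [ChartedSpace E M]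

variable (E M) in
/-- Vector fields on the manifold `M` modelled on `E`. -/
abbrev VField : Type _ := Π p : M, TangentSpace 𝓘(ℝ, E) p

variable (E M) in
/-- Families of real-valued functions of two tangent vectors (used for the metric). -/
abbrev Tensor2 : Type _ := Π p : M, TangentSpace 𝓘(ℝ, E) p → TangentSpace 𝓘(ℝ, E) p → ℝ

/-- The derivative `X f` of a function along a vector field. -/
def dirDeriv (X : VField E M) (f : M → ℝ) : M → ℝ := fun p => mvfderiv 𝓘(ℝ, E) f p (X p)

variable [IsManifold 𝓘(ℝ, E) ∞ M]

/-- Smoothness of a vector field. -/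
def IsSmooth (X : VField E M) : Prop :=
  ContMDiff 𝓘(ℝ, E) 𝓘(ℝ, E).tangent ∞ (fun p => (⟨p, X p⟩ : TangentBundle 𝓘(ℝ, E) M))

variable (E M) in
/-- Smooth affine connections on `M`, i.e. smooth covariant derivatives on the tangent bundle. -/
structure AffineConnection where
  cov : CovariantDerivative 𝓘(ℝ, E) E (fun p : M => TangentSpace 𝓘(ℝ, E) p)
  smooth : cov.ContMDiffCovariantDerivative ∞

/-- `∇_X Y`. -/
def AffineConnection.nabla (D : AffineConnection E M) (X Y : VField E M) : VField E M :=
  fun p => D.cov Y p (X p)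

/-- The cubic form `C(X, Y, Z) = (∇_X g)(Y, Z)`. -/
def cubicForm (g : Tensor2 E M) (D : AffineConnection E M) (X Y Z : VField E M) : M → ℝ :=
  dirDeriv X (fun p => g p (Y p) (Z p)) - (fun p => g p (D.nabla X Y p) (Z p)) -
    (fun p => g p (Y p) (D.nabla X Z p))

/-- The covariant derivative `(∇_W T)(X, Y, Z)` of a `(0,3)`-tensor field `T`, given as a function
of three vector fields. -/
def nablaCubic (D : AffineConnection E M) (T : VField E M → VField E M → VField E M → M → ℝ)
    (W X Y Z : VField E M) : M → ℝ :=
  dirDeriv W (T X Y Z) - T (D.nabla W X) Y Z - T X (D.nabla W Y) Z - T X Y (D.nabla W Z)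

/-- The difference tensor `K(X, Y) = ∇_X Y - ∇̂_X Y`. -/
def differenceTensor (Dhat D : AffineConnection E M) (X Y : VField E M) : VField E M :=
  D.nabla X Y - Dhat.nabla X Y

/-- The covariant derivative `(∇_X T)(Y, Z)` of a `(1,2)`-tensor field `T`, given as a function
of two vector fields. -/
def nablaDifference (D : AffineConnection E M) (T : VField E M → VField E M → VField E M)
    (X Y Z : VField E M) : VField E M :=
  D.nabla X (T Y Z) - T (D.nabla X Y) Z - T Y (D.nabla X Z)

/-- Total symmetry of a tensor field, given as a function of `k` vector fields: invariance under
all permutations of the arguments. -/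
def TotallySymmetric {k : ℕ} {β : Type*} (T : (Fin k → VField E M) → β) : Prop :=
  ∀ X : Fin k → VField E M, (∀ i, IsSmooth (X i)) → ∀ σ : Equiv.Perm (Fin k), T (X ∘ σ) = T X

/-- The curvature `R(X, Y)Z = ∇_X ∇_Y Z - ∇_Y ∇_X Z - ∇_{[X, Y]} Z`. -/
def curvature (D : AffineConnection E M) (X Y Z : VField E M) : VField E M :=
  D.nabla X (D.nabla Y Z) - D.nabla Y (D.nabla X Z) -
    D.nabla (VectorField.mlieBracket 𝓘(ℝ, E) X Y) Z

/-- `D'` is the conjugate connection of `D`: `X g(Y, Z) = g(∇_X Y, Z) + g(Y, ∇*_X Z)`. -/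
def IsConjugate (g : Tensor2 E M) (D D' : AffineConnection E M) : Prop :=
  ∀ X Y Z : VField E M, IsSmooth X → IsSmooth Y → IsSmooth Z → ∀ p,
    dirDeriv X (fun q => g q (Y q) (Z q)) p =
      g p (D.nabla X Y p) (Z p) + g p (Y p) (D'.nabla X Z p)

/-- `(M, g, ∇)` is conjugate symmetric: the conjugate connection `∇*`, which is unique as an
operator on smooth vector fields, has the same curvature as `∇`. -/
def IsConjugateSymmetric (g : Tensor2 E M) (D : AffineConnection E M) : Prop :=
  ∃ D' : AffineConnection E M, IsConjugate g D D' ∧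
    ∀ X Y Z : VField E M, IsSmooth X → IsSmooth Y → IsSmooth Z →
      curvature D X Y Z = curvature D' X Y Z

/-- Left-invariance of a metric on a Lie group. -/
def IsLeftInvariantMetric [Group M] (g : Tensor2 E M) : Prop :=
  ∀ (a p : M) (u v : TangentSpace 𝓘(ℝ, E) p),
    g (a * p) (mfderiv 𝓘(ℝ, E) 𝓘(ℝ, E) (a * ·) p u) (mfderiv 𝓘(ℝ, E) 𝓘(ℝ, E) (a * ·) p v) =
      g p u v

/-- Left-invariance of a connection on a Lie group: every left translation `L_a` satisfies
`L_a^*(∇_X Y) = ∇_{L_a^* X} (L_a^* Y)`. -/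
def IsLeftInvariantConnection [Group M] (D : AffineConnection E M) : Prop :=
  ∀ (a : M) (X Y : VField E M), IsSmooth X → IsSmooth Y →
    VectorField.mpullback 𝓘(ℝ, E) 𝓘(ℝ, E) (a * ·) (D.nabla X Y) =
      D.nabla (VectorField.mpullback 𝓘(ℝ, E) 𝓘(ℝ, E) (a * ·) X)
        (VectorField.mpullback 𝓘(ℝ, E) 𝓘(ℝ, E) (a * ·) Y)

variable [FiniteDimensional ℝ E] [CompleteSpace E]

/-- `D` is the Levi-Civita connection of `g`: torsion-free and metric. -/
def IsLeviCivita (g : Tensor2 E M) (D : AffineConnection E M) : Prop :=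
  D.cov.torsion = 0 ∧
    ∀ X Y Z : VField E M, IsSmooth X → IsSmooth Y → IsSmooth Z → cubicForm g D X Y Z = 0

/-- `(g, ∇)` is a statistical structure: `∇` is torsion-free and the cubic form `∇g` is totally
symmetric. -/
def IsStatistical (g : Tensor2 E M) (D : AffineConnection E M) : Prop :=
  D.cov.torsion = 0 ∧
    TotallySymmetric (fun X : Fin 3 → VField E M => cubicForm g D (X 0) (X 1) (X 2))

end Geometry


/-- The group `Aff^s(n, ℝ) = R ⋉ ℝⁿ`, where `R` is the group of upper triangular matrices with
positive diagonal entries. The pair `(A, b)` stands for the affine map `x ↦ A x + b`. -/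
@[ext]
structure AffS (n : ℕ) where
  A : Matrix (Fin n) (Fin n) ℝ
  b : Fin n → ℝ
  upper : A.IsUpperTriangular
  pos : ∀ i, 0 < A i i

theorem det_pos_of_upper {n : ℕ} {A : Matrix (Fin n) (Fin n) ℝ} (hA : A.IsUpperTriangular)
    (hp : ∀ i, 0 < A i i) : 0 < A.det := by
  rw [Matrix.det_of_isUpperTriangular hA]
  exact Finset.prod_pos fun i _ => hp i

theorem inv_upper {n : ℕ} {A : Matrix (Fin n) (Fin n) ℝ} (hA : A.IsUpperTriangular)
    (hp : ∀ i, 0 < A i i) : (A⁻¹).IsUpperTriangular := by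
  have : Invertible A := A.invertibleOfIsUnitDet (det_pos_of_upper hA hp).ne'.isUnit
  exact blockTriangular_inv_of_blockTriangular hA

theorem mul_upper_diag {n : ℕ} {A B : Matrix (Fin n) (Fin n) ℝ} (hA : A.IsUpperTriangular)
    (hB : B.IsUpperTriangular) (i : Fin n) : (A * B) i i = A i i * B i i := by
  rw [Matrix.mul_apply]
  refine Finset.sum_eq_single i (fun k _ hk => ?_) (by simp)
  rcases lt_or_gt_of_ne hk with h | h
  · rw [hA (show id k < id i from h), zero_mul]
  · rw [hB (show id i < id k from h), mul_zero]

theorem inv_diag_pos {n : ℕ} {A : Matrix (Fin n) (Fin n) ℝ} (hA : A.IsUpperTriangular)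
    (hp : ∀ i, 0 < A i i) (i : Fin n) : 0 < A⁻¹ i i := by
  have h := mul_upper_diag hA (inv_upper hA hp) i
  rw [Matrix.mul_nonsing_inv _ (det_pos_of_upper hA hp).ne'.isUnit, Matrix.one_apply_eq] at h
  exact pos_of_mul_pos_right (h ▸ one_pos) (hp i).le

/-- Composition of affine maps: `(A, b) (A', b') = (A A', A b' + b)`. -/
instance (n : ℕ) : Group (AffS n) where
  mul x y := ⟨x.A * y.A, x.A *ᵥ y.b + x.b, x.upper.mul y.upper, fun i => by
    rw [mul_upper_diag x.upper y.upper]; exact mul_pos (x.pos i) (y.pos i)⟩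
  one := ⟨1, 0, blockTriangular_one, fun i => by simp⟩
  inv x := ⟨x.A⁻¹, -(x.A⁻¹ *ᵥ x.b), inv_upper x.upper x.pos, inv_diag_pos x.upper x.pos⟩
  mul_assoc x y z := by
    refine AffS.ext (Matrix.mul_assoc _ _ _) ?_
    change (x.A * y.A) *ᵥ z.b + (x.A *ᵥ y.b + x.b) = x.A *ᵥ (y.A *ᵥ z.b + y.b) + x.b
    rw [Matrix.mulVec_add, Matrix.mulVec_mulVec, add_assoc]
  one_mul x := by
    refine AffS.ext (Matrix.one_mul _) ?_
    change (1 : Matrix (Fin n) (Fin n) ℝ) *ᵥ x.b + 0 = x.b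
    simp
  mul_one x := by
    refine AffS.ext (Matrix.mul_one _) ?_
    change x.A *ᵥ 0 + x.b = x.b
    simp
  inv_mul_cancel x := by
    refine AffS.ext (Matrix.nonsing_inv_mul _ (det_pos_of_upper x.upper x.pos).ne'.isUnit) ?_
    change x.A⁻¹ *ᵥ x.b + -(x.A⁻¹ *ᵥ x.b) = 0
    simp

/-- The vector space of symmetric `n × n` real matrices, as a subspace of `Fin n → Fin n → ℝ`
(which, unlike `Matrix`, carries a norm by default). -/
def SymMat (n : ℕ) : Submodule ℝ (Fin n → Fin n → ℝ) where
  carrier := {S | (Matrix.of S).IsSymm}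
  add_mem' := fun ha hb => ha.add hb
  zero_mem' := Matrix.isSymm_zero
  smul_mem' := fun c _ hS => hS.smul c

/-- The vector space `ℝⁿ × Sym(n, ℝ)`, in which the parameters `(μ, Σ)` live. -/
abbrev Param (n : ℕ) : Type := (Fin n → ℝ) × SymMat n

theorem isOpen_posDef (n : ℕ) :
    IsOpen {θ : Param n | (Matrix.of θ.2.1).PosDef} := by
  rw [isOpen_iff_mem_nhds]
  intro θ hθ
  have hcont : Continuous fun q : Param n × (Fin n → ℝ) =>
      q.2 ⬝ᵥ (Matrix.of q.1.2.1 *ᵥ q.2) := by fun_prop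
  have key : ∀ᶠ η : Param n in 𝓝 θ, ∀ x ∈ Metric.sphere (0 : Fin n → ℝ) 1,
      0 < x ⬝ᵥ (Matrix.of η.2.1 *ᵥ x) := by
    refine (isCompact_sphere _ _).eventually_forall_of_forall_eventually fun x hx => ?_
    refine hcont.continuousAt.eventually_const_lt (u := 0) ?_
    have hx0 : x ≠ 0 := by rintro rfl; simp at hx
    simpa using (Matrix.posDef_iff_dotProduct_mulVec.1 hθ).2 hx0
  filter_upwards [key] with η hη
  refine Matrix.posDef_iff_dotProduct_mulVec.2 ⟨?_, fun x hx => ?_⟩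
  · rw [Matrix.IsHermitian, Matrix.conjTranspose_eq_transpose_of_trivial]
    exact η.2.2
  · have hn : 0 < ‖x‖ := norm_pos_iff.2 hx
    have := hη (‖x‖⁻¹ • x) (by simp [norm_smul, hn.ne'])
    simp only [Matrix.mulVec_smul, smul_dotProduct, dotProduct_smul, smul_eq_mul] at this
    have h2 : 0 < ‖x‖⁻¹ := inv_pos.2 hn
    simpa using (pos_of_mul_pos_right (pos_of_mul_pos_right this h2.le) h2.le)

/-- The family of `n`-variate normal distributions: the open subset `ℝⁿ × Sym⁺(n, ℝ)` of
`ℝⁿ × Sym(n, ℝ)`, with its structure of an open submanifold. -/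
def normalOpens (n : ℕ) : TopologicalSpace.Opens (Param n) :=
  ⟨{θ | (Matrix.of θ.2.1).PosDef}, isOpen_posDef n⟩

abbrev NormalFamily (n : ℕ) : Type := normalOpens n

def NormalFamily.mean {n : ℕ} (θ : NormalFamily n) : Fin n → ℝ := θ.1.1

def NormalFamily.cov {n : ℕ} (θ : NormalFamily n) : Matrix (Fin n) (Fin n) ℝ := Matrix.of θ.1.2.1

theorem posDef_mul_transpose {n : ℕ} (x : AffS n) : (x.A * x.Aᵀ).PosDef := by
  have hu : IsUnit x.A :=
    (Matrix.isUnit_iff_isUnit_det _).2 (det_pos_of_upper x.upper x.pos).ne'.isUnit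
  have := Matrix.PosDef.mul_mul_conjTranspose_same (Matrix.PosDef.one (n := Fin n) (R := ℝ))
    (B := x.A) (Matrix.vecMul_injective_of_isUnit hu)
  simpa [Matrix.conjTranspose_eq_transpose_of_trivial] using this

/-- The map `φ(A, b) = (b, A Aᵀ)`, the image of the standard normal distribution `(0, I)` under
the action `(A, b) · (μ, Σ) = (A μ + b, A Σ Aᵀ)`. -/
def phi {n : ℕ} (x : AffS n) : NormalFamily n :=
  ⟨(x.b, ⟨x.A * x.Aᵀ, Matrix.isSymm_mul_transpose_self _⟩), posDef_mul_transpose x⟩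

theorem phi_injective (n : ℕ) : Function.Injective (phi (n := n)) := by
  intro x y h
  have hb : x.b = y.b := congrArg (fun θ : NormalFamily n => θ.mean) h
  have hA : x.A * x.Aᵀ = y.A * y.Aᵀ := congrArg (fun θ : NormalFamily n => θ.cov) h
  have ux := (det_pos_of_upper x.upper x.pos).ne'.isUnit
  have uy := (det_pos_of_upper y.upper y.pos).ne'.isUnit
  set D := y.A⁻¹ * x.A with hD
  have hDu : D.IsUpperTriangular := (inv_upper y.upper y.pos).mul x.upper
  have hDp : ∀ i, 0 < D i i := fun i => by
    rw [hD, mul_upper_diag (inv_upper y.upper y.pos) x.upper]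
    exact mul_pos (inv_diag_pos y.upper y.pos i) (x.pos i)
  have hDD : D * Dᵀ = 1 := by
    rw [hD, Matrix.transpose_mul, Matrix.mul_assoc, ← Matrix.mul_assoc x.A, hA,
      Matrix.mul_assoc y.A, ← Matrix.transpose_mul, Matrix.nonsing_inv_mul _ uy,
      Matrix.transpose_one, Matrix.mul_one, Matrix.nonsing_inv_mul _ uy]
  have hDt : Dᵀ = D⁻¹ := (Matrix.inv_eq_right_inv hDD).symm
  have hDtu : (Dᵀ).IsUpperTriangular := hDt ▸ inv_upper hDu hDp
  have hD1 : D = 1 := by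
    ext i j
    rcases lt_trichotomy i j with h | rfl | h
    · rw [Matrix.one_apply_ne h.ne]
      exact hDtu (show id i < id j from h)
    · have h1 := mul_upper_diag hDu hDtu i
      rw [hDD, Matrix.one_apply_eq, Matrix.transpose_apply] at h1
      rw [Matrix.one_apply_eq]
      nlinarith [hDp i]
    · rw [Matrix.one_apply_ne h.ne']
      exact hDu (show id j < id i from h)
  refine AffS.ext ?_ hb
  have : y.A * D = x.A := by
    rw [hD, ← Matrix.mul_assoc, Matrix.mul_nonsing_inv _ uy, Matrix.one_mul]
  rw [← this, hD1, Matrix.mul_one]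

theorem phi_surjective (n : ℕ) : Function.Surjective (phi (n := n)) := by
  rintro ⟨⟨μ, S⟩, hS⟩
  change (Matrix.of S.1).PosDef at hS
  set T : Matrix (Fin n) (Fin n) ℝ := Matrix.of S.1 with hT
  have hTi : (T⁻¹).PosDef := hS.inv
  set L := LDL.lowerInv hTi with hL
  have hLinv : IsUnit L.det :=
    (Matrix.isUnit_iff_isUnit_det _).1 (isUnit_of_invertible (LDL.lowerInv hTi))
  have hLtri : (Lᵀ).IsUpperTriangular := fun i j h => LDL.lowerInv_triangular hTi h
  have hLd : ∀ i, L i i ≠ 0 := fun i hi => by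
    have : L.det = 0 := by
      rw [← Matrix.det_transpose, Matrix.det_of_isUpperTriangular hLtri]
      exact Finset.prod_eq_zero (Finset.mem_univ i) hi
    exact hLinv.ne_zero this
  have hdiag : Matrix.diagonal (LDL.diagEntries hTi) = L * T⁻¹ * Lᵀ := by
    simpa [LDL.diag, Matrix.conjTranspose_eq_transpose_of_trivial] using
      LDL.diag_eq_lowerInv_conj hTi
  have hdpos : ∀ i, 0 < LDL.diagEntries hTi i := by
    have : (Matrix.diagonal (LDL.diagEntries hTi)).PosDef := by
      rw [hdiag, ← Matrix.conjTranspose_eq_transpose_of_trivial]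
      exact hTi.mul_mul_conjTranspose_same (Matrix.vecMul_injective_of_isUnit
        ((Matrix.isUnit_iff_isUnit_det _).2 hLinv))
    exact Matrix.posDef_diagonal_iff.1 this
  set d := LDL.diagEntries hTi with hd
  set e : Fin n → ℝ := fun i => (SignType.sign (L i i) : ℝ) * (Real.sqrt (d i))⁻¹ with he
  have hee : ∀ i, e i * e i = (d i)⁻¹ := fun i => by
    have h1 : (SignType.sign (L i i) : ℝ) * (SignType.sign (L i i) : ℝ) = 1 := by
      rcases lt_or_gt_of_ne (hLd i) with h | h <;> simp [sign_neg, sign_pos, h]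
    have h2 : Real.sqrt (d i) * Real.sqrt (d i) = d i := Real.mul_self_sqrt (hdpos i).le
    calc e i * e i = ((SignType.sign (L i i) : ℝ) * (SignType.sign (L i i) : ℝ)) *
          (Real.sqrt (d i) * Real.sqrt (d i))⁻¹ := by rw [he, mul_inv]; ring
      _ = _ := by rw [h1, h2, one_mul]
  refine ⟨⟨Lᵀ * Matrix.diagonal e, μ, hLtri.mul (blockTriangular_diagonal e), fun i => ?_⟩, ?_⟩
  · rw [Matrix.mul_diagonal, Matrix.transpose_apply, he]
    have h1 : L i i * (SignType.sign (L i i) : ℝ) = |L i i| := self_mul_sign _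
    rw [← mul_assoc, h1]
    exact mul_pos (abs_pos.2 (hLd i)) (inv_pos.2 (Real.sqrt_pos.2 (hdpos i)))
  · have hdinv : Matrix.diagonal e * (Matrix.diagonal e)ᵀ = (Matrix.diagonal d)⁻¹ := by
      rw [Matrix.diagonal_transpose, Matrix.diagonal_mul_diagonal]
      refine (Matrix.inv_eq_right_inv ?_).symm
      rw [Matrix.diagonal_mul_diagonal, ← Matrix.diagonal_one]
      congr 1
      ext i
      rw [hee, mul_inv_cancel₀ (hdpos i).ne']
    have hprod : Lᵀ * Matrix.diagonal e * (Lᵀ * Matrix.diagonal e)ᵀ = T := by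
      rw [Matrix.transpose_mul, Matrix.transpose_transpose, Matrix.mul_assoc,
        ← Matrix.mul_assoc (Matrix.diagonal e), hdinv, hdiag, Matrix.mul_inv_rev,
        Matrix.mul_inv_rev, Matrix.nonsing_inv_nonsing_inv _ hS.det_pos.ne'.isUnit,
        ← Matrix.mul_assoc, ← Matrix.mul_assoc, Matrix.mul_nonsing_inv _
          (by rwa [Matrix.det_transpose]), Matrix.one_mul, Matrix.mul_assoc,
        Matrix.nonsing_inv_mul _ hLinv, Matrix.mul_one]
    exact Subtype.ext (Prod.ext rfl (Subtype.ext hprod))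

/-- The bijection `φ : Aff^s(n, ℝ) ≃ 𝒩`. -/
def phiEquiv (n : ℕ) : AffS n ≃ NormalFamily n :=
  Equiv.ofBijective phi ⟨phi_injective n, phi_surjective n⟩

/-- The group structure of `𝒩` that makes `φ : Aff^s(n, ℝ) → 𝒩` an isomorphism. -/
instance (n : ℕ) : Group (NormalFamily n) := (phiEquiv n).symm.group

/-- The density `p(x, θ)` of the `n`-variate normal distribution with parameter `θ = (μ, Σ)`. -/
def density {n : ℕ} (x : Fin n → ℝ) (θ : NormalFamily n) : ℝ :=
  (Real.sqrt ((2 * Real.pi) ^ n * θ.cov.det))⁻¹ *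
    Real.exp (-(1 / 2) * ((x - θ.mean) ⬝ᵥ (θ.cov⁻¹ *ᵥ (x - θ.mean))))

/-- The derivative `X log p(x, θ)` of the log-density in the direction of the tangent vector `X`
at `θ`. -/
def score {n : ℕ} (x : Fin n → ℝ) (θ : NormalFamily n) (X : TangentSpace 𝓘(ℝ, Param n) θ) : ℝ :=
  mvfderiv 𝓘(ℝ, Param n) (fun η : NormalFamily n => Real.log (density x η)) θ X

/-- The Fisher metric `g^F`. -/
def fisherMetric (n : ℕ) : Tensor2 (Param n) (NormalFamily n) := fun θ X Y =>
  ∫ x : Fin n → ℝ, density x θ * score x θ X * score x θ Y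

/-- The Amari–Chentsov cubic form `C^A`. -/
def amariChentsovCubic {n : ℕ} (θ : NormalFamily n) (X Y Z : TangentSpace 𝓘(ℝ, Param n) θ) : ℝ :=
  ∫ x : Fin n → ℝ, density x θ * score x θ X * score x θ Y * score x θ Z

/-- `D` is an Amari–Chentsov `α`-connection for some `α ∈ ℝ`, where `Dhat` is the Levi-Civita
connection of the Fisher metric. -/
def IsAmariChentsov {n : ℕ} (Dhat D : AffineConnection (Param n) (NormalFamily n)) : Prop :=
  ∃ α : ℝ, ∀ X Y Z : VField (Param n) (NormalFamily n), IsSmooth X → IsSmooth Y → IsSmooth Z → ∀ θ,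
    fisherMetric n θ (D.nabla X Y θ) (Z θ) =
      fisherMetric n θ (Dhat.nabla X Y θ) (Z θ) -
        α / 2 * amariChentsovCubic θ (X θ) (Y θ) (Z θ)

end NormalDist
end

open NormalDist

/-!
Identify each tangent space with `ℝⁿ × Sym(n, ℝ)` through the left-invariant frame. In this frame
the Fisher metric and the Amari–Chentsov cubic form are constant, and a left-invariant connection is
a bilinear map, so everything reduces to algebra at the standard normal distribution; the two forms
are there computed from the moments of the score. If `L` denotes the coefficients of the Levi-Civita
connection and `c` the cubic form of the difference tensor `K`, each of the conditions 2–5 says that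
the derivative of `c` along `L` satisfies the Codazzi equation, because the contribution of `K` to
`∇C` is always symmetric, and the curvatures of the conjugate connections `∇̂ ± K` differ by twice
the antisymmetrization of `∇̂K`.

It remains to see that the Codazzi equation characterizes the multiples of the Amari–Chentsov form.
Sending `(m, S)` to the symmetric matrix of size `n + 1` with blocks `S`, `m`, `mᵀ`, `0` (the
Calvo–Oller embedding) turns the Levi-Civita operators into commutators with skew-symmetric
matrices. They vanish in diagonal directions, and in the others they are the rotations of the
coordinate planes; so the Codazzi equation says that the derivative of `c` along a rotation vanishes
once another argument is diagonal. These linear equations determine `c` up to a scalar.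
-/

noncomputable section

namespace NormalDist

section OpenSubmanifold

open TopologicalSpace

variable {E : Type*} [NormedAddCommGroup E] {U : Opens E}
  {F : Type*} [NormedAddCommGroup F] [NormedSpace ℝ F]

/-- The inverse of the chart of an open subset of a normed space, as a retraction onto it. -/
def retr (p : U) : E → U := (chartAt E p).symm

theorem mem_chartAt_source_opens (p q : U) : q ∈ (chartAt E p).source := by
  rw [Opens.chartAt_eq, OpenPartialHomeomorph.subtypeRestr_source]
  exact Set.mem_univ _

theorem retr_coe (p q : U) : retr p q.1 = q :=
  (chartAt E p).left_inv (mem_chartAt_source_opens p q)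

theorem retr_val (p : U) {x : E} (hx : x ∈ U) : (retr p x).1 = x :=
  congrArg Subtype.val (retr_coe p ⟨x, hx⟩)

theorem eventually_retr (p : U) : ∀ᶠ x in 𝓝 p.1, (retr p x).1 = x := by
  filter_upwards [U.isOpen.mem_nhds p.2] with x hx using retr_val p hx

theorem continuousAt_retr (p : U) : ContinuousAt (retr p) p.1 := by
  rw [ContinuousAt, Topology.IsInducing.subtypeVal.tendsto_nhds_iff, retr_coe p p]
  exact (Filter.tendsto_congr' (eventually_retr p)).2 Filter.tendsto_id

theorem continuousAt_iff_retr {X : Type*} [TopologicalSpace X] {f : U → X} {p : U} :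
    ContinuousAt f p ↔ ContinuousAt (f ∘ retr p) p.1 := by
  refine ⟨fun h => ContinuousAt.comp (by rwa [retr_coe]) (continuousAt_retr p), fun h => ?_⟩
  have hf : f = (f ∘ retr p) ∘ Subtype.val := funext fun q => congrArg f (retr_coe p q).symm
  rw [hf]
  exact h.comp continuous_subtype_val.continuousAt

variable [NormedSpace ℝ E]

theorem contMDiffAt_iff_retr {k : ℕ∞ω} {f : U → F} {p : U} :
    ContMDiffAt 𝓘(ℝ, E) 𝓘(ℝ, F) k f p ↔ ContDiffAt ℝ k (f ∘ retr p) p.1 := by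
  have hchart : (extChartAt 𝓘(ℝ, F) (f p) ∘ f ∘ (extChartAt 𝓘(ℝ, E) p).symm) = f ∘ retr p := rfl
  rw [contMDiffAt_iff, continuousAt_iff_retr, hchart]
  simp only [modelWithCornersSelf_coe, Set.range_id, contDiffWithinAt_univ]
  exact ⟨fun h => h.2, fun h => ⟨h.continuousAt, h⟩⟩

theorem mdifferentiableAt_iff_retr {f : U → F} {p : U} :
    MDifferentiableAt 𝓘(ℝ, E) 𝓘(ℝ, F) f p ↔ DifferentiableAt ℝ (f ∘ retr p) p.1 := by
  have hchart : writtenInExtChartAt 𝓘(ℝ, E) 𝓘(ℝ, F) p f = f ∘ retr p := rfl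
  rw [mdifferentiableAt_iff, continuousAt_iff_retr, hchart]
  simp only [modelWithCornersSelf_coe, Set.range_id, differentiableWithinAt_univ]
  exact ⟨fun h => h.2, fun h => ⟨h.continuousAt, h⟩⟩

theorem mfderiv_eq_retr (f : U → F) (p : U) :
    (mfderiv 𝓘(ℝ, E) 𝓘(ℝ, F) f p : E →L[ℝ] F) = fderiv ℝ (f ∘ retr p) p.1 := by
  by_cases h : MDifferentiableAt 𝓘(ℝ, E) 𝓘(ℝ, F) f p
  · refine h.mfderiv.trans ?_
    change fderivWithin ℝ (f ∘ retr p) (Set.range id) p.1 = _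
    rw [Set.range_id, fderivWithin_univ]
  · rw [mfderiv_zero_of_not_mdifferentiableAt h, fderiv_zero_of_not_differentiableAt
      (mt mdifferentiableAt_iff_retr.2 h)]
    rfl

theorem mvfderiv_eq_retr (f : U → F) (p : U) (v : E) :
    mvfderiv 𝓘(ℝ, E) f p v = fderiv ℝ (f ∘ retr p) p.1 v := by
  rw [← mfderiv_eq_retr]; rfl

theorem contMDiff_iff_retr {k : ℕ∞ω} {f : U → F} :
    ContMDiff 𝓘(ℝ, E) 𝓘(ℝ, F) k f ↔ ∀ p : U, ContDiffAt ℝ k (f ∘ retr p) p.1 :=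
  forall_congr' fun _ => contMDiffAt_iff_retr

theorem coordChange_opens (p q x : U) :
    (tangentBundleCore 𝓘(ℝ, E) U).coordChange (achart E p) (achart E q) x =
      ContinuousLinearMap.id ℝ E := by
  ext v
  exact (tangentBundleCore 𝓘(ℝ, E) U).coordChange_self (achart E p) x
    (mem_chartAt_source_opens p x) v

theorem trivializationAt_opens (p : U) (z : TangentBundle 𝓘(ℝ, E) U) :
    (trivializationAt E (TangentSpace 𝓘(ℝ, E)) p z).2 = z.2 :=
  congrArg (fun L : E →L[ℝ] E => L z.2) (coordChange_opens z.1 p z.1)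

theorem continuousLinearMapAt_opens (p q : U) :
    (trivializationAt E (TangentSpace 𝓘(ℝ, E)) p).continuousLinearMapAt ℝ q =
      ContinuousLinearMap.id ℝ E := by
  rw [TangentBundle.continuousLinearMapAt_trivializationAt_eq_core, coordChange_opens]
  exact mem_chartAt_source_opens p q

theorem symmL_opens (p q : U) :
    (trivializationAt E (TangentSpace 𝓘(ℝ, E)) p).symmL ℝ q =
      ContinuousLinearMap.id ℝ E := by
  rw [TangentBundle.symmL_trivializationAt_eq_core, coordChange_opens]
  exact mem_chartAt_source_opens p q

theorem contMDiffAt_vfield_iff {k : ℕ∞ω} {X : VField E U} {p : U} :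
    ContMDiffAt 𝓘(ℝ, E) 𝓘(ℝ, E).tangent k (fun p => (⟨p, X p⟩ : TangentBundle 𝓘(ℝ, E) U)) p ↔
      ContMDiffAt 𝓘(ℝ, E) 𝓘(ℝ, E) k (X : U → E) p := by
  refine (Bundle.contMDiffAt_section _).trans ?_
  simp only [trivializationAt_opens]

theorem isSmooth_iff {X : VField E U} :
    IsSmooth X ↔ ContMDiff 𝓘(ℝ, E) 𝓘(ℝ, E) ∞ (X : U → E) :=
  forall_congr' fun _ => contMDiffAt_vfield_iff

theorem mdifferentiableAt_vfield_iff {X : VField E U} {p : U} :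
    MDifferentiableAt 𝓘(ℝ, E) 𝓘(ℝ, E).tangent
      (fun p => (⟨p, X p⟩ : TangentBundle 𝓘(ℝ, E) U)) p ↔
      MDifferentiableAt 𝓘(ℝ, E) 𝓘(ℝ, E) (X : U → E) p := by
  refine (mdifferentiableAt_section _ _).trans ?_
  simp only [trivializationAt_opens]

theorem contMDiff_endo_iff {k : ℕ∞ω} {A : U → E →L[ℝ] E} :
    ContMDiff 𝓘(ℝ, E) (𝓘(ℝ, E).prod 𝓘(ℝ, E →L[ℝ] E)) k
      (fun p => (⟨p, A p⟩ : Bundle.TotalSpace (E →L[ℝ] E)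
        fun p : U => TangentSpace 𝓘(ℝ, E) p →L[ℝ] TangentSpace 𝓘(ℝ, E) p)) ↔
    ContMDiff 𝓘(ℝ, E) 𝓘(ℝ, E →L[ℝ] E) k A := by
  refine forall_congr' fun p => (Bundle.contMDiffAt_section _).trans ?_
  have hcoord : (fun q => (trivializationAt (E →L[ℝ] E)
      (fun p : U => TangentSpace 𝓘(ℝ, E) p →L[ℝ] TangentSpace 𝓘(ℝ, E) p) p ⟨q, A q⟩).2) = A := by
    ext1 q
    rw [hom_trivializationAt_apply]
    simp only [ContinuousLinearMap.inCoordinates]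
    rw [continuousLinearMapAt_opens, symmL_opens]
    rfl
  rw [hcoord]

theorem contMDiff_bilin_iff {k : ℕ∞ω} {B : U → E →L[ℝ] E →L[ℝ] ℝ} :
    ContMDiff 𝓘(ℝ, E) (𝓘(ℝ, E).prod 𝓘(ℝ, E →L[ℝ] E →L[ℝ] ℝ)) k
      (fun p => (⟨p, B p⟩ : Bundle.TotalSpace (E →L[ℝ] E →L[ℝ] ℝ)
        fun p : U => TangentSpace 𝓘(ℝ, E) p →L[ℝ] TangentSpace 𝓘(ℝ, E) p →L[ℝ] ℝ)) ↔
    ContMDiff 𝓘(ℝ, E) 𝓘(ℝ, E →L[ℝ] E →L[ℝ] ℝ) k B := by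
  refine forall_congr' fun p => (Bundle.contMDiffAt_section _).trans ?_
  have hcoord : (fun q => (trivializationAt (E →L[ℝ] E →L[ℝ] ℝ)
      (fun p : U => TangentSpace 𝓘(ℝ, E) p →L[ℝ] TangentSpace 𝓘(ℝ, E) p →L[ℝ] ℝ) p
        ⟨q, B q⟩).2) = B := by
    ext q v w
    rw [hom_trivializationAt_apply]
    refine (inCoordinates_apply_eq₂ (mem_chartAt_source_opens p q) (mem_chartAt_source_opens p q)
      (Set.mem_univ _)).trans ?_
    rw [← Bundle.Trivialization.symmL_apply (R := ℝ), ← Bundle.Trivialization.symmL_apply (R := ℝ),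
      symmL_opens]
    · simp only [Bundle.Trivial.fiberBundle_trivializationAt',
        Bundle.Trivial.linearMapAt_trivialization]
      rfl
    · exact mem_chartAt_source_opens p q
    · exact mem_chartAt_source_opens p q
  rw [hcoord]

theorem mlieBracket_opens (X Y : VField E U) (p : U) :
    VectorField.mlieBracket 𝓘(ℝ, E) X Y p =
      fderiv ℝ ((Y : U → E) ∘ retr p) p.1 (X p) - fderiv ℝ ((X : U → E) ∘ retr p) p.1 (Y p) := by
  have hpull : ∀ Z : VField E U, VectorField.mpullbackWithin 𝓘(ℝ, E) 𝓘(ℝ, E)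
      (extChartAt 𝓘(ℝ, E) p).symm Z (Set.range 𝓘(ℝ, E)) =ᶠ[𝓝 p.1] (Z : U → E) ∘ retr p := by
    intro Z
    filter_upwards [U.isOpen.mem_nhds p.2] with x hx
    have h := TangentBundle.symmL_trivializationAt (I := 𝓘(ℝ, E))
      (mem_chartAt_source_opens p ⟨x, hx⟩)
    rw [symmL_opens] at h
    have h' : mfderivWithin 𝓘(ℝ, E) 𝓘(ℝ, E) (extChartAt 𝓘(ℝ, E) p).symm (Set.range 𝓘(ℝ, E)) x =
      ContinuousLinearMap.id ℝ E := h.symm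
    rw [VectorField.mpullbackWithin_apply, h']
    exact congrArg (fun L : E →L[ℝ] E => L (Z (retr p x))) ContinuousLinearMap.inverse_id
  have h := TangentBundle.continuousLinearMapAt_trivializationAt (I := 𝓘(ℝ, E))
    (mem_chartAt_source_opens p p)
  rw [continuousLinearMapAt_opens] at h
  rw [VectorField.mlieBracket, VectorField.mlieBracketWithin_apply, ← h]
  refine (congrArg (fun L : E →L[ℝ] E => L _) ContinuousLinearMap.inverse_id).trans ?_
  refine ((hpull X).lieBracketWithin_vectorField_eq_nhds (hpull Y)).trans ?_
  simp only [VectorField.lieBracketWithin, modelWithCornersSelf_coe, Set.range_id,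
    Set.preimage_univ, Set.inter_univ, fderivWithin_univ]
  have hv : ∀ Z : U → E, (Z ∘ retr p) p.1 = Z p := fun Z => congrArg Z (retr_coe p p)
  exact congrArg₂ (· - ·) (congrArg _ (hv X)) (congrArg _ (hv Y))

end OpenSubmanifold

section ParamAlgebra

variable {n : ℕ}

/-- The covariance component of a tangent vector, as a matrix. -/
def cmat (X : Param n) : Matrix (Fin n) (Fin n) ℝ := Matrix.of X.2.1

/-- The tangent vector with mean component `m` and covariance component `S`. -/
def mkParam (m : Fin n → ℝ) (S : Matrix (Fin n) (Fin n) ℝ) (h : Sᵀ = S) : Param n := (m, ⟨S, h⟩)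

@[simp] theorem cmat_mkParam (m : Fin n → ℝ) (S : Matrix (Fin n) (Fin n) ℝ) (h : Sᵀ = S) :
    cmat (mkParam m S h) = S := rfl

@[simp] theorem fst_mkParam (m : Fin n → ℝ) (S : Matrix (Fin n) (Fin n) ℝ) (h : Sᵀ = S) :
    (mkParam m S h).1 = m := rfl

@[simp] theorem cmat_zero : cmat (0 : Param n) = 0 := rfl
@[simp] theorem cmat_add (X Y : Param n) : cmat (X + Y) = cmat X + cmat Y := rfl
@[simp] theorem cmat_sub (X Y : Param n) : cmat (X - Y) = cmat X - cmat Y := rfl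
@[simp] theorem cmat_smul (a : ℝ) (X : Param n) : cmat (a • X) = a • cmat X := rfl

theorem isSymm_cmat (X : Param n) : (cmat X).IsSymm := X.2.2

@[simp] theorem transpose_cmat (X : Param n) : (cmat X)ᵀ = cmat X := X.2.2

theorem param_ext {X Y : Param n} (h₁ : X.1 = Y.1) (h₂ : cmat X = cmat Y) : X = Y :=
  Prod.ext h₁ (Subtype.ext h₂)

/-- The upper triangular matrix `a` with `a + aᵀ = S`, for `S` symmetric. -/
def halfUpper (S : Matrix (Fin n) (Fin n) ℝ) : Matrix (Fin n) (Fin n) ℝ :=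
  Matrix.of fun i j => if i < j then S i j else if i = j then S i j / 2 else 0

theorem halfUpper_upper (S : Matrix (Fin n) (Fin n) ℝ) : (halfUpper S).IsUpperTriangular := by
  intro i j (h : j < i)
  simp [halfUpper, h.ne', not_lt_of_gt h]

theorem halfUpper_add_transpose {S : Matrix (Fin n) (Fin n) ℝ} (hS : S.IsSymm) :
    halfUpper S + (halfUpper S)ᵀ = S := by
  ext i j
  simp only [halfUpper, Matrix.add_apply, Matrix.transpose_apply, Matrix.of_apply]
  rcases lt_trichotomy i j with h | h | h
  · simp [h, h.ne', not_lt_of_gt h]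
  · subst h; simp
  · simp [h, h.ne', not_lt_of_gt h, hS.apply]

theorem halfUpper_eq {S B : Matrix (Fin n) (Fin n) ℝ} (hB : B.IsUpperTriangular)
    (h : B + Bᵀ = S) : halfUpper S = B := by
  subst h
  ext i j
  simp only [halfUpper, Matrix.add_apply, Matrix.transpose_apply, Matrix.of_apply]
  rcases lt_trichotomy i j with h | h | h
  · simp [h, show B j i = 0 from hB h]
  · subst h; simp
  · simp [h.ne', not_lt_of_gt h, show B i j = 0 from hB h]

theorem halfUpper_add (S T : Matrix (Fin n) (Fin n) ℝ) :
    halfUpper (S + T) = halfUpper S + halfUpper T := by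
  ext i j
  simp only [halfUpper, Matrix.add_apply, Matrix.of_apply]
  split_ifs <;> ring

theorem halfUpper_smul (a : ℝ) (S : Matrix (Fin n) (Fin n) ℝ) :
    halfUpper (a • S) = a • halfUpper S := by
  ext i j
  simp only [halfUpper, Matrix.smul_apply, Matrix.of_apply, smul_eq_mul, mul_ite, mul_zero,
    mul_div_assoc]

theorem halfUpper_diag (S : Matrix (Fin n) (Fin n) ℝ) (i : Fin n) :
    halfUpper S i i = S i i / 2 := by simp [halfUpper]

/-- The derivative at the identity of the action `(A, b) · (m, S) = (A m, A S Aᵀ)` of `Aff^s(n, ℝ)`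
on tangent vectors, in the direction `W` of the group. -/
def rhoOp (W X : Param n) : Param n :=
  mkParam (halfUpper (cmat W) *ᵥ X.1)
    (halfUpper (cmat W) * cmat X + cmat X * (halfUpper (cmat W))ᵀ) (by simp [add_comm])

end ParamAlgebra

section Augmented

variable {n : ℕ}

/-- Index set of the symmetric matrices of size `n + 1` that represent tangent vectors; the extra
index is `Sum.inr ()`. -/
abbrev AugIndex (n : ℕ) : Type := Fin n ⊕ Unit

/-- The tangent vector `(m, S)` as the symmetric matrix with blocks `S`, `m`, `mᵀ` and `0`
(the Calvo–Oller embedding). -/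
def augment : Param n →ₗ[ℝ] Matrix (AugIndex n) (AugIndex n) ℝ where
  toFun X := fromBlocks (cmat X) (replicateCol Unit X.1) (replicateRow Unit X.1) 0
  map_add' X Y := by simp [fromBlocks_add]
  map_smul' a X := by simp [fromBlocks_smul]

/-- The retraction of `augment` that symmetrizes a matrix and drops its last diagonal entry. -/
def compress : Matrix (AugIndex n) (AugIndex n) ℝ →ₗ[ℝ] Param n where
  toFun M := mkParam (fun i => (M (.inl i) (.inr ()) + M (.inr ()) (.inl i)) / 2)
    ((1 / 2 : ℝ) • (M.toBlocks₁₁ + M.toBlocks₁₁ᵀ)) (by simp [add_comm])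
  map_add' M N := param_ext (by ext i; simp; ring) (by ext i j; simp [toBlocks₁₁]; ring)
  map_smul' a M := param_ext (by ext i; simp; ring) (by ext i j; simp [toBlocks₁₁]; ring)

theorem transpose_augment (X : Param n) : (augment X)ᵀ = augment X := by
  simp [augment, fromBlocks_transpose]

theorem compress_augment (X : Param n) : compress (augment X) = X :=
  param_ext (by ext i; simp [augment, compress])
    (by ext i j; simp [augment, compress]; ring)

theorem compress_transpose (M : Matrix (AugIndex n) (AugIndex n) ℝ) :
    compress Mᵀ = compress M :=
  param_ext (by ext i; simp [compress, add_comm])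
    (by ext i j; simp [compress, toBlocks₁₁, add_comm])

theorem augment_compress (M : Matrix (AugIndex n) (AugIndex n) ℝ) :
    augment (compress M) =
      (1 / 2 : ℝ) • (M + Mᵀ) - M (.inr ()) (.inr ()) • single (.inr ()) (.inr ()) 1 := by
  ext (i | i) (j | j) <;> simp [augment, compress, toBlocks₁₁] <;> ring

theorem augment_inr (X : Param n) : augment X (.inr ()) (.inr ()) = 0 := rfl

theorem augment_mul_augment_inr (X Y : Param n) :
    (augment X * augment Y) (.inr ()) (.inr ()) = X.1 ⬝ᵥ Y.1 := by
  simp [augment, Matrix.mul_apply, dotProduct]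

/-- The Fisher metric at the standard normal distribution. -/
def metricForm (X Y : Param n) : ℝ := 1 / 2 * (augment X * augment Y).trace

/-- The Amari–Chentsov cubic form at the standard normal distribution, as a trilinear map. -/
def cubicLin (n : ℕ) : Param n →ₗ[ℝ] Param n →ₗ[ℝ] Param n →ₗ[ℝ] ℝ :=
  ((LinearMap.mul ℝ (Matrix (AugIndex n) (AugIndex n) ℝ)).compl₁₂ augment augment).compr₂
    (((LinearMap.mul ℝ (Matrix (AugIndex n) (AugIndex n) ℝ)).compr₂
      (traceLinearMap (AugIndex n) ℝ ℝ)).compl₂ augment)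

theorem cubicLin_apply (X Y Z : Param n) :
    cubicLin n X Y Z = (augment X * augment Y * augment Z).trace := rfl

theorem metricForm_comm (X Y : Param n) : metricForm X Y = metricForm Y X := by
  rw [metricForm, metricForm, Matrix.trace_mul_comm]

theorem trace_fromBlocks_unit (A : Matrix (Fin n) (Fin n) ℝ) (B : Matrix (Fin n) Unit ℝ)
    (C : Matrix Unit (Fin n) ℝ) (D : Matrix Unit Unit ℝ) :
    (fromBlocks A B C D).trace = A.trace + D () () := by
  simp [Matrix.trace]

theorem metricForm_eq (X Y : Param n) :
    metricForm X Y = X.1 ⬝ᵥ Y.1 + 1 / 2 * (cmat X * cmat Y).trace := by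
  simp only [metricForm, augment, LinearMap.coe_mk, AddHom.coe_mk, fromBlocks_multiply,
    trace_fromBlocks_unit, trace_add, trace_replicateCol_mul_replicateRow,
    replicateRow_mul_replicateCol_apply, Matrix.mul_zero, add_zero]
  rw [dotProduct_comm]
  ring

theorem cubicLin_eq (X Y Z : Param n) :
    cubicLin n X Y Z = (cmat X * cmat Y * cmat Z).trace + X.1 ⬝ᵥ cmat Y *ᵥ Z.1 +
      X.1 ⬝ᵥ cmat Z *ᵥ Y.1 + Y.1 ⬝ᵥ cmat X *ᵥ Z.1 := by
  have hcorner : (replicateRow Unit X.1 * cmat Y * replicateCol Unit Z.1) () () =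
      X.1 ⬝ᵥ cmat Y *ᵥ Z.1 := by
    rw [← replicateRow_vecMul, replicateRow_mul_replicateCol_apply, dotProduct_mulVec]
  have hleft : (replicateCol Unit X.1 * replicateRow Unit Y.1 * cmat Z).trace =
      X.1 ⬝ᵥ cmat Z *ᵥ Y.1 := by
    rw [← vecMulVec_eq Unit, vecMulVec_mul, trace_vecMulVec, ← Matrix.mulVec_transpose,
      transpose_cmat]
  have hright : (cmat X * replicateCol Unit Y.1 * replicateRow Unit Z.1).trace =
      Y.1 ⬝ᵥ cmat X *ᵥ Z.1 := by
    rw [← replicateCol_mulVec, trace_replicateCol_mul_replicateRow, dotProduct_mulVec,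
      ← Matrix.mulVec_transpose, transpose_cmat]
  simp only [cubicLin_apply, augment, LinearMap.coe_mk, AddHom.coe_mk, fromBlocks_multiply,
    trace_fromBlocks_unit, trace_add, Matrix.add_mul, Matrix.mul_zero,
    Matrix.zero_mul, add_zero, hcorner, hleft, hright]
  ring

theorem cubicLin_swap_left (X Y Z : Param n) : cubicLin n X Y Z = cubicLin n Y X Z := by
  rw [cubicLin_apply, cubicLin_apply, ← trace_transpose, transpose_mul, transpose_mul,
    transpose_augment, transpose_augment, transpose_augment, Matrix.trace_mul_comm]

theorem cubicLin_swap_right (X Y Z : Param n) : cubicLin n X Y Z = cubicLin n X Z Y := by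
  rw [cubicLin_apply, cubicLin_apply, ← trace_transpose, transpose_mul, transpose_mul,
    transpose_augment, transpose_augment, transpose_augment, ← Matrix.mul_assoc,
    Matrix.trace_mul_comm, ← Matrix.mul_assoc]

/-- The skew-symmetric matrix `u - uᵀ`, where `u` is upper triangular with `u + uᵀ = augment W`. -/
def skewPart : Param n →ₗ[ℝ] Matrix (AugIndex n) (AugIndex n) ℝ where
  toFun W := fromBlocks (halfUpper (cmat W) - (halfUpper (cmat W))ᵀ) (replicateCol Unit W.1)
    (-replicateRow Unit W.1) 0
  map_add' W X := by
    simp [halfUpper_add, fromBlocks_add, add_sub_add_comm, add_comm]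
  map_smul' a W := by simp [halfUpper_smul, fromBlocks_smul, smul_sub]

theorem transpose_skewPart (W : Param n) : (skewPart W)ᵀ = -skewPart W := by
  simp [skewPart, fromBlocks_transpose, fromBlocks_neg]

theorem exists_skewPart_eq {A : Matrix (AugIndex n) (AugIndex n) ℝ} (hA : Aᵀ = -A) :
    ∃ W, skewPart W = A := by
  have h : ∀ a b, A b a = -A a b := fun a b => congrFun₂ hA a b
  have hdiag : ∀ a, A a a = 0 := fun a => by linarith [h a a]
  set U : Matrix (Fin n) (Fin n) ℝ :=
    Matrix.of fun i j => if i < j then A (.inl i) (.inl j) else 0 with hU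
  have hUup : U.IsUpperTriangular := fun i j (hji : j < i) => by simp [hU, not_lt_of_gt hji]
  refine ⟨mkParam (fun i => A (.inl i) (.inr ())) (U + Uᵀ) (by simp [add_comm]), ?_⟩
  simp only [skewPart, LinearMap.coe_mk, AddHom.coe_mk, cmat_mkParam, halfUpper_eq hUup rfl]
  ext (i | i) (j | j)
  · rcases lt_trichotomy i j with hij | rfl | hij
    · simp [hU, hij, not_lt_of_gt hij]
    · simp [hdiag]
    · simp [hU, hij, not_lt_of_gt hij, h (.inl i) (.inl j)]
  · simp
  · simp [h (.inl j) (.inr i)]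
  · simp [hdiag]

/-- The Levi-Civita connection of the Fisher metric on left-invariant vector fields. -/
def lcOp (W X : Param n) : Param n := compress (skewPart W * augment X)

theorem augment_lcOp (W X : Param n) :
    augment (lcOp W X) = (1 / 2 : ℝ) • (skewPart W * augment X - augment X * skewPart W) +
      (W.1 ⬝ᵥ X.1) • single (.inr ()) (.inr ()) 1 := by
  have hcorner : (skewPart W * augment X) (.inr ()) (.inr ()) = -(W.1 ⬝ᵥ X.1) := by
    simp [skewPart, augment, Matrix.mul_apply, dotProduct]
  rw [lcOp, augment_compress, hcorner, transpose_mul, transpose_augment, transpose_skewPart,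
    Matrix.mul_neg, neg_smul, sub_neg_eq_add, ← sub_eq_add_neg]

theorem fst_lcOp (W X : Param n) : (lcOp W X).1 = (1 / 2 : ℝ) •
    ((halfUpper (cmat W) - (halfUpper (cmat W))ᵀ) *ᵥ X.1 - cmat X *ᵥ W.1) := by
  have h : replicateRow Unit W.1 * cmat X = replicateRow Unit (cmat X *ᵥ W.1) := by
    rw [← replicateRow_vecMul, ← Matrix.mulVec_transpose, transpose_cmat]
  ext i
  simp [lcOp, compress, skewPart, augment, fromBlocks_multiply, h, ← replicateCol_mulVec]
  ring

theorem cmat_lcOp (W X : Param n) : cmat (lcOp W X) = (1 / 2 : ℝ) •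
    ((halfUpper (cmat W) - (halfUpper (cmat W))ᵀ) * cmat X -
      cmat X * (halfUpper (cmat W) - (halfUpper (cmat W))ᵀ) +
      vecMulVec W.1 X.1 + vecMulVec X.1 W.1) := by
  simp [lcOp, compress, skewPart, augment, fromBlocks_multiply, vecMulVec_eq Unit, Matrix.mul_sub]
  module

theorem rhoOp_sub_rhoOp (X Y : Param n) : rhoOp X Y - rhoOp Y X = lcOp X Y - lcOp Y X := by
  have hX := halfUpper_add_transpose (isSymm_cmat X)
  have hY := halfUpper_add_transpose (isSymm_cmat Y)
  apply param_ext
  · simp only [rhoOp, Prod.fst_sub, fst_mkParam, fst_lcOp]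
    set a := halfUpper (cmat X)
    set b := halfUpper (cmat Y)
    rw [← hX, ← hY]
    simp only [Matrix.add_mulVec, Matrix.sub_mulVec]
    module
  · simp only [rhoOp, cmat_sub, cmat_mkParam, cmat_lcOp]
    set a := halfUpper (cmat X)
    set b := halfUpper (cmat Y)
    rw [← hX, ← hY]
    simp only [Matrix.mul_add, Matrix.add_mul, Matrix.mul_sub, Matrix.sub_mul]
    module

theorem metricForm_lcOp (W X Y : Param n) :
    metricForm (lcOp W X) Y + metricForm X (lcOp W Y) = 0 := by
  have hcycle := Matrix.trace_mul_cycle (augment X) (augment Y) (skewPart W)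
  simp only [metricForm, augment_lcOp, Matrix.add_mul, Matrix.mul_add, Matrix.sub_mul,
    Matrix.mul_sub, Matrix.smul_mul, Matrix.mul_smul, trace_add, trace_sub, trace_smul,
    trace_single_mul, trace_mul_single, ← Matrix.mul_assoc, hcycle, augment_inr, smul_eq_mul,
    smul_zero]
  ring

theorem cubicLin_lcOp (W X Y Z : Param n) :
    cubicLin n (lcOp W X) Y Z + cubicLin n X (lcOp W Y) Z + cubicLin n X Y (lcOp W Z) =
      (W.1 ⬝ᵥ X.1) * (Y.1 ⬝ᵥ Z.1) + (W.1 ⬝ᵥ Y.1) * (X.1 ⬝ᵥ Z.1) + (W.1 ⬝ᵥ Z.1) * (X.1 ⬝ᵥ Y.1) := by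
  have hcycle := Matrix.trace_mul_cycle (augment X * augment Y) (augment Z) (skewPart W)
  have hcorner :
      (augment X * single (Sum.inr ()) (Sum.inr ()) 1 * augment Z).trace = X.1 ⬝ᵥ Z.1 := by
    rw [Matrix.trace_mul_cycle, trace_mul_single, op_smul_eq_smul, one_smul,
      augment_mul_augment_inr, dotProduct_comm]
  simp only [cubicLin_apply, augment_lcOp, Matrix.add_mul, Matrix.mul_add, Matrix.sub_mul,
    Matrix.mul_sub, Matrix.smul_mul, Matrix.mul_smul, trace_add, trace_sub, trace_smul,
    ← Matrix.mul_assoc] at hcycle ⊢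
  simp only [hcycle, hcorner, Matrix.mul_assoc (single _ _ _), trace_single_mul, trace_mul_single,
    augment_mul_augment_inr, op_smul_eq_smul, smul_eq_mul]
  ring

theorem cubicLin_lcOp_comm (W X Y Z : Param n) :
    cubicLin n (lcOp W X) Y Z + cubicLin n X (lcOp W Y) Z + cubicLin n X Y (lcOp W Z) =
      cubicLin n (lcOp X W) Y Z + cubicLin n W (lcOp X Y) Z + cubicLin n W Y (lcOp X Z) := by
  rw [cubicLin_lcOp, cubicLin_lcOp, dotProduct_comm W.1 X.1]
  ring

end Augmented

section CubicUniqueness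

variable {n : ℕ}

/-- The tangent vector whose augmented matrix is the symmetrization of the matrix unit at
`(i, j)`; these vectors span `Param n`. -/
def unitVec (i : Fin n) (j : AugIndex n) : Param n := compress (single (.inl i) j 1)

theorem compress_single_comm (a b : AugIndex n) :
    compress (single a b 1) = compress (single b a 1) := by
  rw [← compress_transpose, transpose_single]

theorem compress_single_inr : compress (single (.inr ()) (.inr ()) 1) = (0 : Param n) :=
  param_ext (by ext i; simp [compress]) (by ext i j; simp [compress, toBlocks₁₁])

theorem param_linearMap_ext {N : Type*} [AddCommMonoid N] [Module ℝ N] {f g : Param n →ₗ[ℝ] N}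
    (h : ∀ i j, f (unitVec i j) = g (unitVec i j)) : f = g := by
  have hunit : ∀ a b, f (compress (single a b 1)) = g (compress (single a b 1)) := by
    rintro (i | i) (j | j)
    · exact h i _
    · exact h i _
    · rw [compress_single_comm]; exact h j _
    · rw [compress_single_inr, map_zero, map_zero]
  have hcomp : f ∘ₗ compress = g ∘ₗ compress :=
    Matrix.ext_linearMap ℝ fun a b => LinearMap.ext_ring (hunit a b)
  refine LinearMap.ext fun X => ?_
  simpa [compress_augment] using LinearMap.congr_fun hcomp (augment X)

/-- The infinitesimal rotation in the plane of the coordinates `i` and `j`, acting on tangent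
vectors. -/
def rotOp (i : Fin n) (j : AugIndex n) (X : Param n) : Param n :=
  compress ((single (.inl i) j 1 - single j (.inl i) 1) * augment X)

theorem rotOp_unitVec (i k : Fin n) (j l : AugIndex n) :
    rotOp i j (unitVec k l) = (1 / 2 : ℝ) •
      ((if j = .inl k then unitVec i l else 0) + (if j = l then unitVec i (.inl k) else 0) -
        (if i = k then compress (single j l 1) else 0) -
        (if .inl i = l then unitVec k j else 0)) := by
  have hmul : ∀ a b d e : AugIndex n, compress (single a b (1 : ℝ) * single d e 1) =
      if b = d then compress (single a e (1 : ℝ)) else 0 := by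
    intro a b d e
    split_ifs with h
    · rw [h, single_mul_single_same, one_mul]
    · rw [single_mul_single_of_ne _ a b d h, map_zero]
  have hcorner : (single (Sum.inl k) l 1 : Matrix (AugIndex n) (AugIndex n) ℝ)
      (.inr ()) (.inr ()) = 0 := by simp
  rw [rotOp, unitVec, augment_compress, hcorner, zero_smul, sub_zero, transpose_single]
  simp only [Matrix.mul_smul, Matrix.sub_mul, Matrix.mul_add, map_smul, map_sub, map_add, hmul,
    compress_single_comm j (.inl k), Sum.inl.injEq, unitVec]
  module

theorem rotOp_unitVec_diag (i k : Fin n) (j : AugIndex n) :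
    rotOp i j (unitVec k (.inl k)) =
      ((if j = .inl k then 1 else 0) - (if i = k then 1 else 0) : ℝ) • unitVec i j := by
  rw [rotOp_unitVec]
  have hj : (if j = .inl k then unitVec i (.inl k) else 0) =
      (if j = .inl k then 1 else 0 : ℝ) • unitVec i j := by
    split_ifs with h <;> simp [h]
  have hi : (if i = k then compress (single j (.inl k) 1) else 0) =
      (if i = k then 1 else 0 : ℝ) • unitVec i j := by
    split_ifs with h <;> simp [h, compress_single_comm j, unitVec]
  have hi' : (if Sum.inl i = (Sum.inl k : AugIndex n) then unitVec k j else 0) =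
      (if i = k then 1 else 0 : ℝ) • unitVec i j := by
    simp only [Sum.inl.injEq]
    split_ifs with h <;> simp [h]
  rw [hj, hi, hi']
  module

theorem rotOp_inr_unitVec_inr (i : Fin n) :
    rotOp i (.inr ()) (unitVec i (.inr ())) = (1 / 2 : ℝ) • unitVec i (.inl i) := by
  simp [rotOp_unitVec, compress_single_inr]

theorem rotOp_inl_unitVec_left {i j : Fin n} (h : i ≠ j) :
    rotOp i (.inl j) (unitVec i (.inr ())) = -(1 / 2 : ℝ) • unitVec j (.inr ()) := by
  have hj : compress (single (.inl j) (.inr ()) 1) = unitVec j (.inr ()) := rfl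
  simp only [rotOp_unitVec, Sum.inl.injEq, h.symm, reduceCtorEq, if_true, if_false, hj]
  module

theorem rotOp_inl_unitVec_right {i j : Fin n} (h : i ≠ j) :
    rotOp i (.inl j) (unitVec j (.inr ())) = (1 / 2 : ℝ) • unitVec i (.inr ()) := by
  simp [rotOp_unitVec, h]

/-- A symmetric cubic form whose derivatives along infinitesimal rotations vanish as soon as one of
the arguments is diagonal. -/
structure IsRotationCubic (c : Param n →ₗ[ℝ] Param n →ₗ[ℝ] Param n →ₗ[ℝ] ℝ) : Prop where
  swap_left : ∀ X Y Z, c X Y Z = c Y X Z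
  swap_right : ∀ X Y Z, c X Y Z = c X Z Y
  rot : ∀ (k i : Fin n) (j : AugIndex n) (Y Z : Param n),
    c (rotOp i j (unitVec k (.inl k))) Y Z + c (unitVec k (.inl k)) (rotOp i j Y) Z +
      c (unitVec k (.inl k)) Y (rotOp i j Z) = 0

namespace IsRotationCubic

variable {c : Param n →ₗ[ℝ] Param n →ₗ[ℝ] Param n →ₗ[ℝ] ℝ}

theorem diag_diag_offDiag (hc : IsRotationCubic c) {i : Fin n} {j : AugIndex n} (hij : j ≠ .inl i)
    (k l : Fin n) : c (unitVec k (.inl k)) (unitVec l (.inl l)) (unitVec i j) = 0 := by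
  set g : Fin n → Fin n → ℝ :=
    fun k l => c (unitVec k (.inl k)) (unitVec l (.inl l)) (unitVec i j)
  set w : Fin n → ℝ := fun k => (if j = .inl k then 1 else 0) - (if i = k then 1 else 0)
  have hwi : w i = -1 := by simp [w, hij]
  have hsum : ∀ a b e, w a * g b e + w b * g a e + w e * g a b = 0 := by
    intro a b e
    have h := hc.rot a i j (unitVec b (.inl b)) (unitVec e (.inl e))
    simp only [rotOp_unitVec_diag, map_smul, LinearMap.smul_apply, smul_eq_mul] at h
    rw [hc.swap_left (unitVec i j), hc.swap_right _ (unitVec i j),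
      hc.swap_right _ (unitVec i j)] at h
    exact h
  have hii : g i i = 0 := by linarith [hwi ▸ hsum i i i]
  have hi : ∀ b, g i b = 0 := fun b => by linarith [hii ▸ hwi ▸ hsum i i b]
  linarith [hi k ▸ hi l ▸ hwi ▸ hsum i k l]

theorem diag_diag_diag (hc : IsRotationCubic c) (k l i : Fin n) :
    c (unitVec k (.inl k)) (unitVec l (.inl l)) (unitVec i (.inl i)) =
      2 * ((if i = k then c (unitVec l (.inl l)) (unitVec i (.inr ())) (unitVec i (.inr ())) else 0)
       + (if i = l then c (unitVec k (.inl k)) (unitVec i (.inr ())) (unitVec i (.inr ()))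
          else 0)) := by
  have h := hc.rot k i (.inr ()) (unitVec l (.inl l)) (unitVec i (.inr ()))
  simp only [rotOp_unitVec_diag, rotOp_inr_unitVec_inr, reduceCtorEq, if_false, zero_sub, map_smul,
    LinearMap.smul_apply, smul_eq_mul] at h
  rw [hc.swap_left (unitVec i _) (unitVec l _)] at h
  split_ifs at h ⊢ <;> linarith

theorem diag_offDiag_self (hc : IsRotationCubic c) {i l : Fin n} (h : l ≠ i) :
    c (unitVec l (.inl l)) (unitVec i (.inr ())) (unitVec i (.inr ())) = 0 := by
  have h₁ := hc.diag_diag_diag i l i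
  have h₂ := hc.diag_diag_diag i i l
  rw [hc.swap_right] at h₂
  simp only [h, h.symm, if_true, if_false, add_zero] at h₁ h₂
  linarith

theorem diag_diag_diag_of_ne (hc : IsRotationCubic c) {k l i : Fin n} (h : ¬(i = k ∧ i = l)) :
    c (unitVec k (.inl k)) (unitVec l (.inl l)) (unitVec i (.inl i)) = 0 := by
  rw [hc.diag_diag_diag]
  split_ifs with hk hl hl
  · exact absurd ⟨hk, hl⟩ h
  · rw [hc.diag_offDiag_self (Ne.symm hl), add_zero, mul_zero]
  · rw [hc.diag_offDiag_self (Ne.symm hk), add_zero, mul_zero]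
  · rw [add_zero, mul_zero]

theorem diag_self_eq (hc : IsRotationCubic c) (i j : Fin n) :
    c (unitVec i (.inl i)) (unitVec i (.inl i)) (unitVec i (.inl i)) =
      c (unitVec j (.inl j)) (unitVec j (.inl j)) (unitVec j (.inl j)) := by
  rcases eq_or_ne i j with rfl | hij
  · rfl
  have hi := hc.rot i i (.inl j) (unitVec j (.inr ())) (unitVec i (.inr ()))
  have hj := hc.rot j i (.inl j) (unitVec j (.inr ())) (unitVec i (.inr ()))
  simp only [rotOp_unitVec_diag, rotOp_inl_unitVec_left hij, rotOp_inl_unitVec_right hij, map_smul,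
    LinearMap.smul_apply, smul_eq_mul, Sum.inl.injEq, hij, hij.symm, if_true, if_false,
    hc.diag_offDiag_self hij, hc.diag_offDiag_self hij.symm] at hi hj
  rw [hc.diag_diag_diag i i i, hc.diag_diag_diag j j j]
  simp only [if_true]
  linarith

theorem diag_diag_eq_zero (hc : IsRotationCubic c)
    (h0 : ∀ k, c (unitVec k (.inl k)) (unitVec k (.inl k)) (unitVec k (.inl k)) = 0)
    (k l : Fin n) : c (unitVec k (.inl k)) (unitVec l (.inl l)) = 0 := by
  refine param_linearMap_ext fun i j => ?_
  rw [LinearMap.zero_apply]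
  rcases eq_or_ne j (.inl i) with rfl | hij
  · by_cases h : i = k ∧ i = l
    · obtain ⟨rfl, rfl⟩ := h
      exact h0 i
    · exact hc.diag_diag_diag_of_ne h
  · exact hc.diag_diag_offDiag hij k l

theorem diag_eq_zero (hc : IsRotationCubic c)
    (h0 : ∀ k, c (unitVec k (.inl k)) (unitVec k (.inl k)) (unitVec k (.inl k)) = 0)
    (k : Fin n) : c (unitVec k (.inl k)) = 0 := by
  refine param_linearMap_ext fun i j => LinearMap.ext fun Y => ?_
  rw [LinearMap.zero_apply, LinearMap.zero_apply]
  rcases eq_or_ne j (.inl i) with rfl | hij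
  · rw [hc.diag_diag_eq_zero h0, LinearMap.zero_apply]
  have hsum : ∀ l, -c (unitVec l (.inl l)) (unitVec i j) Y +
      ((if j = .inl l then 1 else 0) - (if i = l then 1 else 0)) *
        c (unitVec i (.inl i)) (unitVec i j) Y = 0 := by
    intro l
    have h := hc.rot i i j (unitVec l (.inl l)) Y
    simp only [rotOp_unitVec_diag, hc.diag_diag_eq_zero h0, hij, if_true, if_false, map_smul,
      LinearMap.smul_apply, smul_eq_mul, LinearMap.zero_apply] at h
    rw [hc.swap_left] at h
    linarith
  have hi := hsum i
  simp only [hij, if_false, if_true] at hi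
  have hi' : c (unitVec i (.inl i)) (unitVec i j) Y = 0 := by linarith
  linarith [hi' ▸ hsum k]

theorem eq_zero (hc : IsRotationCubic c)
    (h0 : ∀ k, c (unitVec k (.inl k)) (unitVec k (.inl k)) (unitVec k (.inl k)) = 0) : c = 0 := by
  refine param_linearMap_ext fun i j => LinearMap.ext₂ fun Y Z => ?_
  rw [LinearMap.zero_apply]
  rcases eq_or_ne j (.inl i) with rfl | hij
  · rw [hc.diag_eq_zero h0]
  · have h := hc.rot i i j Y Z
    simpa [rotOp_unitVec_diag, hc.diag_eq_zero h0, hij] using h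

end IsRotationCubic

theorem exists_lcOp_eq_rotOp (i : Fin n) (j : AugIndex n) : ∃ W, ∀ X, lcOp W X = rotOp i j X := by
  obtain ⟨W, hW⟩ := exists_skewPart_eq
    (A := single (.inl i) j 1 - single j (.inl i) 1) (by simp)
  exact ⟨W, fun X => by rw [lcOp, hW, rotOp]⟩

theorem fst_unitVec_diag (k : Fin n) : (unitVec k (.inl k)).1 = 0 := by
  ext i
  simp [unitVec, compress]

theorem cmat_unitVec_diag (k : Fin n) :
    cmat (unitVec k (.inl k)) = diagonal (Pi.single k 1) := by
  ext i j
  simp only [unitVec, compress, LinearMap.coe_mk, AddHom.coe_mk, cmat_mkParam, toBlocks₁₁,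
    Matrix.smul_apply, Matrix.add_apply, Matrix.transpose_apply, of_apply, single_apply,
    Sum.inl.injEq, diagonal_apply, Pi.single_apply, smul_eq_mul]
  grind

theorem lcOp_unitVec_diag (k : Fin n) (X : Param n) : lcOp (unitVec k (.inl k)) X = 0 := by
  have h : skewPart (unitVec k (.inl k)) = 0 := by
    have hhalf : halfUpper (cmat (unitVec k (.inl k))) = diagonal (Pi.single k (1 / 2)) := by
      refine halfUpper_eq (blockTriangular_diagonal _) ?_
      rw [diagonal_transpose, diagonal_add, cmat_unitVec_diag]
      refine congrArg diagonal (funext fun i => ?_)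
      rw [← Pi.add_apply, ← Pi.single_add, add_halves]
    ext (i | i) (j | j) <;> simp [skewPart, hhalf, fst_unitVec_diag]
  rw [lcOp, h, Matrix.zero_mul, map_zero]

theorem isRotationCubic_of_codazzi {c : Param n →ₗ[ℝ] Param n →ₗ[ℝ] Param n →ₗ[ℝ] ℝ}
    (hleft : ∀ X Y Z, c X Y Z = c Y X Z) (hright : ∀ X Y Z, c X Y Z = c X Z Y)
    (h : ∀ W X Y Z, c (lcOp W X) Y Z + c X (lcOp W Y) Z + c X Y (lcOp W Z) =
      c (lcOp X W) Y Z + c W (lcOp X Y) Z + c W Y (lcOp X Z)) : IsRotationCubic c where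
  swap_left := hleft
  swap_right := hright
  rot k i j Y Z := by
    obtain ⟨W, hW⟩ := exists_lcOp_eq_rotOp i j
    simpa [← hW, lcOp_unitVec_diag] using h W (unitVec k (.inl k)) Y Z

theorem isRotationCubic_cubicLin : IsRotationCubic (cubicLin n) :=
  isRotationCubic_of_codazzi cubicLin_swap_left cubicLin_swap_right cubicLin_lcOp_comm

theorem cubicLin_unitVec_diag (k : Fin n) :
    cubicLin n (unitVec k (.inl k)) (unitVec k (.inl k)) (unitVec k (.inl k)) = 1 := by
  simp [cubicLin_eq, fst_unitVec_diag, cmat_unitVec_diag, Pi.single_apply]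

theorem IsRotationCubic.exists_eq_mul_cubicLin
    {c : Param n →ₗ[ℝ] Param n →ₗ[ℝ] Param n →ₗ[ℝ] ℝ} (hc : IsRotationCubic c) :
    ∃ γ : ℝ, ∀ X Y Z, c X Y Z = γ * cubicLin n X Y Z := by
  obtain ⟨γ, hγ⟩ : ∃ γ : ℝ, ∀ k,
      c (unitVec k (.inl k)) (unitVec k (.inl k)) (unitVec k (.inl k)) = γ := by
    rcases isEmpty_or_nonempty (Fin n) with _ | ⟨⟨k₀⟩⟩
    · exact ⟨0, fun k => isEmptyElim k⟩
    · exact ⟨_, fun k => hc.diag_self_eq k k₀⟩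
  have hL := isRotationCubic_cubicLin (n := n)
  have happly : ∀ X Y Z, (c + (-γ) • cubicLin n) X Y Z = c X Y Z - γ * cubicLin n X Y Z :=
    fun X Y Z => by simp [sub_eq_add_neg]
  have hdiff : IsRotationCubic (c + (-γ) • cubicLin n) :=
    { swap_left := fun X Y Z => by simp only [happly, hc.swap_left X Y, hL.swap_left X Y]
      swap_right := fun X Y Z => by simp only [happly, hc.swap_right X Y, hL.swap_right X Y]
      rot := fun k i j Y Z => by
        simp only [happly]
        linear_combination hc.rot k i j Y Z - γ * hL.rot k i j Y Z }
  have hzero := hdiff.eq_zero fun k => by rw [happly, hγ, cubicLin_unitVec_diag, mul_one, sub_self]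
  refine ⟨γ, fun X Y Z => sub_eq_zero.1 ?_⟩
  rw [← happly, hzero]
  rfl

end CubicUniqueness

section GaussianMoments

open MvPolynomial ProbabilityTheory

theorem gaussianPDFReal_zero_one (t : ℝ) :
    gaussianPDFReal 0 1 t = (Real.sqrt (2 * Real.pi))⁻¹ * Real.exp (-(1 / 2) * t ^ 2) := by
  simp only [gaussianPDFReal, NNReal.coe_one, mul_one, sub_zero]
  ring_nf

theorem hasDerivAt_gaussianPDFReal_zero_one (t : ℝ) :
    HasDerivAt (gaussianPDFReal 0 1) (-(gaussianPDFReal 0 1 t * t)) t := by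
  have hsq : HasDerivAt (fun t : ℝ => -(1 / 2) * t ^ 2) (-t) t :=
    ((hasDerivAt_pow 2 t).const_mul _).congr_deriv (by norm_num; ring)
  rw [gaussianPDFReal_zero_one, funext gaussianPDFReal_zero_one]
  exact (hsq.exp.const_mul _).congr_deriv (by ring)

theorem integrable_gaussianPDFReal_mul_pow (k : ℕ) :
    Integrable fun t => gaussianPDFReal 0 1 t * t ^ k := by
  have h := (integrable_rpow_mul_exp_neg_mul_sq (b := 1 / 2) (by norm_num) (s := k)
    (by linarith [k.cast_nonneg (α := ℝ)])).const_mul (Real.sqrt (2 * Real.pi))⁻¹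
  refine h.congr (Filter.Eventually.of_forall fun t => ?_)
  simp only [gaussianPDFReal_zero_one, Real.rpow_natCast]
  ring

/-- The moments of the standard normal distribution on `ℝ`. -/
def stdMoment (k : ℕ) : ℝ := ∫ t, gaussianPDFReal 0 1 t * t ^ k

theorem stdMoment_zero : stdMoment 0 = 1 := by
  simpa [stdMoment] using integral_gaussianPDFReal_eq_one 0 (one_ne_zero (α := NNReal))

theorem stdMoment_succ (k : ℕ) : stdMoment (k + 1) = k * stdMoment (k - 1) := by
  have h := integral_mul_deriv_eq_deriv_mul_of_integrable (u := fun t : ℝ => t ^ k)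
    (v := gaussianPDFReal 0 1) (u' := fun t => k * t ^ (k - 1))
    (v' := fun t => -(gaussianPDFReal 0 1 t * t))
    (fun t _ => hasDerivAt_pow k t) (fun t _ => hasDerivAt_gaussianPDFReal_zero_one t)
    ((integrable_gaussianPDFReal_mul_pow (k + 1)).neg.congr (Filter.Eventually.of_forall fun t => by
      simp only [Pi.neg_apply, Pi.mul_apply]; ring))
    (((integrable_gaussianPDFReal_mul_pow (k - 1)).const_mul k).congr
      (Filter.Eventually.of_forall fun t => by simp only [Pi.mul_apply]; ring))
    ((integrable_gaussianPDFReal_mul_pow k).congr (Filter.Eventually.of_forall fun t => by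
      simp only [Pi.mul_apply]; ring))
  rw [stdMoment, stdMoment, ← integral_const_mul]
  calc ∫ t, gaussianPDFReal 0 1 t * t ^ (k + 1)
      = -∫ t : ℝ, t ^ k * -(gaussianPDFReal 0 1 t * t) := by
        rw [← integral_neg]; congr 1; ext t; ring
    _ = ∫ t, k * (gaussianPDFReal 0 1 t * t ^ (k - 1)) := by
        rw [h, neg_neg]; congr 1; ext t; ring

variable {n : ℕ}

/-- The density of the standard normal distribution on `ℝⁿ`. -/
def stdDensity (x : Fin n → ℝ) : ℝ := ∏ i, gaussianPDFReal 0 1 (x i)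

theorem stdDensity_mul_monomial (s : Fin n →₀ ℕ) (a : ℝ) (x : Fin n → ℝ) :
    stdDensity x * eval x (monomial s a) = a * ∏ i, gaussianPDFReal 0 1 (x i) * x i ^ s i := by
  rw [eval_monomial, stdDensity, Finset.prod_mul_distrib,
    Finsupp.prod_fintype _ _ (fun i => pow_zero _)]
  ring

theorem integrable_stdDensity_mul (p : MvPolynomial (Fin n) ℝ) :
    Integrable fun x : Fin n → ℝ => stdDensity x * eval x p := by
  induction p using MvPolynomial.induction_on' with
  | monomial s a =>
    simp only [stdDensity_mul_monomial]
    exact (Integrable.fintype_prod fun i => integrable_gaussianPDFReal_mul_pow (s i)).const_mul a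
  | add p q hp hq =>
    simp only [map_add, mul_add]
    exact hp.add hq

/-- The expectation of a polynomial under the standard normal distribution. -/
def gaussExp : MvPolynomial (Fin n) ℝ →ₗ[ℝ] ℝ where
  toFun p := ∫ x : Fin n → ℝ, stdDensity x * eval x p
  map_add' p q := by
    simp only [map_add, mul_add]
    exact integral_add (integrable_stdDensity_mul p) (integrable_stdDensity_mul q)
  map_smul' a p := by
    simp only [smul_eval, RingHom.id_apply, smul_eq_mul, ← integral_const_mul]
    congr 1; ext x; ring

theorem gaussExp_apply (p : MvPolynomial (Fin n) ℝ) :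
    gaussExp p = ∫ x : Fin n → ℝ, stdDensity x * eval x p := rfl

theorem gaussExp_monomial (s : Fin n →₀ ℕ) (a : ℝ) :
    gaussExp (monomial s a) = a * ∏ i, stdMoment (s i) := by
  rw [gaussExp_apply]
  simp only [stdDensity_mul_monomial, stdMoment]
  rw [integral_const_mul, ← integral_fintype_prod_volume_eq_prod]

@[simp] theorem gaussExp_one : gaussExp (1 : MvPolynomial (Fin n) ℝ) = 1 := by
  rw [← C_1, C_apply, gaussExp_monomial]
  simp [stdMoment_zero]

@[simp] theorem gaussExp_C (a : ℝ) : gaussExp (C a : MvPolynomial (Fin n) ℝ) = a := by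
  rw [← mul_one (C a), ← smul_eq_C_mul, map_smul, gaussExp_one, smul_eq_mul, mul_one]

theorem gaussExp_C_mul (a : ℝ) (p : MvPolynomial (Fin n) ℝ) :
    gaussExp (C a * p) = a * gaussExp p := by
  rw [← smul_eq_C_mul, map_smul, smul_eq_mul]

theorem gaussExp_X_mul (i : Fin n) (p : MvPolynomial (Fin n) ℝ) :
    gaussExp (X i * p) = gaussExp (pderiv i p) := by
  induction p using MvPolynomial.induction_on' with
  | monomial s a =>
    have hprod : ∀ t : Fin n →₀ ℕ, ∏ j, stdMoment (t j) =
        stdMoment (t i) * ∏ j ∈ Finset.univ.erase i, stdMoment (t j) := fun t =>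
      (Finset.mul_prod_erase _ (fun j => stdMoment (t j)) (Finset.mem_univ i)).symm
    have hother : ∀ j ∈ Finset.univ.erase i,
        stdMoment ((Finsupp.single i 1 + s : Fin n →₀ ℕ) j) =
          stdMoment ((s - Finsupp.single i 1 : Fin n →₀ ℕ) j) := fun j hj => by
      simp [Finsupp.single_eq_of_ne (Finset.ne_of_mem_erase hj)]
    rw [pderiv_monomial, X, monomial_mul, gaussExp_monomial, gaussExp_monomial, hprod, hprod,
      Finset.prod_congr rfl hother]
    simp only [Finsupp.coe_add, Pi.add_apply, Finsupp.single_eq_same, Finsupp.coe_tsub,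
      Pi.sub_apply, add_comm 1, stdMoment_succ]
    ring
  | add p q hp hq =>
    simp only [mul_add, map_add, hp, hq]

/-- The score function at the standard normal distribution, as a polynomial. -/
def scorePoly (Y : Param n) : MvPolynomial (Fin n) ℝ :=
  ∑ i, C (Y.1 i) * X i + C (1 / 2) * (∑ i, ∑ j, C (cmat Y i j) * (X i * X j) - C (cmat Y).trace)

theorem gaussExp_scorePoly_mul (Y : Param n) (p : MvPolynomial (Fin n) ℝ) :
    gaussExp (scorePoly Y * p) = ∑ i, Y.1 i * gaussExp (pderiv i p) +
      1 / 2 * ∑ i, ∑ j, cmat Y i j * gaussExp (pderiv j (pderiv i p)) := by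
  have h : ∀ i j, gaussExp (X i * (X j * p)) =
      (if i = j then gaussExp p else 0) + gaussExp (pderiv j (pderiv i p)) := by
    intro i j
    rw [gaussExp_X_mul, Derivation.leibniz, pderiv_X, map_add]
    simp only [smul_eq_mul]
    rw [gaussExp_X_mul, add_comm]
    by_cases hij : i = j
    · subst hij; simp
    · simp [hij, Ne.symm hij]
  simp only [scorePoly, add_mul, mul_assoc, Finset.sum_mul, sub_mul, map_add, map_sum,
    gaussExp_C_mul, map_sub, h, mul_add, Finset.sum_add_distrib, mul_ite, mul_zero]
  simp [Matrix.trace, gaussExp_X_mul, Finset.sum_mul]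

theorem pderiv_scorePoly (Y : Param n) (k : Fin n) :
    pderiv k (scorePoly Y) = C (Y.1 k) + ∑ j, C (cmat Y k j) * X j := by
  have hX : ∀ i, pderiv k (X i : MvPolynomial (Fin n) ℝ) = if i = k then 1 else 0 := fun i => by
    rw [pderiv_X, Pi.single_apply]
  have hlin : ∑ i, pderiv k (C (Y.1 i) * X i) = C (Y.1 k) := by
    simp [hX]
  have hquad : ∑ i, ∑ j, pderiv k (C (cmat Y i j) * (X i * X j)) =
      C 2 * ∑ j, C (cmat Y k j) * X j := by
    simp only [Derivation.leibniz, pderiv_C, hX, smul_eq_mul, mul_add, mul_ite, mul_one, mul_zero,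
      add_zero, Finset.sum_add_distrib, Finset.sum_ite_eq', Finset.mem_univ, if_true]
    rw [Finset.sum_comm]
    simp only [Finset.sum_ite_eq', Finset.mem_univ, if_true, (isSymm_cmat Y).apply, ← two_mul]
    rfl
  rw [scorePoly, map_add, map_sum, hlin, pderiv_C_mul, map_sub, map_sum, pderiv_C, sub_zero]
  simp only [map_sum]
  rw [hquad, ← mul_assoc, ← C_mul]
  norm_num

theorem pderiv_pderiv_scorePoly (Y : Param n) (k l : Fin n) :
    pderiv l (pderiv k (scorePoly Y)) = C (cmat Y k l) := by
  rw [pderiv_scorePoly]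
  simp [Derivation.leibniz, pderiv_X, Pi.single_apply]

theorem gaussExp_scorePoly (Y : Param n) : gaussExp (scorePoly Y) = 0 := by
  have := gaussExp_scorePoly_mul Y 1
  simpa using this

theorem gaussExp_pderiv_scorePoly (Y : Param n) (k : Fin n) :
    gaussExp (pderiv k (scorePoly Y)) = Y.1 k := by
  have h : ∀ j, gaussExp (X j : MvPolynomial (Fin n) ℝ) = 0 := fun j => by
    have := gaussExp_X_mul j (1 : MvPolynomial (Fin n) ℝ)
    simpa using this
  simp [pderiv_scorePoly, gaussExp_C_mul, h]

theorem gaussExp_scorePoly_scorePoly (Y Z : Param n) :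
    gaussExp (scorePoly Y * scorePoly Z) = metricForm Y Z := by
  rw [gaussExp_scorePoly_mul]
  simp only [gaussExp_pderiv_scorePoly, pderiv_pderiv_scorePoly, gaussExp_C, metricForm_eq]
  congr 2
  simp only [Matrix.trace, Matrix.diag, Matrix.mul_apply]
  refine Finset.sum_congr rfl fun i _ => Finset.sum_congr rfl fun j _ => ?_
  rw [(isSymm_cmat Z).apply]

theorem gaussExp_scorePoly_mul_pderiv (Y Z : Param n) (k : Fin n) :
    gaussExp (scorePoly Y * pderiv k (scorePoly Z)) = (cmat Z *ᵥ Y.1) k := by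
  rw [gaussExp_scorePoly_mul]
  simp [pderiv_pderiv_scorePoly, Matrix.mulVec, dotProduct, mul_comm]

theorem gaussExp_pderiv_mul_pderiv (Y Z : Param n) (k l : Fin n) :
    gaussExp (pderiv k (scorePoly Y) * pderiv l (scorePoly Z)) =
      (vecMulVec Y.1 Z.1 + cmat Y * cmat Z) k l := by
  rw [pderiv_scorePoly Y k, add_mul, Finset.sum_mul, map_add, map_sum, gaussExp_C_mul,
    gaussExp_pderiv_scorePoly]
  simp [mul_assoc, gaussExp_C_mul, gaussExp_X_mul, pderiv_pderiv_scorePoly,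
    (isSymm_cmat Z).apply, vecMulVec_apply, Matrix.mul_apply]

theorem gaussExp_pderiv_pderiv_mul (Y Z : Param n) (k l : Fin n) :
    gaussExp (pderiv l (pderiv k (scorePoly Y * scorePoly Z))) =
      (vecMulVec Y.1 Z.1 + cmat Y * cmat Z) k l + (vecMulVec Y.1 Z.1 + cmat Y * cmat Z) l k := by
  simp only [Derivation.leibniz, map_add, smul_eq_mul, pderiv_pderiv_scorePoly, mul_comm _ (C _),
    gaussExp_C_mul, gaussExp_scorePoly, mul_comm (pderiv k (scorePoly Z)),
    gaussExp_pderiv_mul_pderiv]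
  ring

theorem sum_mul_symmetrize_eq_trace {S : Matrix (Fin n) (Fin n) ℝ} (hS : Sᵀ = S)
    (M : Matrix (Fin n) (Fin n) ℝ) :
    ∑ i, ∑ j, S i j * (M i j + M j i) = 2 * (S * M).trace := by
  have h : ∑ i, ∑ j, S i j * M j i = (S * M).trace := by
    simp only [Matrix.trace, Matrix.diag, Matrix.mul_apply]
  have h' : ∑ i, ∑ j, S i j * M i j = (S * M).trace := by
    rw [← h, Finset.sum_comm]
    exact Finset.sum_congr rfl fun i _ => Finset.sum_congr rfl fun j _ =>
      by rw [← congrFun₂ hS, transpose_apply]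
  simp only [mul_add, Finset.sum_add_distrib, h, h', two_mul]

theorem gaussExp_scorePoly_three (W Y Z : Param n) :
    gaussExp (scorePoly W * scorePoly Y * scorePoly Z) = cubicLin n W Y Z := by
  have hlin : ∑ k, W.1 k * gaussExp (pderiv k (scorePoly Y * scorePoly Z)) =
      W.1 ⬝ᵥ cmat Z *ᵥ Y.1 + W.1 ⬝ᵥ cmat Y *ᵥ Z.1 := by
    simp only [Derivation.leibniz, smul_eq_mul, map_add, gaussExp_scorePoly_mul_pderiv, mul_add,
      Finset.sum_add_distrib, dotProduct]
  rw [mul_assoc, gaussExp_scorePoly_mul, hlin]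
  simp only [gaussExp_pderiv_pderiv_mul]
  rw [sum_mul_symmetrize_eq_trace (transpose_cmat W), Matrix.mul_add, trace_add, mul_vecMulVec,
    trace_vecMulVec, cubicLin_eq, dotProduct_mulVec Y.1, ← Matrix.mulVec_transpose, transpose_cmat,
    Matrix.mul_assoc]
  ring

end GaussianMoments

section Coordinates

variable {n : ℕ} {H : Type*} [TopologicalSpace H] {E' : Type*} [NormedAddCommGroup E']
  [NormedSpace ℝ E'] {I : ModelWithCorners ℝ E' H} {M : Type*} [TopologicalSpace M]
  [ChartedSpace H M] {k : ℕ∞ω}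

theorem contMDiff_of_injective_comp {E F : Type*} [NormedAddCommGroup E] [NormedSpace ℝ E]
    [NormedAddCommGroup F] [NormedSpace ℝ F] [FiniteDimensional ℝ F] {f : M → E} (L : E →ₗ[ℝ] F)
    (hL : Function.Injective L) (h : ContMDiff I 𝓘(ℝ, F) k fun q => L (f q)) :
    ContMDiff I 𝓘(ℝ, E) k f := by
  obtain ⟨P, hP⟩ := L.exists_leftInverse_of_injective (LinearMap.ker_eq_bot.2 hL)
  have hf : f = P.toContinuousLinearMap ∘ fun q => L (f q) :=
    funext fun q => (LinearMap.congr_fun hP (f q)).symm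
  rw [hf]
  exact (ContinuousLinearMap.contDiff _).contMDiff.comp h

theorem contMDiff_param {f : M → Param n}
    (h₁ : ∀ i, ContMDiff I 𝓘(ℝ, ℝ) k fun q => (f q).1 i)
    (h₂ : ∀ i j, ContMDiff I 𝓘(ℝ, ℝ) k fun q => cmat (f q) i j) :
    ContMDiff I 𝓘(ℝ, Param n) k f :=
  contMDiff_of_injective_comp (LinearMap.id.prodMap (SymMat n).subtype)
    (Function.injective_id.prodMap Subtype.val_injective)
    (ContMDiff.prodMk_space (contMDiff_pi_space.2 h₁)
      (contMDiff_pi_space.2 fun i => contMDiff_pi_space.2 fun j => h₂ i j))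

/-- A coordinate of the matrix component. -/
def cmatCoord (i j : Fin n) : Param n →L[ℝ] ℝ :=
  LinearMap.toContinuousLinearMap
    { toFun := fun X => cmat X i j
      map_add' := fun _ _ => rfl
      map_smul' := fun _ _ => rfl }

/-- A coordinate of the mean component. -/
def meanCoord (i : Fin n) : Param n →L[ℝ] ℝ :=
  LinearMap.toContinuousLinearMap
    { toFun := fun X => X.1 i
      map_add' := fun _ _ => rfl
      map_smul' := fun _ _ => rfl }

theorem contMDiff_clm {E F : Type*} [NormedAddCommGroup E] [NormedSpace ℝ E]
    [FiniteDimensional ℝ E] [NormedAddCommGroup F] [NormedSpace ℝ F] [FiniteDimensional ℝ F]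
    {f : M → E →L[ℝ] F} (h : ∀ v, ContMDiff I 𝓘(ℝ, F) k fun q => f q v) :
    ContMDiff I 𝓘(ℝ, E →L[ℝ] F) k f := by
  let b := Module.finBasis ℝ E
  refine contMDiff_of_injective_comp (LinearMap.pi fun i =>
    (ContinuousLinearMap.apply ℝ F (b i)).toLinearMap) (fun A B hAB => ?_)
    (contMDiff_pi_space.2 fun i => h (b i))
  exact ContinuousLinearMap.coe_injective (b.ext fun i => congrFun hAB i)

theorem contMDiff_matrix_mul {ι₁ ι₂ ι₃ : Type*} [Fintype ι₂] {A : M → Matrix ι₁ ι₂ ℝ}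
    {B : M → Matrix ι₂ ι₃ ℝ} (hA : ∀ i j, ContMDiff I 𝓘(ℝ, ℝ) k fun q => A q i j)
    (hB : ∀ i j, ContMDiff I 𝓘(ℝ, ℝ) k fun q => B q i j) (i : ι₁) (j : ι₃) :
    ContMDiff I 𝓘(ℝ, ℝ) k fun q => (A q * B q) i j := by
  simp only [Matrix.mul_apply]
  exact contMDiff_finsetSum fun l _ => (hA i l).mul (hB l j)

theorem contMDiff_matrix_mulVec {ι₁ ι₂ : Type*} [Fintype ι₂] {A : M → Matrix ι₁ ι₂ ℝ}
    {v : M → ι₂ → ℝ} (hA : ∀ i j, ContMDiff I 𝓘(ℝ, ℝ) k fun q => A q i j)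
    (hv : ∀ i, ContMDiff I 𝓘(ℝ, ℝ) k fun q => v q i) (i : ι₁) :
    ContMDiff I 𝓘(ℝ, ℝ) k fun q => (A q *ᵥ v q) i := by
  simp only [Matrix.mulVec, dotProduct]
  exact contMDiff_finsetSum fun l _ => (hA i l).mul (hv l)

theorem contMDiff_det {ι : Type*} [Fintype ι] [DecidableEq ι] {A : M → Matrix ι ι ℝ}
    (hA : ∀ i j, ContMDiff I 𝓘(ℝ, ℝ) k fun q => A q i j) :
    ContMDiff I 𝓘(ℝ, ℝ) k fun q => (A q).det := by
  simp only [Matrix.det_apply']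
  refine contMDiff_finsetSum fun σ _ => contMDiff_const.mul ?_
  exact contMDiff_finsetProd fun i _ => hA _ _

theorem contMDiff_matrix_inv {ι : Type*} [Fintype ι] [DecidableEq ι] {A : M → Matrix ι ι ℝ}
    (hA : ∀ i j, ContMDiff I 𝓘(ℝ, ℝ) k fun q => A q i j) (hd : ∀ q, (A q).det ≠ 0) (i j : ι) :
    ContMDiff I 𝓘(ℝ, ℝ) k fun q => (A q)⁻¹ i j := by
  simp only [Matrix.inv_def, Matrix.smul_apply, Ring.inverse_eq_inv', smul_eq_mul,
    Matrix.adjugate_apply]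
  refine ContMDiff.mul ?_ (contMDiff_det fun a b => ?_)
  · exact fun q => ContMDiffAt.comp q (contDiffAt_inv ℝ (hd q)).contMDiffAt (contMDiff_det hA q)
  · by_cases h : a = j
    · subst h
      simp only [Matrix.updateRow_self]
      exact contMDiff_const
    · simp only [Matrix.updateRow_ne h]
      exact hA a b

open TopologicalSpace in
theorem contMDiff_opens {E : Type*} [NormedAddCommGroup E] [NormedSpace ℝ E] {U : Opens E}
    {f : M → U} (h : ContMDiff I 𝓘(ℝ, E) k fun q => (f q).1) : ContMDiff I 𝓘(ℝ, E) k f := by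
  intro q
  rw [contMDiffAt_iff_target]
  exact ⟨(Topology.IsInducing.subtypeVal.continuous_iff.2 h.continuous).continuousAt, h q⟩

end Coordinates

section Cholesky

variable {n : ℕ}

/-- The upper triangular factor of the covariance matrix. -/
def chol (θ : NormalFamily n) : Matrix (Fin n) (Fin n) ℝ := ((phiEquiv n).symm θ).A

theorem chol_upper (θ : NormalFamily n) : (chol θ).IsUpperTriangular := ((phiEquiv n).symm θ).upper

theorem chol_pos (θ : NormalFamily n) (i : Fin n) : 0 < chol θ i i := ((phiEquiv n).symm θ).pos i

theorem chol_det_pos (θ : NormalFamily n) : 0 < (chol θ).det :=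
  det_pos_of_upper (chol_upper θ) (chol_pos θ)

theorem chol_isUnit_det (θ : NormalFamily n) : IsUnit (chol θ).det := (chol_det_pos θ).ne'.isUnit

theorem chol_mul_transpose (θ : NormalFamily n) : chol θ * (chol θ)ᵀ = cmat θ.1 :=
  congrArg (fun η : NormalFamily n => cmat η.1) ((phiEquiv n).apply_symm_apply θ)

theorem phiEquiv_symm_b (θ : NormalFamily n) : ((phiEquiv n).symm θ).b = θ.1.1 :=
  congrArg (fun η : NormalFamily n => η.1.1) ((phiEquiv n).apply_symm_apply θ)

theorem chol_eq {θ : NormalFamily n} {A : Matrix (Fin n) (Fin n) ℝ} (hA : A.IsUpperTriangular)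
    (hp : ∀ i, 0 < A i i) (h : A * Aᵀ = cmat θ.1) : chol θ = A := by
  have : (phiEquiv n).symm θ = ⟨A, θ.1.1, hA, hp⟩ := by
    rw [Equiv.symm_apply_eq]
    exact Subtype.ext (param_ext rfl h.symm)
  rw [chol, this]

theorem coe_mul (θ η : NormalFamily n) : (θ * η).1 =
    mkParam (chol θ *ᵥ η.1.1 + θ.1.1) (chol θ * cmat η.1 * (chol θ)ᵀ) (by
      simp [Matrix.mul_assoc]) := by
  apply param_ext
  · change (chol θ *ᵥ ((phiEquiv n).symm η).b + ((phiEquiv n).symm θ).b) = _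
    rw [phiEquiv_symm_b, phiEquiv_symm_b]; rfl
  · change (chol θ * chol η) * (chol θ * chol η)ᵀ = _
    rw [cmat_mkParam, ← chol_mul_transpose, transpose_mul]
    simp only [Matrix.mul_assoc]

theorem chol_mul (θ η : NormalFamily n) : chol (θ * η) = chol θ * chol η :=
  congrArg AffS.A ((phiEquiv n).symm_apply_apply _)

theorem coe_inv (θ : NormalFamily n) : (θ⁻¹).1 =
    mkParam (-((chol θ)⁻¹ *ᵥ θ.1.1)) ((chol θ)⁻¹ * ((chol θ)⁻¹)ᵀ)
      (by simp) := by
  apply param_ext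
  · change -((chol θ)⁻¹ *ᵥ ((phiEquiv n).symm θ).b) = _
    rw [phiEquiv_symm_b]; rfl
  · rfl

theorem eq_zero_of_add_transpose_eq_zero {B : Matrix (Fin n) (Fin n) ℝ}
    (hB : B.IsUpperTriangular) (h : B + Bᵀ = 0) : B = 0 := by
  rw [← halfUpper_eq hB h]
  exact halfUpper_eq Matrix.blockTriangular_zero (by simp)

/-- The polarization of the map `(m, S) ↦ a aᵀ`, where `a` is upper triangular with `a + aᵀ = S`. -/
def halfBilin (n : ℕ) : Param n →L[ℝ] Param n →L[ℝ] Param n :=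
  LinearMap.toContinuousBilinearMap (LinearMap.mk₂ ℝ
    (fun X Y => mkParam 0 (halfUpper (cmat X) * (halfUpper (cmat Y))ᵀ +
      halfUpper (cmat Y) * (halfUpper (cmat X))ᵀ) (by simp [add_comm]))
    (fun X X' Y => param_ext (by simp) (by
      simp only [cmat_mkParam, cmat_add, halfUpper_add, Matrix.add_mul, Matrix.mul_add,
        transpose_add]
      abel))
    (fun a X Y => param_ext (by simp) (by
      simp only [cmat_mkParam, cmat_smul, halfUpper_smul, Matrix.smul_mul, Matrix.mul_smul,
        transpose_smul, smul_add]))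
    (fun X Y Y' => param_ext (by simp) (by
      simp only [cmat_mkParam, cmat_add, halfUpper_add, Matrix.add_mul, Matrix.mul_add,
        transpose_add]
      abel))
    (fun a X Y => param_ext (by simp) (by
      simp only [cmat_mkParam, cmat_smul, halfUpper_smul, Matrix.smul_mul, Matrix.mul_smul,
        transpose_smul, smul_add])))

theorem halfBilin_fst (X Y : Param n) : (halfBilin n X Y).1 = 0 := rfl

theorem cmat_halfBilin (X Y : Param n) : cmat (halfBilin n X Y) =
    halfUpper (cmat X) * (halfUpper (cmat Y))ᵀ + halfUpper (cmat Y) * (halfUpper (cmat X))ᵀ := rfl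

/-- The mean component, as a parameter. -/
def meanProj (n : ℕ) : Param n →L[ℝ] Param n :=
  (ContinuousLinearMap.inl ℝ (Fin n → ℝ) (SymMat n)).comp
    (ContinuousLinearMap.fst ℝ (Fin n → ℝ) (SymMat n))

theorem meanProj_fst (X : Param n) : (meanProj n X).1 = X.1 := rfl

theorem cmat_meanProj (X : Param n) : cmat (meanProj n X) = 0 := rfl

/-- The map `(m, S) ↦ (m, a aᵀ)`, where `a` is upper triangular with `a + aᵀ = S`. -/
def squareMap (X : Param n) : Param n := meanProj n X + (1 / 2 : ℝ) • halfBilin n X X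

theorem squareMap_fst (X : Param n) : (squareMap X).1 = X.1 := by
  simp [squareMap, halfBilin_fst, meanProj_fst]

theorem cmat_squareMap (X : Param n) :
    cmat (squareMap X) = halfUpper (cmat X) * (halfUpper (cmat X))ᵀ := by
  simp only [squareMap, cmat_add, cmat_meanProj, cmat_smul, cmat_halfBilin]
  module

theorem contDiff_squareMap : ContDiff ℝ ∞ (squareMap (n := n)) :=
  (meanProj n).contDiff.add (((halfBilin n).contDiff.clm_apply contDiff_id).const_smul _)

theorem hasFDerivAt_squareMap (X : Param n) :
    HasFDerivAt squareMap (meanProj n + halfBilin n X) X := by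
  have h := (meanProj n).hasFDerivAt (x := X) |>.add
    ((((halfBilin n).hasFDerivAt (x := X)).clm_apply (hasFDerivAt_id X)).const_smul (1 / 2 : ℝ))
  refine h.congr_fderiv ?_
  refine ContinuousLinearMap.ext fun V => ?_
  apply param_ext
  · simp [halfBilin_fst]
  · simp [cmat_halfBilin]
    module

theorem eq_zero_of_mul_transpose_add_eq_zero {A B : Matrix (Fin n) (Fin n) ℝ}
    (hA : A.IsUpperTriangular) (hpos : ∀ i, 0 < A i i) (hB : B.IsUpperTriangular)
    (h : A * Bᵀ + B * Aᵀ = 0) : B = 0 := by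
  have hu : IsUnit A.det := (det_pos_of_upper hA hpos).ne'.isUnit
  have hut : IsUnit (Aᵀ).det := by rwa [det_transpose]
  have hquot : A⁻¹ * B + (A⁻¹ * B)ᵀ = 0 := by
    calc A⁻¹ * B + (A⁻¹ * B)ᵀ = A⁻¹ * (A * Bᵀ + B * Aᵀ) * (Aᵀ)⁻¹ := by
          rw [Matrix.mul_add, Matrix.add_mul, ← Matrix.mul_assoc, Matrix.nonsing_inv_mul _ hu,
            Matrix.one_mul, ← Matrix.mul_assoc, Matrix.mul_assoc _ _ (Aᵀ)⁻¹,
            Matrix.mul_nonsing_inv _ hut, Matrix.mul_one, transpose_mul, transpose_nonsing_inv,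
            add_comm]
      _ = 0 := by rw [h, Matrix.mul_zero, Matrix.zero_mul]
  calc B = A * (A⁻¹ * B) := by
        rw [← Matrix.mul_assoc, Matrix.mul_nonsing_inv _ hu, Matrix.one_mul]
    _ = 0 := by
        rw [eq_zero_of_add_transpose_eq_zero ((inv_upper hA hpos).mul hB) hquot, Matrix.mul_zero]

theorem squareMap_deriv_injective {X : Param n} (hX : ∀ i, 0 < halfUpper (cmat X) i i) :
    Function.Injective (meanProj n + halfBilin n X : Param n →L[ℝ] Param n) := by
  rw [injective_iff_map_eq_zero]
  intro V hV
  have hmean : V.1 = 0 := by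
    simpa [halfBilin_fst, meanProj_fst] using congrArg Prod.fst hV
  have hhalf : halfUpper (cmat V) = 0 :=
    eq_zero_of_mul_transpose_add_eq_zero (halfUpper_upper _) hX (halfUpper_upper _) <| by
      simpa [cmat_halfBilin, cmat_meanProj] using congrArg cmat hV
  refine param_ext hmean ?_
  rw [← halfUpper_add_transpose (isSymm_cmat V), hhalf, transpose_zero, add_zero, cmat_zero]

theorem exists_contDiffAt_rightInverse_squareMap {X : Param n}
    (hX : ∀ i, 0 < halfUpper (cmat X) i i) :
    ∃ g : Param n → Param n, ContDiffAt ℝ ∞ g (squareMap X) ∧ g (squareMap X) = X ∧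
      ∀ᶠ x in 𝓝 (squareMap X), squareMap (g x) = x := by
  let e : Param n ≃L[ℝ] Param n := (LinearEquiv.ofInjectiveEndo
    ((meanProj n + halfBilin n X : Param n →L[ℝ] Param n) : Param n →ₗ[ℝ] Param n)
    (squareMap_deriv_injective hX)).toContinuousLinearEquiv
  have hd : HasFDerivAt squareMap (e : Param n →L[ℝ] Param n) X :=
    (hasFDerivAt_squareMap X).congr_fderiv (ContinuousLinearMap.ext fun _ => rfl)
  have hc : ContDiffAt ℝ ∞ squareMap X := contDiff_squareMap.contDiffAt
  exact ⟨hc.localInverse hd (by simp), hc.to_localInverse hd (by simp),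
    hc.localInverse_apply_image hd (by simp),
    (hc.hasStrictFDerivAt' hd (by simp)).eventually_right_inverse⟩

theorem contDiff_halfUpper_cmat (i j : Fin n) :
    ContDiff ℝ ∞ fun X : Param n => halfUpper (cmat X) i j := by
  have hent : ContDiff ℝ ∞ fun X : Param n => cmat X i j := (cmatCoord i j).contDiff
  simp only [halfUpper, Matrix.of_apply]
  split_ifs
  exacts [hent, hent.div_const 2, contDiff_const]

theorem chol_eq_halfUpper {θ : NormalFamily n} {X : Param n}
    (hX : ∀ i, 0 < halfUpper (cmat X) i i) (h : squareMap X = θ.1) :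
    chol θ = halfUpper (cmat X) :=
  chol_eq (halfUpper_upper _) hX (by rw [← cmat_squareMap, h])

theorem contMDiff_chol (i j : Fin n) :
    ContMDiff 𝓘(ℝ, Param n) 𝓘(ℝ, ℝ) ∞ fun θ : NormalFamily n => chol θ i j := by
  rw [contMDiff_iff_retr]
  intro θ
  set X : Param n := mkParam θ.1.1 (chol θ + (chol θ)ᵀ) (by simp [add_comm])
  have hhalf : halfUpper (cmat X) = chol θ := halfUpper_eq (chol_upper θ) rfl
  have hsq : squareMap X = θ.1 := by
    refine param_ext (squareMap_fst X) ?_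
    rw [cmat_squareMap, hhalf, chol_mul_transpose]
  have hpos : ∀ i, 0 < halfUpper (cmat X) i i := fun i => by rw [hhalf]; exact chol_pos θ i
  obtain ⟨g, hg, hgX, hright⟩ := exists_contDiffAt_rightInverse_squareMap hpos
  rw [hsq] at hg hgX hright
  have hent : ∀ i j, ContDiffAt ℝ ∞ (fun x => halfUpper (cmat (g x)) i j) θ.1 := fun i j =>
    (contDiff_halfUpper_cmat i j).contDiffAt.comp θ.1 hg
  have hgpos : ∀ᶠ x in 𝓝 θ.1, ∀ i, 0 < halfUpper (cmat (g x)) i i :=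
    Filter.eventually_all.2 fun i =>
      (hent i i).continuousAt.eventually_const_lt (by simpa only [hgX] using hpos i)
  refine (hent i j).congr_of_eventuallyEq ?_
  filter_upwards [hright, hgpos, eventually_retr θ] with x hx hxpos hxθ
  rw [Function.comp_apply, chol_eq_halfUpper hxpos (hx.trans hxθ.symm)]

end Cholesky

section LieGroup

variable {n : ℕ}

theorem contMDiff_cmat_coe (i j : Fin n) :
    ContMDiff 𝓘(ℝ, Param n) 𝓘(ℝ, ℝ) ∞ fun θ : NormalFamily n => cmat θ.1 i j :=
  (cmatCoord i j).contDiff.contMDiff.comp contMDiff_subtype_val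

theorem contMDiff_mean_coe (i : Fin n) :
    ContMDiff 𝓘(ℝ, Param n) 𝓘(ℝ, ℝ) ∞ fun θ : NormalFamily n => θ.1.1 i :=
  (meanCoord i).contDiff.contMDiff.comp contMDiff_subtype_val

theorem contMDiff_chol_inv (i j : Fin n) :
    ContMDiff 𝓘(ℝ, Param n) 𝓘(ℝ, ℝ) ∞ fun θ : NormalFamily n => (chol θ)⁻¹ i j :=
  contMDiff_matrix_inv contMDiff_chol (fun θ => (chol_det_pos θ).ne') i j

theorem lieGroup_normalFamily (n : ℕ) : LieGroup 𝓘(ℝ, Param n) ∞ (NormalFamily n) where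
  contMDiff_mul := by
    have hc : ∀ i j, ContMDiff (𝓘(ℝ, Param n).prod 𝓘(ℝ, Param n)) 𝓘(ℝ, ℝ) ∞
        fun p : NormalFamily n × NormalFamily n => chol p.1 i j :=
      fun i j => (contMDiff_chol i j).comp contMDiff_fst
    have hs : ∀ i j, ContMDiff (𝓘(ℝ, Param n).prod 𝓘(ℝ, Param n)) 𝓘(ℝ, ℝ) ∞
        fun p : NormalFamily n × NormalFamily n => cmat p.2.1 i j :=
      fun i j => (contMDiff_cmat_coe i j).comp contMDiff_snd
    have hm : ∀ i, ContMDiff (𝓘(ℝ, Param n).prod 𝓘(ℝ, Param n)) 𝓘(ℝ, ℝ) ∞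
        fun p : NormalFamily n × NormalFamily n => p.2.1.1 i :=
      fun i => (contMDiff_mean_coe i).comp contMDiff_snd
    refine contMDiff_opens ?_
    simp only [coe_mul]
    refine contMDiff_param (fun i => ?_) (fun i j => ?_)
    · exact (contMDiff_matrix_mulVec hc hm i).add ((contMDiff_mean_coe i).comp contMDiff_fst)
    · exact contMDiff_matrix_mul (contMDiff_matrix_mul hc hs) (fun k l => hc l k) i j
  contMDiff_inv := by
    refine contMDiff_opens ?_
    simp only [coe_inv]
    refine contMDiff_param (fun i => ?_) (fun i j => ?_)
    · exact (contMDiff_matrix_mulVec contMDiff_chol_inv contMDiff_mean_coe i).neg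
    · exact contMDiff_matrix_mul contMDiff_chol_inv (fun k l => contMDiff_chol_inv l k) i j

end LieGroup

section Solvable

variable {n : ℕ}

theorem AffS.apply_succ_zero (x : AffS (n + 1)) (i : Fin n) : x.A i.succ 0 = 0 :=
  x.upper (Fin.succ_pos i)

theorem AffS.mul_A (x y : AffS n) : (x * y).A = x.A * y.A := rfl

theorem AffS.mul_b (x y : AffS n) : (x * y).b = x.A *ᵥ y.b + x.b := rfl

theorem AffS.one_A : (1 : AffS n).A = 1 := rfl

/-- The homomorphism forgetting the first coordinate. -/
def AffS.tail (n : ℕ) : AffS (n + 1) →* AffS n where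
  toFun x :=
    { A := x.A.submatrix Fin.succ Fin.succ
      b := x.b ∘ Fin.succ
      upper := fun _ _ h => x.upper (Fin.succ_lt_succ_iff.2 h)
      pos := fun i => x.pos i.succ }
  map_one' := AffS.ext (by
    ext i j
    simp [AffS.one_A, Matrix.one_apply]) rfl
  map_mul' x y := by
    apply AffS.ext
    · ext i j
      simp [AffS.mul_A, Matrix.mul_apply, Fin.sum_univ_succ, AffS.apply_succ_zero]
    · ext i
      simp [AffS.mul_b, Matrix.mulVec, dotProduct, Fin.sum_univ_succ, AffS.apply_succ_zero]

/-- The first diagonal entry. -/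
def AffS.headDiag (n : ℕ) : AffS (n + 1) →* ℝˣ where
  toFun x := Units.mk0 (x.A 0 0) (x.pos 0).ne'
  map_one' := Units.ext rfl
  map_mul' x y := Units.ext (mul_upper_diag x.upper y.upper 0)

theorem AffS.mem_ker_tail_prod_headDiag {x : AffS (n + 1)}
    (hx : x ∈ ((AffS.tail n).prod (AffS.headDiag n)).ker) :
    x.A 0 0 = 1 ∧ (∀ i j : Fin n, x.A i.succ j.succ = (1 : Matrix (Fin n) (Fin n) ℝ) i j) ∧
      ∀ i : Fin n, x.b i.succ = 0 := by
  have h := Prod.ext_iff.1 (MonoidHom.mem_ker.1 hx)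
  exact ⟨congrArg Units.val h.2, fun i j => congrFun (congrFun (congrArg AffS.A h.1) i) j,
    fun i => congrFun (congrArg AffS.b h.1) i⟩

theorem AffS.comm_of_mem_ker {x y : AffS (n + 1)}
    (hx : x ∈ ((AffS.tail n).prod (AffS.headDiag n)).ker)
    (hy : y ∈ ((AffS.tail n).prod (AffS.headDiag n)).ker) : x * y = y * x := by
  obtain ⟨hxHead, hxTail, hxb⟩ := mem_ker_tail_prod_headDiag hx
  obtain ⟨hyHead, hyTail, hyb⟩ := mem_ker_tail_prod_headDiag hy
  apply AffS.ext
  · ext i j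
    refine Fin.cases ?_ (fun i => ?_) i <;> refine Fin.cases ?_ (fun j => ?_) j <;>
      simp [AffS.mul_A, Matrix.mul_apply, Fin.sum_univ_succ, AffS.apply_succ_zero, hxHead, hxTail,
        hyHead, hyTail, Matrix.one_apply, add_comm]
  · ext i
    refine Fin.cases ?_ (fun i => ?_) i <;>
      simp [AffS.mul_b, Matrix.mulVec, dotProduct, Fin.sum_univ_succ, AffS.apply_succ_zero, hxHead,
        hxTail, hxb, hyHead, hyTail, hyb, add_comm]

theorem isSolvable_affS (n : ℕ) : Group.IsSolvable (AffS n) := by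
  induction n with
  | zero =>
    have : Subsingleton (AffS 0) := ⟨fun x y => AffS.ext (Subsingleton.elim _ _)
      (Subsingleton.elim _ _)⟩
    infer_instance
  | succ n ih =>
    set f := (AffS.tail n).prod (AffS.headDiag n)
    have : Group.IsSolvable f.ker :=
      Group.isSolvable_of_comm fun a b => Subtype.ext (AffS.comm_of_mem_ker a.2 b.2)
    exact Group.isSolvable_of_ker_le_range f.ker.subtype f (by rw [Subgroup.range_subtype])

theorem isSolvable_normalFamily (n : ℕ) : Group.IsSolvable (NormalFamily n) := by
  have := isSolvable_affS n
  exact Group.isSolvable_of_isSolvable_injective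
    (f := ((phiEquiv n).symm.mulEquiv).toMonoidHom) ((phiEquiv n).symm.mulEquiv).injective

end Solvable

section OpensDeriv

open TopologicalSpace

variable {E : Type*} [NormedAddCommGroup E] [NormedSpace ℝ E] {U : Opens E}
  {F : Type*} [NormedAddCommGroup F] [NormedSpace ℝ F]
  {G : Type*} [NormedAddCommGroup G] [NormedSpace ℝ G]

/-- Differentiability of a map on an open subset of a normed space. -/
def OpensDiffAt (f : U → F) (p : U) : Prop := DifferentiableAt ℝ (f ∘ retr p) p.1

/-- The derivative of a map on an open subset of a normed space. -/
def opensDeriv (f : U → F) (p : U) : E →L[ℝ] F := fderiv ℝ (f ∘ retr p) p.1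

theorem opensDiffAt_smooth {f : U → F} (hf : ContMDiff 𝓘(ℝ, E) 𝓘(ℝ, F) ∞ f)
    (p : U) : OpensDiffAt f p :=
  (contMDiff_iff_retr.1 hf p).differentiableAt (by simp)

theorem opensDiffAt_vfield {X : VField E U} {p : U}
    (hX : MDifferentiableAt 𝓘(ℝ, E) 𝓘(ℝ, E).tangent
      (fun q => (⟨q, X q⟩ : TangentBundle 𝓘(ℝ, E) U)) p) : OpensDiffAt (X : U → E) p :=
  mdifferentiableAt_iff_retr.1 (mdifferentiableAt_vfield_iff.1 hX)

theorem opensDeriv_const (c : F) (p : U) : opensDeriv (fun _ => c) p = 0 :=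
  fderiv_const_apply c

theorem opensDiffAt_const (c : F) (p : U) : OpensDiffAt (fun _ => c) p :=
  differentiableAt_const c

theorem opensDeriv_add {f g : U → F} {p : U} (hf : OpensDiffAt f p) (hg : OpensDiffAt g p) :
    opensDeriv (fun q => f q + g q) p = opensDeriv f p + opensDeriv g p :=
  fderiv_fun_add hf hg

theorem opensDeriv_sub {f g : U → F} {p : U} (hf : OpensDiffAt f p) (hg : OpensDiffAt g p) :
    opensDeriv (fun q => f q - g q) p = opensDeriv f p - opensDeriv g p :=
  fderiv_fun_sub hf hg

theorem OpensDiffAt.clm_comp {f : U → F} {p : U} (L : F →L[ℝ] G) (hf : OpensDiffAt f p) :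
    OpensDiffAt (fun q => L (f q)) p :=
  L.differentiableAt.comp p.1 hf

theorem opensDeriv_clm_comp {f : U → F} {p : U} (L : F →L[ℝ] G) (hf : OpensDiffAt f p) (v : E) :
    opensDeriv (fun q => L (f q)) p v = L (opensDeriv f p v) := by
  have h := (L.hasFDerivAt.comp p.1 (HasFDerivAt.congr_fderiv
    (DifferentiableAt.hasFDerivAt hf) rfl)).fderiv
  exact congrArg (fun T : E →L[ℝ] G => T v) h

theorem opensDeriv_clm_apply {c : U → F →L[ℝ] G} {u : U → F} {p : U} (hc : OpensDiffAt c p)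
    (hu : OpensDiffAt u p) (v : E) :
    opensDeriv (fun q => c q (u q)) p v = c p (opensDeriv u p v) + opensDeriv c p v (u p) := by
  have h := (DifferentiableAt.hasFDerivAt hc).clm_apply (DifferentiableAt.hasFDerivAt hu)
  refine (congrArg (fun T : E →L[ℝ] G => T v) h.fderiv).trans ?_
  simp only [Function.comp_apply, retr_coe, opensDeriv]
  rfl

theorem OpensDiffAt.clm_apply {c : U → F →L[ℝ] G} {u : U → F} {p : U} (hc : OpensDiffAt c p)
    (hu : OpensDiffAt u p) : OpensDiffAt (fun q => c q (u q)) p :=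
  DifferentiableAt.clm_apply hc hu

theorem opensDeriv_bilin {H : Type*} [NormedAddCommGroup H] [NormedSpace ℝ H]
    (B : F →L[ℝ] G →L[ℝ] H) {f : U → F} {g : U → G} {p : U} (hf : OpensDiffAt f p)
    (hg : OpensDiffAt g p) (v : E) :
    opensDeriv (fun q => B (f q) (g q)) p v =
      B (f p) (opensDeriv g p v) + B (opensDeriv f p v) (g p) := by
  rw [opensDeriv_clm_apply (hf.clm_comp B) hg, opensDeriv_clm_comp B hf]

theorem opensDeriv_smul {f : U → ℝ} {u : U → F} {p : U} (hf : OpensDiffAt f p)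
    (hu : OpensDiffAt u p) (v : E) :
    opensDeriv (fun q => f q • u q) p v = f p • opensDeriv u p v + opensDeriv f p v • u p :=
  opensDeriv_bilin (ContinuousLinearMap.lsmul ℝ ℝ) hf hu v

theorem OpensDiffAt.mul {f g : U → ℝ} {p : U} (hf : OpensDiffAt f p) (hg : OpensDiffAt g p) :
    OpensDiffAt (fun q => f q * g q) p :=
  DifferentiableAt.mul hf hg

theorem opensDeriv_mul {f g : U → ℝ} {p : U} (hf : OpensDiffAt f p) (hg : OpensDiffAt g p) (v : E) :
    opensDeriv (fun q => f q * g q) p v = f p * opensDeriv g p v + opensDeriv f p v * g p :=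
  opensDeriv_smul hf hg v

theorem opensDeriv_sum {ι : Type*} (s : Finset ι) {f : ι → U → F} {p : U}
    (hf : ∀ i ∈ s, OpensDiffAt (f i) p) (v : E) :
    opensDeriv (fun q => ∑ i ∈ s, f i q) p v = ∑ i ∈ s, opensDeriv (f i) p v := by
  have h := HasFDerivAt.fun_sum fun i hi => DifferentiableAt.hasFDerivAt (hf i hi)
  refine (congrArg (fun T : E →L[ℝ] F => T v) h.fderiv).trans ?_
  rw [_root_.sum_apply]
  rfl

theorem mvfderiv_eq_opensDeriv (f : U → F) (p : U) (v : E) :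
    mvfderiv 𝓘(ℝ, E) f p v = opensDeriv f p v := mvfderiv_eq_retr f p v

theorem contMDiff_opensDeriv {f : U → F} (hf : ContMDiff 𝓘(ℝ, E) 𝓘(ℝ, F) ∞ f) :
    ContMDiff 𝓘(ℝ, E) 𝓘(ℝ, E →L[ℝ] F) ∞ (opensDeriv f) := by
  rw [contMDiff_iff_retr] at hf ⊢
  intro p
  refine ((hf p).fderiv_right (m := ∞) (by simp)).congr_of_eventuallyEq ?_
  filter_upwards [eventually_retr p] with x hx
  change fderiv ℝ (f ∘ retr (retr p x)) (retr p x).1 = _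
  rw [hx]; rfl

theorem mfderiv_opens {V : Opens F} {f : U → V} {p : U}
    (hf : MDifferentiableAt 𝓘(ℝ, E) 𝓘(ℝ, F) f p) :
    (mfderiv 𝓘(ℝ, E) 𝓘(ℝ, F) f p : E →L[ℝ] F) = opensDeriv (fun q => (f q).1) p := by
  refine hf.mfderiv.trans ?_
  change fderivWithin ℝ ((fun q => (f q).1) ∘ retr p) (Set.range id) p.1 = _
  rw [Set.range_id, fderivWithin_univ]
  rfl

theorem opensDeriv_coe (p : U) : opensDeriv (fun q : U => q.1) p = ContinuousLinearMap.id ℝ E := by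
  refine HasFDerivAt.fderiv ((hasFDerivAt_id p.1).congr_of_eventuallyEq ?_)
  filter_upwards [eventually_retr p] with x hx using hx

theorem opensDiffAt_coe (p : U) : OpensDiffAt (fun q : U => q.1) p :=
  opensDiffAt_smooth contMDiff_subtype_val p

theorem OpensDiffAt.log {f : U → ℝ} {p : U} (hf : OpensDiffAt f p) (hp : f p ≠ 0) :
    OpensDiffAt (fun q => Real.log (f q)) p :=
  DifferentiableAt.log hf (by rwa [retr_coe])

theorem opensDeriv_log {f : U → ℝ} {p : U} (hf : OpensDiffAt f p) (hp : f p ≠ 0) (v : E) :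
    opensDeriv (fun q => Real.log (f q)) p v = (f p)⁻¹ * opensDeriv f p v := by
  have h := (DifferentiableAt.hasFDerivAt hf).log (by rwa [Function.comp_apply, retr_coe])
  refine (congrArg (fun T : E →L[ℝ] ℝ => T v) h.fderiv).trans ?_
  simp [retr_coe, opensDeriv]

/-- The entrywise derivative of a matrix-valued map on an open subset of a normed space. -/
def entryDeriv {ι κ : Type*} (A : U → Matrix ι κ ℝ) (p : U) (v : E) : Matrix ι κ ℝ :=
  Matrix.of fun i j => opensDeriv (fun q => A q i j) p v

section MatrixProducts

variable {ι κ l : Type*} [Fintype κ] {A : U → Matrix ι κ ℝ} {p : U}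

theorem OpensDiffAt.dotProduct {x y : U → κ → ℝ} (hx : ∀ k, OpensDiffAt (fun q => x q k) p)
    (hy : ∀ k, OpensDiffAt (fun q => y q k) p) : OpensDiffAt (fun q => x q ⬝ᵥ y q) p :=
  DifferentiableAt.fun_sum fun k _ => (hx k).mul (hy k)

theorem opensDeriv_dotProduct {x y : U → κ → ℝ} (hx : ∀ k, OpensDiffAt (fun q => x q k) p)
    (hy : ∀ k, OpensDiffAt (fun q => y q k) p) (v : E) :
    opensDeriv (fun q => x q ⬝ᵥ y q) p v = (x p ⬝ᵥ fun k => opensDeriv (fun q => y q k) p v) +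
      (fun k => opensDeriv (fun q => x q k) p v) ⬝ᵥ y p := by
  simp only [dotProduct]
  rw [opensDeriv_sum _ fun k _ => (hx k).mul (hy k), ← Finset.sum_add_distrib]
  exact Finset.sum_congr rfl fun k _ => opensDeriv_mul (hx k) (hy k) v

theorem opensDeriv_mulVec {x : U → κ → ℝ} (hA : ∀ i j, OpensDiffAt (fun q => A q i j) p)
    (hx : ∀ k, OpensDiffAt (fun q => x q k) p) (i : ι) (v : E) :
    opensDeriv (fun q => (A q *ᵥ x q) i) p v =
      (A p *ᵥ fun k => opensDeriv (fun q => x q k) p v) i + (entryDeriv A p v *ᵥ x p) i :=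
  opensDeriv_dotProduct (hA i) hx v

theorem OpensDiffAt.matrix_mul {B : U → Matrix κ l ℝ}
    (hA : ∀ i j, OpensDiffAt (fun q => A q i j) p) (hB : ∀ i j, OpensDiffAt (fun q => B q i j) p)
    (i : ι) (j : l) : OpensDiffAt (fun q => (A q * B q) i j) p :=
  OpensDiffAt.dotProduct (hA i) (hB · j)

theorem entryDeriv_mul {B : U → Matrix κ l ℝ} (hA : ∀ i j, OpensDiffAt (fun q => A q i j) p)
    (hB : ∀ i j, OpensDiffAt (fun q => B q i j) p) (v : E) :
    entryDeriv (fun q => A q * B q) p v = A p * entryDeriv B p v + entryDeriv A p v * B p :=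
  Matrix.ext fun i j => opensDeriv_mulVec hA (fun k => hB k j) i v

end MatrixProducts

end OpensDeriv

section Frame

variable {n : ℕ}

/-- The linear action `(m, S) ↦ (A m, A S Aᵀ)`. -/
def actL (A : Matrix (Fin n) (Fin n) ℝ) : Param n →L[ℝ] Param n :=
  LinearMap.toContinuousLinearMap
    { toFun := fun X => mkParam (A *ᵥ X.1) (A * cmat X * Aᵀ) (by simp [Matrix.mul_assoc])
      map_add' := fun X Y => param_ext (by simp [Matrix.mulVec_add])
        (by simp [Matrix.mul_add, Matrix.add_mul])
      map_smul' := fun a X => param_ext (by simp [Matrix.mulVec_smul]) (by simp) }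

@[simp] theorem actL_fst (A : Matrix (Fin n) (Fin n) ℝ) (X : Param n) :
    (actL A X).1 = A *ᵥ X.1 := rfl

@[simp] theorem cmat_actL (A : Matrix (Fin n) (Fin n) ℝ) (X : Param n) :
    cmat (actL A X) = A * cmat X * Aᵀ := rfl

theorem actL_mul (A B : Matrix (Fin n) (Fin n) ℝ) (X : Param n) :
    actL (A * B) X = actL A (actL B X) :=
  param_ext (by simp) (by simp [Matrix.mul_assoc])

@[simp] theorem actL_one (X : Param n) : actL 1 X = X :=
  param_ext (by simp) (by simp)

/-- The differential at the identity of the left translation by `θ`. -/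
def frame (θ : NormalFamily n) : Param n →L[ℝ] Param n := actL (chol θ)

/-- The Maurer–Cartan form. -/
def coframe (θ : NormalFamily n) : Param n →L[ℝ] Param n := actL (chol θ)⁻¹

@[simp] theorem coframe_frame (θ : NormalFamily n) (X : Param n) :
    coframe θ (frame θ X) = X := by
  rw [coframe, frame, ← actL_mul, Matrix.nonsing_inv_mul _ (chol_isUnit_det θ), actL_one]

@[simp] theorem frame_coframe (θ : NormalFamily n) (X : Param n) :
    frame θ (coframe θ X) = X := by
  rw [coframe, frame, ← actL_mul, Matrix.mul_nonsing_inv _ (chol_isUnit_det θ), actL_one]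

theorem frame_mul (a θ : NormalFamily n) (X : Param n) :
    frame (a * θ) X = frame a (frame θ X) := by
  rw [frame, chol_mul, actL_mul]; rfl

theorem contMDiff_actL {A : NormalFamily n → Matrix (Fin n) (Fin n) ℝ}
    (hA : ∀ i j, ContMDiff 𝓘(ℝ, Param n) 𝓘(ℝ, ℝ) ∞ fun θ => A θ i j) :
    ContMDiff 𝓘(ℝ, Param n) 𝓘(ℝ, Param n →L[ℝ] Param n) ∞ fun θ => actL (A θ) := by
  refine contMDiff_clm fun X => contMDiff_param (fun i => ?_) (fun i j => ?_)
  · exact contMDiff_matrix_mulVec (v := fun _ => X.1) hA (fun i => contMDiff_const) i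
  · exact contMDiff_matrix_mul (B := fun θ => (A θ)ᵀ) (contMDiff_matrix_mul
      (B := fun _ => cmat X) hA fun _ _ => contMDiff_const) (fun k l => hA l k) i j

theorem contMDiff_frame : ContMDiff 𝓘(ℝ, Param n) 𝓘(ℝ, Param n →L[ℝ] Param n) ∞ (frame (n := n)) :=
  contMDiff_actL contMDiff_chol

theorem contMDiff_coframe :
    ContMDiff 𝓘(ℝ, Param n) 𝓘(ℝ, Param n →L[ℝ] Param n) ∞ (coframe (n := n)) :=
  contMDiff_actL contMDiff_chol_inv

theorem opensDiffAt_chol (i j : Fin n) (θ : NormalFamily n) :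
    OpensDiffAt (fun η => chol η i j) θ :=
  opensDiffAt_smooth (contMDiff_chol i j) θ

theorem opensDeriv_meanCoord (i : Fin n) (θ : NormalFamily n) (V : Param n) :
    opensDeriv (fun η : NormalFamily n => η.1.1 i) θ V = V.1 i := by
  have := opensDeriv_clm_comp (meanCoord i) (opensDiffAt_coe θ) V
  rw [opensDeriv_coe] at this
  exact this

theorem opensDeriv_cmatCoord (i j : Fin n) (θ : NormalFamily n) (V : Param n) :
    opensDeriv (fun η : NormalFamily n => cmat η.1 i j) θ V = cmat V i j := by
  have := opensDeriv_clm_comp (cmatCoord i j) (opensDiffAt_coe θ) V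
  rw [opensDeriv_coe] at this
  exact this

theorem entryDeriv_chol_mul_transpose (θ : NormalFamily n) (V : Param n) :
    chol θ * (entryDeriv chol θ V)ᵀ + entryDeriv chol θ V * (chol θ)ᵀ = cmat V := by
  have h := entryDeriv_mul (opensDiffAt_chol · · θ) (B := fun η => (chol η)ᵀ)
    (fun i j => opensDiffAt_chol j i θ) V
  simp only [chol_mul_transpose] at h
  exact h.symm.trans (Matrix.ext fun i j => opensDeriv_cmatCoord i j θ V)

theorem entryDeriv_chol_upper (θ : NormalFamily n) (V : Param n) :
    (entryDeriv chol θ V).IsUpperTriangular := by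
  intro i j h
  have hzero : (fun η : NormalFamily n => chol η i j) = fun _ => 0 :=
    funext fun η => chol_upper η h
  rw [entryDeriv, Matrix.of_apply, hzero, opensDeriv_const, _root_.zero_apply]

theorem entryDeriv_chol (θ : NormalFamily n) (X : Param n) :
    entryDeriv chol θ (frame θ X) = chol θ * halfUpper (cmat X) := by
  have hframe : chol θ * (chol θ * halfUpper (cmat X))ᵀ +
      chol θ * halfUpper (cmat X) * (chol θ)ᵀ = cmat (frame θ X) := by
    conv_rhs => rw [frame, cmat_actL, ← halfUpper_add_transpose (isSymm_cmat X)]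
    simp only [transpose_mul, Matrix.mul_add, Matrix.add_mul, Matrix.mul_assoc, add_comm]
  refine sub_eq_zero.1 (eq_zero_of_mul_transpose_add_eq_zero (chol_upper θ) (chol_pos θ)
    ((entryDeriv_chol_upper θ _).sub ((chol_upper θ).mul (halfUpper_upper _))) ?_)
  rw [transpose_sub, Matrix.mul_sub, Matrix.sub_mul, sub_add_sub_comm,
    entryDeriv_chol_mul_transpose, hframe, sub_self]

theorem opensDiffAt_frame (θ : NormalFamily n) : OpensDiffAt (frame (n := n)) θ :=
  opensDiffAt_smooth contMDiff_frame θ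

theorem opensDiffAt_coframe (θ : NormalFamily n) : OpensDiffAt (coframe (n := n)) θ :=
  opensDiffAt_smooth contMDiff_coframe θ

theorem opensDeriv_frame_apply (θ : NormalFamily n) (W X : Param n) :
    opensDeriv (fun η => frame η X) θ (frame θ W) = frame θ (rhoOp W X) := by
  have hdiff : OpensDiffAt (fun η : NormalFamily n => frame η X) θ :=
    (opensDiffAt_frame θ).clm_apply (opensDiffAt_const X θ)
  have hchol := fun i j => opensDiffAt_chol i j θ
  have hconst : ∀ S : Matrix (Fin n) (Fin n) ℝ,
      entryDeriv (fun _ : NormalFamily n => S) θ (frame θ W) = 0 := fun S => by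
    ext i j; simp [entryDeriv, opensDeriv_const]
  have htranspose : entryDeriv (fun η : NormalFamily n => (chol η)ᵀ) θ (frame θ W) =
      (chol θ * halfUpper (cmat W))ᵀ := by rw [← entryDeriv_chol]; rfl
  apply param_ext
  · ext i
    refine (opensDeriv_clm_comp (meanCoord i) hdiff (frame θ W)).symm.trans ?_
    refine (opensDeriv_mulVec hchol (fun k => opensDiffAt_const (X.1 k) θ) i _).trans ?_
    simp only [entryDeriv_chol, opensDeriv_const, _root_.zero_apply, ← Pi.zero_def,
      Matrix.mulVec_zero, Pi.zero_apply, zero_add, ← Matrix.mulVec_mulVec]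
    rfl
  · ext i j
    refine (opensDeriv_clm_comp (cmatCoord i j) hdiff (frame θ W)).symm.trans ?_
    have hconjugate := entryDeriv_mul (OpensDiffAt.matrix_mul hchol fun k l =>
      opensDiffAt_const (cmat X k l) θ) (fun k l => hchol l k) (B := fun η => (chol η)ᵀ) (frame θ W)
    rw [entryDeriv_mul hchol (fun k l => opensDiffAt_const (cmat X k l) θ), hconst, htranspose,
      entryDeriv_chol] at hconjugate
    refine (congrFun (congrFun hconjugate i) j).trans ?_
    simp [frame, rhoOp, Matrix.mul_add, Matrix.add_mul, Matrix.mul_assoc, add_comm]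

theorem opensDeriv_frame (θ : NormalFamily n) (V X : Param n) :
    opensDeriv (frame (n := n)) θ V X = frame θ (rhoOp (coframe θ V) X) := by
  rw [← opensDeriv_frame_apply, frame_coframe,
    opensDeriv_clm_apply (opensDiffAt_frame θ) (opensDiffAt_const X θ), opensDeriv_const]
  simp

theorem opensDeriv_vfield {X : NormalFamily n → Param n} {θ : NormalFamily n}
    (hX : OpensDiffAt X θ) (V : Param n) :
    opensDeriv X θ V = frame θ (opensDeriv (fun η => coframe η (X η)) θ V +
      rhoOp (coframe θ V) (coframe θ (X θ))) := by
  have h : X = fun η => frame η (coframe η (X η)) := funext fun η => (frame_coframe η _).symm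
  conv_lhs => rw [h]
  rw [opensDeriv_clm_apply (opensDiffAt_frame θ) ((opensDiffAt_coframe θ).clm_apply hX),
    opensDeriv_frame, map_add]

theorem mfderiv_mul_left (a θ : NormalFamily n) :
    (mfderiv 𝓘(ℝ, Param n) 𝓘(ℝ, Param n) (a * ·) θ : Param n →L[ℝ] Param n) = frame a := by
  have := lieGroup_normalFamily n
  have hs : ContMDiff 𝓘(ℝ, Param n) 𝓘(ℝ, Param n) ∞ (a * · : NormalFamily n → NormalFamily n) :=
    contMDiff_mul_left
  rw [mfderiv_opens ((hs θ).mdifferentiableAt (by simp))]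
  have haffine : (fun η : NormalFamily n => (a * η).1) = fun η => frame a η.1 + (a.1.1, 0) := by
    ext1 η
    rw [coe_mul]
    refine param_ext rfl ?_
    simp only [cmat_mkParam, cmat_add]
    exact (add_zero _).symm
  rw [haffine, opensDeriv_add ((opensDiffAt_coe θ).clm_comp _) (opensDiffAt_const _ θ),
    opensDeriv_const, add_zero]
  refine ContinuousLinearMap.ext fun V => ?_
  rw [opensDeriv_clm_comp _ (opensDiffAt_coe θ), opensDeriv_coe, ContinuousLinearMap.id_apply]

end Frame

section Score

variable {n : ℕ}

/-- The standardized observation `A⁻¹ (x - μ)`, where `A` is the triangular factor of `Σ`. -/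
def standardize (x : Fin n → ℝ) (θ : NormalFamily n) : Fin n → ℝ := (chol θ)⁻¹ *ᵥ (x - θ.1.1)

theorem chol_mulVec_standardize (x : Fin n → ℝ) (θ : NormalFamily n) :
    chol θ *ᵥ standardize x θ = x - θ.1.1 := by
  rw [standardize, Matrix.mulVec_mulVec, Matrix.mul_nonsing_inv _ (chol_isUnit_det θ),
    Matrix.one_mulVec]

theorem stdDensity_eq (y : Fin n → ℝ) :
    stdDensity y = (Real.sqrt (2 * Real.pi))⁻¹ ^ n * Real.exp (-(1 / 2) * (y ⬝ᵥ y)) := by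
  simp only [stdDensity, gaussianPDFReal_zero_one, Finset.prod_mul_distrib, Finset.prod_const,
    Finset.card_univ, Fintype.card_fin, ← Real.exp_sum, ← Finset.mul_sum, dotProduct, sq]

theorem density_eq (x : Fin n → ℝ) (θ : NormalFamily n) :
    density x θ = (chol θ).det⁻¹ * stdDensity (standardize x θ) := by
  have hcov : θ.cov = chol θ * (chol θ)ᵀ := (chol_mul_transpose θ).symm
  have hdet : θ.cov.det = (chol θ).det ^ 2 := by rw [hcov, det_mul, det_transpose, sq]
  have hquad : (x - θ.mean) ⬝ᵥ (θ.cov⁻¹ *ᵥ (x - θ.mean)) =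
      standardize x θ ⬝ᵥ standardize x θ := by
    rw [hcov, Matrix.mul_inv_rev, ← Matrix.mulVec_mulVec, ← transpose_nonsing_inv,
      dotProduct_mulVec, vecMul_transpose]
    rfl
  rw [density, hquad, hdet, stdDensity_eq, Real.sqrt_mul (by positivity),
    Real.sqrt_sq (chol_det_pos θ).le, Real.sqrt_eq_rpow, Real.sqrt_eq_rpow, ← Real.rpow_natCast,
    ← Real.rpow_natCast, ← Real.rpow_mul (by positivity), Real.inv_rpow (by positivity),
    ← Real.rpow_mul (by positivity), mul_comm (n : ℝ), mul_inv]
  ring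

theorem log_density (x : Fin n → ℝ) (θ : NormalFamily n) :
    Real.log (density x θ) = n * Real.log (Real.sqrt (2 * Real.pi))⁻¹ -
      ∑ i, Real.log (chol θ i i) - 1 / 2 * (standardize x θ ⬝ᵥ standardize x θ) := by
  rw [density_eq, stdDensity_eq, Real.log_mul (inv_ne_zero (chol_det_pos θ).ne') (by positivity),
    Real.log_mul (by positivity) (Real.exp_ne_zero _), Real.log_exp, Real.log_pow, Real.log_inv,
    Matrix.det_of_isUpperTriangular (chol_upper θ), Real.log_prod fun i _ => (chol_pos θ i).ne']
  ring

theorem opensDiffAt_standardize (x : Fin n → ℝ) (θ : NormalFamily n) (i : Fin n) :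
    OpensDiffAt (fun η => standardize x η i) θ :=
  opensDiffAt_smooth (contMDiff_matrix_mulVec (v := fun θ : NormalFamily n => x - θ.1.1)
    contMDiff_chol_inv (fun i => contMDiff_const.sub (contMDiff_mean_coe i)) i) θ

theorem opensDeriv_standardize (x : Fin n → ℝ) (θ : NormalFamily n) (X : Param n) :
    (fun i => opensDeriv (fun η => standardize x η i) θ (frame θ X)) =
      -(halfUpper (cmat X) *ᵥ standardize x θ + X.1) := by
  set d : Fin n → ℝ := fun i => opensDeriv (fun η => standardize x η i) θ (frame θ X)
  have hproduct : chol θ *ᵥ d + (chol θ * halfUpper (cmat X)) *ᵥ standardize x θ =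
      -(chol θ *ᵥ X.1) := by
    ext i
    have hresidual : opensDeriv (fun η : NormalFamily n => x i - η.1.1 i) θ (frame θ X) =
        -(chol θ *ᵥ X.1) i := by
      rw [opensDeriv_sub (opensDiffAt_const _ θ) (opensDiffAt_smooth (contMDiff_mean_coe i) θ),
        opensDeriv_const, zero_sub, _root_.neg_apply, opensDeriv_meanCoord]
      rfl
    have hfactor : (fun η : NormalFamily n => x i - η.1.1 i) =
        fun η => (chol η *ᵥ standardize x η) i :=
      funext fun η => (congrFun (chol_mulVec_standardize x η) i).symm
    rw [hfactor, opensDeriv_mulVec (opensDiffAt_chol · · θ) (opensDiffAt_standardize x θ),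
      entryDeriv_chol] at hresidual
    exact hresidual
  have hsolved := congrArg (fun v => (chol θ)⁻¹ *ᵥ v) hproduct
  simp only [Matrix.mulVec_add, Matrix.mulVec_mulVec, Matrix.mulVec_neg, ← Matrix.mul_assoc,
    Matrix.nonsing_inv_mul _ (chol_isUnit_det θ), Matrix.one_mul, Matrix.one_mulVec] at hsolved
  rw [eq_neg_iff_add_eq_zero, ← add_assoc, hsolved, neg_add_cancel]

theorem opensDiffAt_log_chol (θ : NormalFamily n) (i : Fin n) :
    OpensDiffAt (fun η => Real.log (chol η i i)) θ :=
  (opensDiffAt_chol i i θ).log (chol_pos θ i).ne'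

theorem opensDeriv_sum_log_chol (θ : NormalFamily n) (X : Param n) :
    opensDeriv (fun η => ∑ i, Real.log (chol η i i)) θ (frame θ X) = 1 / 2 * (cmat X).trace := by
  have hentry : ∀ i, opensDeriv (fun η => Real.log (chol η i i)) θ (frame θ X) =
      cmat X i i / 2 := fun i => by
    rw [opensDeriv_log (opensDiffAt_chol i i θ) (chol_pos θ i).ne']
    change (chol θ i i)⁻¹ * entryDeriv chol θ (frame θ X) i i = _
    rw [entryDeriv_chol, mul_upper_diag (chol_upper θ) (halfUpper_upper _), halfUpper_diag,
      inv_mul_cancel_left₀ (chol_pos θ i).ne']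
  rw [opensDeriv_sum _ fun i _ => opensDiffAt_log_chol θ i,
    Finset.sum_congr rfl fun i _ => hentry i, ← Finset.sum_div, one_div_mul_eq_div]
  rfl

theorem opensDeriv_log_density (x : Fin n → ℝ) (θ : NormalFamily n) (V : Param n) :
    opensDeriv (fun η => Real.log (density x η)) θ V =
      -opensDeriv (fun η => ∑ i, Real.log (chol η i i)) θ V -
        standardize x θ ⬝ᵥ fun i => opensDeriv (fun η => standardize x η i) θ V := by
  have hstd := opensDiffAt_standardize x θ
  have hlog : OpensDiffAt (fun η => ∑ i, Real.log (chol η i i)) θ :=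
    DifferentiableAt.fun_sum fun i _ => opensDiffAt_log_chol θ i
  have hsub : OpensDiffAt (fun η => n * Real.log (Real.sqrt (2 * Real.pi))⁻¹ -
      ∑ i, Real.log (chol η i i)) θ := DifferentiableAt.sub (opensDiffAt_const _ θ) hlog
  have hsq := OpensDiffAt.dotProduct hstd hstd
  simp only [log_density]
  rw [opensDeriv_sub hsub ((opensDiffAt_const _ θ).mul hsq),
    opensDeriv_sub (opensDiffAt_const _ θ) hlog, opensDeriv_const, zero_sub, _root_.sub_apply,
    _root_.neg_apply, opensDeriv_mul (opensDiffAt_const _ θ) hsq, opensDeriv_const,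
    opensDeriv_dotProduct hstd hstd, dotProduct_comm (fun _ => _) (standardize x θ),
    _root_.zero_apply]
  ring

theorem dotProduct_halfUpper {S : Matrix (Fin n) (Fin n) ℝ} (hS : S.IsSymm) (y : Fin n → ℝ) :
    y ⬝ᵥ halfUpper S *ᵥ y = 1 / 2 * (y ⬝ᵥ S *ᵥ y) := by
  conv_rhs => rw [← halfUpper_add_transpose hS]
  rw [Matrix.add_mulVec, dotProduct_add, dotProduct_mulVec _ (halfUpper S)ᵀ, vecMul_transpose,
    dotProduct_comm (halfUpper S *ᵥ y)]
  ring

theorem eval_scorePoly (X : Param n) (y : Fin n → ℝ) :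
    MvPolynomial.eval y (scorePoly X) =
      X.1 ⬝ᵥ y + 1 / 2 * (y ⬝ᵥ cmat X *ᵥ y - (cmat X).trace) := by
  simp only [scorePoly, map_add, map_sum, map_mul, map_sub, MvPolynomial.eval_C,
    MvPolynomial.eval_X, dotProduct, Matrix.mulVec, Finset.mul_sum]
  congr 3
  exact Finset.sum_congr rfl fun i _ => Finset.sum_congr rfl fun j _ => by ring

theorem score_frame (x : Fin n → ℝ) (θ : NormalFamily n) (X : Param n) :
    score x θ (frame θ X) = MvPolynomial.eval (standardize x θ) (scorePoly X) := by
  refine (mvfderiv_eq_opensDeriv _ θ (frame θ X)).trans ?_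
  rw [opensDeriv_log_density, opensDeriv_sum_log_chol, opensDeriv_standardize, dotProduct_neg,
    dotProduct_add, dotProduct_halfUpper (isSymm_cmat X), dotProduct_comm _ X.1, eval_scorePoly]
  ring

theorem integral_standardize {f : (Fin n → ℝ) → ℝ} (hf : Continuous f) (θ : NormalFamily n) :
    ∫ x, (chol θ).det⁻¹ * f (standardize x θ) = ∫ y, f y := by
  have hdet : ((chol θ)⁻¹).det ≠ 0 := by
    rw [Matrix.det_nonsing_inv, Ring.inverse_eq_inv']
    exact inv_ne_zero (chol_det_pos θ).ne'
  have hmeas : Measurable (Matrix.toLin' (chol θ)⁻¹) :=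
    (Matrix.toLin' (chol θ)⁻¹).continuous_of_finiteDimensional.measurable
  have htranslate : ∫ x, f (standardize x θ) = ∫ x, f (Matrix.toLin' (chol θ)⁻¹ x) :=
    integral_sub_right_eq_self (fun x => f (Matrix.toLin' (chol θ)⁻¹ x)) θ.1.1
  rw [integral_const_mul, htranslate,
    ← integral_map hmeas.aemeasurable hf.aestronglyMeasurable,
    Real.map_matrix_volume_pi_eq_smul_volume_pi hdet, integral_smul_measure, Matrix.det_nonsing_inv,
    Ring.inverse_eq_inv', inv_inv, abs_of_pos (chol_det_pos θ),
    ENNReal.toReal_ofReal (chol_det_pos θ).le, smul_eq_mul,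
    inv_mul_cancel_left₀ (chol_det_pos θ).ne']

theorem continuous_stdDensity : Continuous (stdDensity (n := n)) := by
  unfold stdDensity
  simp only [gaussianPDFReal_zero_one]
  fun_prop

theorem integral_density_mul_eval_standardize (θ : NormalFamily n)
    (p : MvPolynomial (Fin n) ℝ) :
    ∫ x, density x θ * MvPolynomial.eval (standardize x θ) p = gaussExp p := by
  rw [gaussExp_apply]
  refine Eq.trans ?_
    (integral_standardize (continuous_stdDensity.mul (MvPolynomial.continuous_eval p)) θ)
  simp only [density_eq, Pi.mul_apply, mul_assoc]

theorem fisherMetric_frame (θ : NormalFamily n) (X Y : Param n) :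
    fisherMetric n θ (frame θ X) (frame θ Y) = metricForm X Y := by
  rw [← gaussExp_scorePoly_scorePoly, ← integral_density_mul_eval_standardize θ]
  change ∫ x, density x θ * score x θ (frame θ X) * score x θ (frame θ Y) = _
  simp only [score_frame, map_mul, mul_assoc]

theorem amariChentsovCubic_frame (θ : NormalFamily n) (X Y Z : Param n) :
    amariChentsovCubic θ (frame θ X) (frame θ Y) (frame θ Z) = cubicLin n X Y Z := by
  rw [← gaussExp_scorePoly_three, ← integral_density_mul_eval_standardize θ]
  change ∫ x, density x θ * score x θ (frame θ X) * score x θ (frame θ Y) *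
    score x θ (frame θ Z) = _
  simp only [score_frame, map_mul, mul_assoc]

theorem fisherMetric_eq (θ : NormalFamily n) (X Y : Param n) :
    fisherMetric n θ X Y = metricForm (coframe θ X) (coframe θ Y) := by
  rw [← fisherMetric_frame θ, frame_coframe, frame_coframe]

theorem amariChentsovCubic_eq (θ : NormalFamily n) (X Y Z : Param n) :
    amariChentsovCubic θ X Y Z = cubicLin n (coframe θ X) (coframe θ Y) (coframe θ Z) := by
  rw [← amariChentsovCubic_frame θ, frame_coframe, frame_coframe, frame_coframe]

theorem isLeftInvariantMetric_fisherMetric (n : ℕ) : IsLeftInvariantMetric (fisherMetric n) := by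
  intro a θ u v
  have htranslate : ∀ w : Param n, mfderiv 𝓘(ℝ, Param n) 𝓘(ℝ, Param n) (a * ·) θ w =
      frame (a * θ) (coframe θ w) := fun w => by
    rw [frame_mul, frame_coframe, ← mfderiv_mul_left a θ]
    rfl
  rw [fisherMetric_eq θ u v, ← fisherMetric_frame (a * θ)]
  exact congrArg₂ (fisherMetric n (a * θ)) (htranslate u) (htranslate v)

end Score

section Metric

variable {n : ℕ}

/-- The Fisher metric at the standard normal distribution, as a continuous bilinear map. -/
def metricL (n : ℕ) : Param n →L[ℝ] Param n →L[ℝ] ℝ :=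
  LinearMap.toContinuousBilinearMap (LinearMap.mk₂ ℝ metricForm
    (fun X X' Y => by simp only [metricForm, map_add, Matrix.add_mul, trace_add, _root_.mul_add])
    (fun a X Y => by
      simp only [metricForm, map_smul, Matrix.smul_mul, trace_smul, smul_eq_mul, mul_left_comm])
    (fun X Y Y' => by simp only [metricForm, map_add, trace_add, _root_.mul_add])
    (fun a X Y => by
      simp only [metricForm, map_smul, Matrix.mul_smul, trace_smul, smul_eq_mul, mul_left_comm]))

theorem metricL_apply (X Y : Param n) : metricL n X Y = metricForm X Y := rfl

theorem metricL_comm (X Y : Param n) : metricL n X Y = metricL n Y X := metricForm_comm X Y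

/-- The coefficients of the Levi-Civita connection of the Fisher metric in the left-invariant frame,
as a continuous bilinear map. -/
def lcL (n : ℕ) : Param n →L[ℝ] Param n →L[ℝ] Param n :=
  LinearMap.toContinuousBilinearMap (LinearMap.mk₂ ℝ lcOp
    (fun W W' X => by simp only [lcOp, map_add, Matrix.add_mul])
    (fun a W X => by simp only [lcOp, map_smul, Matrix.smul_mul])
    (fun W X X' => by simp only [lcOp, map_add, Matrix.mul_add])
    (fun a W X => by simp only [lcOp, map_smul, Matrix.mul_smul]))

theorem lcL_apply (W X : Param n) : lcL n W X = lcOp W X := rfl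

theorem metricL_lcL (W X Y : Param n) :
    metricL n (lcL n W X) Y + metricL n X (lcL n W Y) = 0 := metricForm_lcOp W X Y

theorem metricForm_self (X : Param n) : metricForm X X = 1 / 2 * ∑ a, ∑ b, augment X a b ^ 2 := by
  rw [metricForm]
  conv_lhs => enter [2, 1, 2]; rw [← transpose_augment]
  simp only [Matrix.trace, Matrix.diag_apply, Matrix.mul_apply, Matrix.transpose_apply, sq]

theorem augment_sq_le_metricForm (X : Param n) (a b : AugIndex n) :
    augment X a b ^ 2 ≤ 2 * metricForm X X := by
  calc augment X a b ^ 2 ≤ ∑ b, augment X a b ^ 2 :=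
        Finset.single_le_sum (f := fun b => augment X a b ^ 2) (fun b _ => sq_nonneg _)
          (Finset.mem_univ b)
    _ ≤ ∑ a, ∑ b, augment X a b ^ 2 :=
        Finset.single_le_sum (f := fun a => ∑ b, augment X a b ^ 2)
          (fun a _ => Finset.sum_nonneg fun b _ => sq_nonneg _) (Finset.mem_univ a)
    _ = 2 * metricForm X X := by rw [metricForm_self]; ring

theorem eq_zero_of_metricForm_self_nonpos {X : Param n} (h : metricForm X X ≤ 0) : X = 0 := by
  have hentry : augment X = 0 := Matrix.ext fun a b =>
    pow_eq_zero_iff two_ne_zero |>.1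
      (le_antisymm (by linarith [augment_sq_le_metricForm X a b]) (sq_nonneg _))
  rw [← compress_augment X, hentry, map_zero]

theorem metricForm_pos {X : Param n} (h : X ≠ 0) : 0 < metricForm X X :=
  not_le.1 fun h' => h (eq_zero_of_metricForm_self_nonpos h')

theorem eq_of_metricL {X Y : Param n} (h : ∀ Z, metricL n X Z = metricL n Y Z) : X = Y := by
  refine sub_eq_zero.1 (eq_zero_of_metricForm_self_nonpos (le_of_eq ?_))
  rw [← metricL_apply, (metricL n).map_sub₂, h, sub_self]

theorem norm_le_of_metricForm_lt {X : Param n} (h : metricForm X X < 1) : ‖X‖ ≤ 2 := by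
  have hentry : ∀ a b, ‖augment X a b‖ ≤ 2 := fun a b =>
    abs_le_of_sq_le_sq (by linarith [augment_sq_le_metricForm X a b]) two_pos.le
  refine max_le ((pi_norm_le_iff_of_nonneg two_pos.le).2 fun i => ?_)
    ((pi_norm_le_iff_of_nonneg two_pos.le).2 fun i =>
      (pi_norm_le_iff_of_nonneg two_pos.le).2 fun j => ?_)
  · exact hentry (.inl i) (.inr ())
  · exact hentry (.inl i) (.inl j)

theorem contMDiff_coframe_apply {X : NormalFamily n → Param n}
    (hX : ContMDiff 𝓘(ℝ, Param n) 𝓘(ℝ, Param n) ∞ X) :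
    ContMDiff 𝓘(ℝ, Param n) 𝓘(ℝ, Param n) ∞ fun η => coframe η (X η) :=
  contMDiff_coframe.clm_apply hX

theorem exists_riemannianMetric (n : ℕ) :
    ∃ G : Bundle.ContMDiffRiemannianMetric 𝓘(ℝ, Param n) ∞ (Param n)
        (fun θ : NormalFamily n => TangentSpace 𝓘(ℝ, Param n) θ),
      ∀ (θ : NormalFamily n) (X Y : TangentSpace 𝓘(ℝ, Param n) θ),
        G.inner θ X Y = fisherMetric n θ X Y := by
  let g : NormalFamily n → Param n →L[ℝ] Param n →L[ℝ] ℝ := fun θ =>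
    (metricL n).bilinearComp (coframe θ) (coframe θ)
  refine ⟨⟨g, fun θ v w => ?_, fun θ v hv => ?_, fun θ => ?_, ?_⟩, fun θ X Y =>
    (fisherMetric_eq θ X Y).symm⟩
  · exact metricForm_comm (coframe θ v) (coframe θ w)
  · refine metricForm_pos (X := coframe θ v) fun h => hv ?_
    rw [← frame_coframe θ v]
    exact (congrArg (frame θ) h).trans (map_zero _)
  · change Bornology.IsVonNBounded ℝ {v : Param n | metricForm (coframe θ v) (coframe θ v) < 1}
    refine (NormedSpace.isVonNBounded_iff ℝ (E := Param n)).2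
      (isBounded_iff_forall_norm_le.2 ⟨‖frame θ‖ * 2, fun v hv => ?_⟩)
    rw [← frame_coframe θ v]
    exact (frame θ).le_of_opNorm_le_of_le le_rfl (norm_le_of_metricForm_lt hv)
  · refine contMDiff_bilin_iff.2 (contMDiff_clm fun v => contMDiff_clm fun w => ?_)
    change ContMDiff _ _ ∞ fun θ => metricL n (coframe θ v) (coframe θ w)
    exact ((metricL n).contDiff.contMDiff.comp
      (contMDiff_coframe_apply contMDiff_const)).clm_apply (contMDiff_coframe_apply contMDiff_const)

end Metric

section Components

variable {n : ℕ} {W X Y Z : VField (Param n) (NormalFamily n)}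

/-- The components of a vector field in the left-invariant frame. -/
def comp (X : VField (Param n) (NormalFamily n)) (θ : NormalFamily n) : Param n := coframe θ (X θ)

/-- The left-invariant vector field with given components. -/
def invField (v : Param n) : VField (Param n) (NormalFamily n) := fun θ => frame θ v

theorem comp_invField (v : Param n) (θ : NormalFamily n) : comp (invField v) θ = v :=
  coframe_frame θ v

theorem frame_comp (X : VField (Param n) (NormalFamily n)) (θ : NormalFamily n) :
    frame θ (comp X θ) = X θ := frame_coframe θ (X θ)

theorem comp_sub (X Y : VField (Param n) (NormalFamily n)) (θ : NormalFamily n) :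
    comp (X - Y) θ = comp X θ - comp Y θ := map_sub (coframe θ) (X θ) (Y θ)

theorem comp_injective : Function.Injective (comp (n := n)) := fun X Y h =>
  funext fun θ => by rw [← frame_comp X, ← frame_comp Y, h]

theorem invField_add (v w : Param n) : invField (v + w) = invField v + invField w :=
  funext fun θ => map_add (frame θ) v w

theorem invField_smul (a : ℝ) (v : Param n) : invField (a • v) = a • invField v :=
  funext fun θ => map_smul (frame θ) a v

theorem isSmooth_invField (v : Param n) : IsSmooth (invField v) :=
  isSmooth_iff.2 (contMDiff_frame.clm_apply contMDiff_const)

theorem IsSmooth.mdifferentiableAt (hX : IsSmooth X) (θ : NormalFamily n) :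
    MDifferentiableAt 𝓘(ℝ, Param n) 𝓘(ℝ, Param n).tangent
      (fun p => (⟨p, X p⟩ : TangentBundle 𝓘(ℝ, Param n) (NormalFamily n))) θ :=
  (hX θ).mdifferentiableAt (by simp)

theorem IsSmooth.opensDiffAt (hX : IsSmooth X) (θ : NormalFamily n) :
    OpensDiffAt (X : NormalFamily n → Param n) θ :=
  opensDiffAt_vfield (hX.mdifferentiableAt θ)

theorem contMDiff_comp (hX : IsSmooth X) :
    ContMDiff 𝓘(ℝ, Param n) 𝓘(ℝ, Param n) ∞ (comp X) :=
  contMDiff_coframe_apply (isSmooth_iff.1 hX)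

theorem opensDiffAt_comp (hX : OpensDiffAt (X : NormalFamily n → Param n) θ) :
    OpensDiffAt (comp X) θ := (opensDiffAt_coframe θ).clm_apply hX

/-- The derivative of a function along the vectors of the left-invariant frame. -/
def frameDeriv {F : Type*} [NormedAddCommGroup F] [NormedSpace ℝ F] (f : NormalFamily n → F)
    (θ : NormalFamily n) : Param n →L[ℝ] F := opensDeriv f θ ∘L frame θ

theorem frameDeriv_comp {F : Type*} [NormedAddCommGroup F] [NormedSpace ℝ F]
    (f : NormalFamily n → F) (W : VField (Param n) (NormalFamily n)) (θ : NormalFamily n) :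
    frameDeriv f θ (comp W θ) = opensDeriv f θ (W θ) :=
  congrArg (opensDeriv f θ) (frame_comp W θ)

theorem frameDeriv_add {F : Type*} [NormedAddCommGroup F] [NormedSpace ℝ F]
    {f g : NormalFamily n → F} {θ : NormalFamily n} (hf : OpensDiffAt f θ) (hg : OpensDiffAt g θ) :
    frameDeriv (fun η => f η + g η) θ = frameDeriv f θ + frameDeriv g θ :=
  congrArg (· ∘L frame θ) (opensDeriv_add hf hg)

theorem frameDeriv_bilin {F G H : Type*} [NormedAddCommGroup F] [NormedSpace ℝ F]
    [NormedAddCommGroup G] [NormedSpace ℝ G] [NormedAddCommGroup H] [NormedSpace ℝ H]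
    (B : F →L[ℝ] G →L[ℝ] H) {f : NormalFamily n → F} {g : NormalFamily n → G} {θ : NormalFamily n}
    (hf : OpensDiffAt f θ) (hg : OpensDiffAt g θ) (v : Param n) :
    frameDeriv (fun η => B (f η) (g η)) θ v =
      B (f θ) (frameDeriv g θ v) + B (frameDeriv f θ v) (g θ) :=
  opensDeriv_bilin B hf hg (frame θ v)

theorem contMDiff_frameDeriv {F : Type*} [NormedAddCommGroup F] [NormedSpace ℝ F]
    {f : NormalFamily n → F} {x : NormalFamily n → Param n}
    (hf : ContMDiff 𝓘(ℝ, Param n) 𝓘(ℝ, F) ∞ f)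
    (hx : ContMDiff 𝓘(ℝ, Param n) 𝓘(ℝ, Param n) ∞ x) :
    ContMDiff 𝓘(ℝ, Param n) 𝓘(ℝ, F) ∞ fun η => frameDeriv f η (x η) :=
  (contMDiff_opensDeriv hf).clm_apply (contMDiff_frame.clm_apply hx)

theorem frameDeriv_comp_invField (v : Param n) (θ : NormalFamily n) :
    frameDeriv (comp (invField v)) θ = 0 := by
  rw [funext (comp_invField v), frameDeriv, opensDeriv_const, ContinuousLinearMap.zero_comp]

theorem fisherMetric_comp (X Y : VField (Param n) (NormalFamily n)) (θ : NormalFamily n) :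
    fisherMetric n θ (X θ) (Y θ) = metricL n (comp X θ) (comp Y θ) :=
  fisherMetric_eq θ (X θ) (Y θ)

theorem dirDeriv_eq_frameDeriv (W : VField (Param n) (NormalFamily n)) (f : NormalFamily n → ℝ)
    (θ : NormalFamily n) : dirDeriv W f θ = frameDeriv f θ (comp W θ) :=
  (mvfderiv_eq_opensDeriv f θ (W θ)).trans (frameDeriv_comp f W θ).symm

theorem dirDeriv_fisherMetric (hX : IsSmooth X) (hY : IsSmooth Y)
    (W : VField (Param n) (NormalFamily n)) (θ : NormalFamily n) :
    dirDeriv W (fun η => fisherMetric n η (X η) (Y η)) θ =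
      metricL n (comp X θ) (frameDeriv (comp Y) θ (comp W θ)) +
        metricL n (frameDeriv (comp X) θ (comp W θ)) (comp Y θ) := by
  simp only [dirDeriv_eq_frameDeriv, fisherMetric_comp]
  exact frameDeriv_bilin (metricL n) (opensDiffAt_comp (hX.opensDiffAt θ))
    (opensDiffAt_comp (hY.opensDiffAt θ)) (comp W θ)

theorem dirDeriv_fisherMetric_invField (W : VField (Param n) (NormalFamily n)) (v u : Param n)
    (θ : NormalFamily n) :
    dirDeriv W (fun η => fisherMetric n η (invField v η) (invField u η)) θ = 0 := by
  rw [dirDeriv_fisherMetric (isSmooth_invField v) (isSmooth_invField u),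
    frameDeriv_comp_invField, frameDeriv_comp_invField]
  simp

theorem coframe_opensDeriv {X : NormalFamily n → Param n} {θ : NormalFamily n}
    (hX : OpensDiffAt X θ) (V : Param n) :
    coframe θ (opensDeriv X θ V) = opensDeriv (fun η => coframe η (X η)) θ V +
      rhoOp (coframe θ V) (coframe θ (X θ)) := by
  rw [opensDeriv_vfield hX, coframe_frame]

theorem comp_mlieBracket {θ : NormalFamily n}
    (hX : OpensDiffAt (X : NormalFamily n → Param n) θ)
    (hY : OpensDiffAt (Y : NormalFamily n → Param n) θ) :
    comp (VectorField.mlieBracket 𝓘(ℝ, Param n) X Y) θ =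
      frameDeriv (comp Y) θ (comp X θ) - frameDeriv (comp X) θ (comp Y θ) +
        (lcL n (comp X θ) (comp Y θ) - lcL n (comp Y θ) (comp X θ)) := by
  rw [frameDeriv_comp, frameDeriv_comp, lcL_apply, lcL_apply, ← rhoOp_sub_rhoOp,
    ← add_sub_add_comm]
  exact (congrArg (coframe θ) (mlieBracket_opens X Y θ)).trans <|
    (map_sub (coframe θ) _ _).trans <|
    congrArg₂ (· - ·) (coframe_opensDeriv hY (X θ)) (coframe_opensDeriv hX (Y θ))

end Components

section Connections

variable {n : ℕ}

/-- The covariant derivative whose coefficients in the left-invariant frame are given by the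
constant bilinear map `Γ`. -/
def frameCov (Γ : Param n →L[ℝ] Param n →L[ℝ] Param n) (X : NormalFamily n → Param n)
    (θ : NormalFamily n) : Param n →L[ℝ] Param n :=
  frame θ ∘L (opensDeriv (fun η => coframe η (X η)) θ + Γ.flip (coframe θ (X θ)) ∘L coframe θ)

theorem frameCov_apply (Γ : Param n →L[ℝ] Param n →L[ℝ] Param n) (X : NormalFamily n → Param n)
    (θ : NormalFamily n) (V : Param n) : frameCov Γ X θ V =
      frame θ (opensDeriv (fun η => coframe η (X η)) θ V + Γ (coframe θ V) (coframe θ (X θ))) := rfl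

theorem frameCov_add (Γ : Param n →L[ℝ] Param n →L[ℝ] Param n) {X Y : NormalFamily n → Param n}
    {θ : NormalFamily n} (hX : OpensDiffAt X θ) (hY : OpensDiffAt Y θ) :
    frameCov Γ (X + Y) θ = frameCov Γ X θ + frameCov Γ Y θ := by
  refine ContinuousLinearMap.ext fun V => ?_
  simp only [_root_.add_apply, frameCov_apply, Pi.add_apply, map_add,
    opensDeriv_add ((opensDiffAt_coframe θ).clm_apply hX) ((opensDiffAt_coframe θ).clm_apply hY)]
  abel

theorem frameCov_smul (Γ : Param n →L[ℝ] Param n →L[ℝ] Param n) {X : NormalFamily n → Param n}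
    {f : NormalFamily n → ℝ} {θ : NormalFamily n} (hX : OpensDiffAt X θ) (hf : OpensDiffAt f θ) :
    frameCov Γ (fun η => f η • X η) θ = f θ • frameCov Γ X θ +
      (opensDeriv f θ).smulRight (X θ) := by
  refine ContinuousLinearMap.ext fun V => ?_
  simp only [_root_.add_apply, _root_.smul_apply, frameCov_apply, map_smul, map_add,
    opensDeriv_smul hf ((opensDiffAt_coframe θ).clm_apply hX), frame_coframe, smul_add,
    ContinuousLinearMap.smulRight_apply]
  abel

theorem contMDiff_frameCov (Γ : Param n →L[ℝ] Param n →L[ℝ] Param n) {X : NormalFamily n → Param n}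
    (hX : ContMDiff 𝓘(ℝ, Param n) 𝓘(ℝ, Param n) ∞ X) :
    ContMDiff 𝓘(ℝ, Param n) 𝓘(ℝ, Param n →L[ℝ] Param n) ∞ (frameCov Γ X) := by
  refine contMDiff_clm fun V => ?_
  simp only [frameCov_apply]
  refine contMDiff_frame.clm_apply (ContMDiff.add ?_ ?_)
  · exact (contMDiff_opensDeriv (contMDiff_coframe_apply hX)).clm_apply contMDiff_const
  · exact (Γ.contDiff.contMDiff.comp (contMDiff_coframe_apply contMDiff_const)).clm_apply
      (contMDiff_coframe_apply hX)

/-- The affine connection whose coefficients in the left-invariant frame are constant. -/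
def frameConnection (Γ : Param n →L[ℝ] Param n →L[ℝ] Param n) :
    AffineConnection (Param n) (NormalFamily n) where
  cov :=
    { toFun := frameCov Γ
      isCovariantDerivativeOnUniv :=
        { add := fun hX hY _ => frameCov_add Γ (opensDiffAt_vfield hX) (opensDiffAt_vfield hY)
          leibniz := fun {X f θ} hX hf _ => by
            have hmv : (opensDeriv f θ : Param n →L[ℝ] ℝ) = mvfderiv 𝓘(ℝ, Param n) f θ :=
              ContinuousLinearMap.ext fun v => (mvfderiv_eq_opensDeriv f θ v).symm
            refine (frameCov_smul Γ (opensDiffAt_vfield hX)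
              (mdifferentiableAt_iff_retr.1 hf)).trans ?_
            rw [hmv]
            rfl } }
  smooth := ⟨⟨fun hX => by
    rw [contMDiffOn_univ] at hX ⊢
    exact contMDiff_endo_iff.2 (contMDiff_frameCov Γ (isSmooth_iff.1 hX))⟩⟩

/-- The connection `D` has the constant coefficients `Γ` in the left-invariant frame. -/
def HasCoeff (D : AffineConnection (Param n) (NormalFamily n))
    (Γ : Param n →L[ℝ] Param n →L[ℝ] Param n) : Prop :=
  ∀ W X : VField (Param n) (NormalFamily n), IsSmooth X → ∀ θ, D.nabla W X θ = frameCov Γ X θ (W θ)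

theorem hasCoeff_frameConnection (Γ : Param n →L[ℝ] Param n →L[ℝ] Param n) :
    HasCoeff (frameConnection Γ) Γ := fun _ _ _ _ => rfl

theorem comp_frameCov (Γ : Param n →L[ℝ] Param n →L[ℝ] Param n)
    (W X : VField (Param n) (NormalFamily n)) (θ : NormalFamily n) :
    coframe θ (frameCov Γ X θ (W θ)) =
      frameDeriv (comp X) θ (comp W θ) + Γ (comp W θ) (comp X θ) := by
  rw [frameDeriv_comp]
  exact coframe_frame θ _

variable {D Dhat : AffineConnection (Param n) (NormalFamily n)}
  {Γ : Param n →L[ℝ] Param n →L[ℝ] Param n} {W X Y Z : VField (Param n) (NormalFamily n)}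

theorem HasCoeff.comp_nabla (hD : HasCoeff D Γ) (hX : IsSmooth X)
    (W : VField (Param n) (NormalFamily n)) (θ : NormalFamily n) :
    comp (D.nabla W X) θ = frameDeriv (comp X) θ (comp W θ) + Γ (comp W θ) (comp X θ) :=
  (congrArg (coframe θ) (hD W X hX θ)).trans (comp_frameCov Γ W X θ)

theorem HasCoeff.isSmooth_nabla (hD : HasCoeff D Γ) (hW : IsSmooth W) (hX : IsSmooth X) :
    IsSmooth (D.nabla W X) := by
  have heq : D.nabla W X = fun θ => frameCov Γ X θ (W θ) := funext fun θ => hD W X hX θ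
  rw [heq]
  exact isSmooth_iff.2 ((contMDiff_frameCov Γ (isSmooth_iff.1 hX)).clm_apply (isSmooth_iff.1 hW))

theorem HasCoeff.cubicForm_apply (hD : HasCoeff D Γ) (X : VField (Param n) (NormalFamily n))
    (hY : IsSmooth Y) (hZ : IsSmooth Z) (θ : NormalFamily n) :
    cubicForm (fisherMetric n) D X Y Z θ = -(metricL n (Γ (comp X θ) (comp Y θ)) (comp Z θ) +
      metricL n (comp Y θ) (Γ (comp X θ) (comp Z θ))) := by
  change dirDeriv X (fun η => fisherMetric n η (Y η) (Z η)) θ -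
    fisherMetric n θ (D.nabla X Y θ) (Z θ) - fisherMetric n θ (Y θ) (D.nabla X Z θ) = _
  rw [dirDeriv_fisherMetric hY hZ, fisherMetric_comp, fisherMetric_comp, hD.comp_nabla hY,
    hD.comp_nabla hZ, map_add, map_add, _root_.add_apply]
  ring

theorem torsion_frameConnection_eq_zero
    (h : ∀ v w, Γ v w - Γ w v = lcL n v w - lcL n w v) : (frameConnection Γ).cov.torsion = 0 := by
  rw [CovariantDerivative.torsion_eq_zero_iff]
  intro X Y θ hX hY
  have hcomp : coframe θ (frameCov Γ Y θ (X θ) - frameCov Γ X θ (Y θ)) =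
      comp (VectorField.mlieBracket 𝓘(ℝ, Param n) X Y) θ := by
    rw [map_sub, comp_frameCov, comp_frameCov, add_sub_add_comm, h,
      comp_mlieBracket (opensDiffAt_vfield hX) (opensDiffAt_vfield hY)]
  refine ((frame_coframe θ _).symm.trans (congrArg (frame θ) hcomp)).trans ?_
  exact frame_comp _ θ

theorem isLeviCivita_frameConnection (n : ℕ) :
    IsLeviCivita (fisherMetric n) (frameConnection (lcL n)) := by
  refine ⟨torsion_frameConnection_eq_zero fun _ _ => rfl, fun X Y Z _ hY hZ => funext fun θ => ?_⟩
  rw [(hasCoeff_frameConnection (lcL n)).cubicForm_apply X hY hZ, metricL_lcL, neg_zero]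
  rfl

theorem comp_nabla_invField_sub_swap (hD : D.cov.torsion = 0) (v w : Param n)
    (θ : NormalFamily n) :
    comp (D.nabla (invField v) (invField w)) θ - comp (D.nabla (invField w) (invField v)) θ =
      lcL n v w - lcL n w v := by
  have hv := isSmooth_invField v
  have hw := isSmooth_invField w
  have hbracket : D.nabla (invField v) (invField w) θ - D.nabla (invField w) (invField v) θ =
      VectorField.mlieBracket 𝓘(ℝ, Param n) (invField v) (invField w) θ :=
    CovariantDerivative.torsion_eq_zero_iff _ |>.1 hD (hv.mdifferentiableAt θ)
      (hw.mdifferentiableAt θ)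
  rw [← comp_sub]
  refine (congrArg (coframe θ) hbracket).trans ?_
  refine (comp_mlieBracket (hv.opensDiffAt θ) (hw.opensDiffAt θ)).trans ?_
  simp only [comp_invField, frameDeriv_comp_invField, _root_.zero_apply, sub_zero, zero_add]

theorem hasCoeff_of_invField
    (h : ∀ w v θ, comp (D.nabla (invField w) (invField v)) θ = Γ w v) : HasCoeff D Γ := by
  intro W X hX θ
  have hval : invField (comp X θ) θ = X θ := frame_comp X θ
  have htensor := congrArg (fun T : Param n →L[ℝ] Param n => T (W θ))
    ((D.cov.isCovariantDerivativeOnUniv.difference_apply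
      (frameConnection Γ).cov.isCovariantDerivativeOnUniv (Set.mem_univ θ)
      (hX.mdifferentiableAt θ)).symm.trans ((congrArg _ hval.symm).trans
    (D.cov.isCovariantDerivativeOnUniv.difference_apply
      (frameConnection Γ).cov.isCovariantDerivativeOnUniv (Set.mem_univ θ)
      ((isSmooth_invField (comp X θ)).mdifferentiableAt θ))))
  have hconst : D.cov (invField (comp X θ)) θ (W θ) =
      frameCov Γ (invField (comp X θ)) θ (W θ) := by
    have hcomp : comp (D.nabla (invField (comp W θ)) (invField (comp X θ))) θ =
        coframe θ (frameCov Γ (invField (comp X θ)) θ (W θ)) := by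
      rw [h, comp_frameCov, frameDeriv_comp_invField, comp_invField, _root_.zero_apply, zero_add]
    rw [← frame_coframe θ (frameCov Γ (invField (comp X θ)) θ (W θ)), ← hcomp, frame_comp]
    exact congrArg (D.cov (invField (comp X θ)) θ) (frame_comp W θ).symm
  exact sub_eq_zero.1 (htensor.trans (sub_eq_zero.2 hconst))

theorem eq_zero_of_symm_of_skew {N : Param n → Param n → Param n} (symm : ∀ w v, N w v = N v w)
    (skew : ∀ w v u, metricL n (N w v) u + metricL n v (N w u) = 0) (w v : Param n) :
    N w v = 0 := by
  have hswap : ∀ w v u, metricL n (N w v) u = -metricL n (N w u) v := fun w v u => by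
    rw [metricL_comm _ v]
    exact eq_neg_of_add_eq_zero_left (skew w v u)
  refine eq_of_metricL fun u => self_eq_neg.1 ?_ |>.trans ?_
  · calc metricL n (N w v) u = -metricL n (N u w) v := by rw [hswap, symm]
      _ = metricL n (N v u) w := by rw [hswap, neg_neg, symm]
      _ = -metricL n (N w v) u := by rw [hswap, symm]
  · rw [map_zero, _root_.zero_apply]

theorem hasCoeff_leviCivita (hDhat : IsLeviCivita (fisherMetric n) Dhat) :
    HasCoeff Dhat (lcL n) := by
  refine hasCoeff_of_invField fun w v θ => sub_eq_zero.1 (eq_zero_of_symm_of_skew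
    (N := fun w v => comp (Dhat.nabla (invField w) (invField v)) θ - lcL n w v)
    (fun w v => ?_) (fun w v u => ?_) w v)
  · exact sub_eq_sub_iff_sub_eq_sub.2 (comp_nabla_invField_sub_swap hDhat.1 w v θ)
  · have hmetric : dirDeriv (invField w)
          (fun η => fisherMetric n η (invField v η) (invField u η)) θ -
        fisherMetric n θ (Dhat.nabla (invField w) (invField v) θ) (invField u θ) -
        fisherMetric n θ (invField v θ) (Dhat.nabla (invField w) (invField u) θ) = 0 :=
      congrFun (hDhat.2 _ _ _ (isSmooth_invField w) (isSmooth_invField v) (isSmooth_invField u)) θ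
    rw [dirDeriv_fisherMetric_invField, fisherMetric_comp, fisherMetric_comp, comp_invField,
      comp_invField] at hmetric
    rw [(metricL n).map_sub₂, map_sub]
    linarith [metricL_lcL w v u]

theorem mpullback_mul_left (a : NormalFamily n) (X : VField (Param n) (NormalFamily n))
    (θ : NormalFamily n) :
    VectorField.mpullback 𝓘(ℝ, Param n) 𝓘(ℝ, Param n) (a * ·) X θ = coframe a (X (a * θ)) := by
  have hinverse : ContinuousLinearMap.inverse (frame a) = coframe a :=
    ContinuousLinearMap.inverse_eq (ContinuousLinearMap.ext fun V => frame_coframe a V)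
      (ContinuousLinearMap.ext fun V => coframe_frame a V)
  rw [← hinverse, ← mfderiv_mul_left a θ]
  rfl

theorem coframe_mul (a θ : NormalFamily n) (X : Param n) :
    coframe (a * θ) X = coframe θ (coframe a X) := by
  rw [coframe, chol_mul, Matrix.mul_inv_rev, actL_mul]; rfl

theorem comp_mpullback (a : NormalFamily n) (X : VField (Param n) (NormalFamily n))
    (θ : NormalFamily n) :
    comp (VectorField.mpullback 𝓘(ℝ, Param n) 𝓘(ℝ, Param n) (a * ·) X) θ = comp X (a * θ) :=
  (congrArg (coframe θ) (mpullback_mul_left a X θ)).trans (coframe_mul a θ (X (a * θ))).symm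

theorem mpullback_invField (a : NormalFamily n) (v : Param n) :
    VectorField.mpullback 𝓘(ℝ, Param n) 𝓘(ℝ, Param n) (a * ·) (invField v) = invField v :=
  comp_injective (funext fun θ => by rw [comp_mpullback, comp_invField, comp_invField])

/-- The coefficients at the identity of a connection in the left-invariant frame. -/
def coeffAtOne (D : AffineConnection (Param n) (NormalFamily n)) :
    Param n →L[ℝ] Param n →L[ℝ] Param n :=
  ContinuousLinearMap.flip <| LinearMap.toContinuousLinearMap
    { toFun := fun v => coframe 1 ∘L D.cov (invField v) 1 ∘L frame 1
      map_add' := fun v v' => by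
        rw [invField_add, D.cov.isCovariantDerivativeOnUniv.add
          ((isSmooth_invField v).mdifferentiableAt 1) ((isSmooth_invField v').mdifferentiableAt 1)]
        exact ContinuousLinearMap.ext fun w => map_add (coframe 1) _ _
      map_smul' := fun a v => by
        rw [invField_smul, D.cov.isCovariantDerivativeOnUniv.smul_const a
          ((isSmooth_invField v).mdifferentiableAt 1)]
        exact ContinuousLinearMap.ext fun w => map_smul (coframe 1) a _ }

theorem hasCoeff_coeffAtOne (hD : IsLeftInvariantConnection D) : HasCoeff D (coeffAtOne D) := by
  refine hasCoeff_of_invField fun w v θ => ?_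
  have hpull := comp_mpullback θ (D.nabla (invField w) (invField v)) 1
  rw [hD θ _ _ (isSmooth_invField w) (isSmooth_invField v), mpullback_invField,
    mpullback_invField, mul_one] at hpull
  exact hpull.symm

end Connections

section Symmetry

theorem totallySymmetric_of_swap {E : Type*} [NormedAddCommGroup E] [NormedSpace ℝ E]
    {M : Type*} [TopologicalSpace M] [ChartedSpace E M] [IsManifold 𝓘(ℝ, E) ∞ M]
    {k : ℕ} {β : Type*} {T : (Fin (k + 1) → VField E M) → β}
    (h : ∀ X : Fin (k + 1) → VField E M, (∀ i, IsSmooth (X i)) → ∀ i : Fin k,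
      T (X ∘ Equiv.swap i.castSucc i.succ) = T X) : TotallySymmetric T := by
  intro X hX σ
  have hσ : σ ∈ Submonoid.closure
      (Set.range fun i : Fin k => Equiv.swap i.castSucc i.succ) := by
    rw [Equiv.Perm.mclosure_swap_castSucc_succ]
    trivial
  induction hσ using Submonoid.closure_induction generalizing X with
  | mem σ hσ =>
    obtain ⟨i, rfl⟩ := hσ
    exact h X hX i
  | one => rfl
  | mul σ τ _ _ ihσ ihτ =>
    rw [Equiv.Perm.coe_mul, ← Function.comp_assoc, ihτ (X ∘ σ) fun i => hX (σ i), ihσ X hX]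

theorem totallySymmetric_iff_of_comp {n k : ℕ} {β γ : Type*} {e : β → NormalFamily n → γ}
    (he : Function.Injective e)
    {T : (Fin (k + 1) → VField (Param n) (NormalFamily n)) → β}
    {t : (Fin (k + 1) → Param n) → γ}
    (hT : ∀ X, (∀ i, IsSmooth (X i)) → e (T X) = fun θ => t fun i => comp (X i) θ) :
    TotallySymmetric T ↔
      ∀ (x : Fin (k + 1) → Param n) (i : Fin k), t (x ∘ Equiv.swap i.castSucc i.succ) = t x := by
  refine ⟨fun hsymm x i => ?_, fun hswap => totallySymmetric_of_swap fun X hX i => he ?_⟩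
  · have h := congrArg e (hsymm (fun j => invField (x j)) (fun j => isSmooth_invField (x j))
      (Equiv.swap i.castSucc i.succ))
    rw [hT _ fun j => isSmooth_invField (x j),
      hT ((fun j => invField (x j)) ∘ Equiv.swap i.castSucc i.succ)
        fun j => isSmooth_invField _] at h
    simpa only [Function.comp_def, comp_invField] using congrFun h 1
  · rw [hT X hX, hT (X ∘ Equiv.swap i.castSucc i.succ) fun j => hX _]
    exact funext fun θ => hswap (fun j => comp (X j) θ) i

end Symmetry

section Pencil

variable {E : Type*} [NormedAddCommGroup E] [NormedSpace ℝ E]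

/-- The coefficients of the point with parameter `s` on the line of connections through the one with
coefficients `L`, in the direction of a difference tensor with coefficients `κ`. Instance search
does not find the sum of bilinear maps for `E = Param n`, hence the general `E`. -/
def coeffPencil (L κ : E →L[ℝ] E →L[ℝ] E) (s : ℝ) : E →L[ℝ] E →L[ℝ] E := L + s • κ

theorem coeffPencil_apply (L κ : E →L[ℝ] E →L[ℝ] E) (s : ℝ) (u v : E) :
    coeffPencil L κ s u v = L u v + s • κ u v := rfl

theorem exists_coeffPencil_one_eq (L Γ : E →L[ℝ] E →L[ℝ] E) : ∃ κ, coeffPencil L κ 1 = Γ :=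
  ⟨Γ - L, by rw [coeffPencil, one_smul, add_sub_cancel]⟩

end Pencil

section Statistical

variable {n : ℕ} {D : AffineConnection (Param n) (NormalFamily n)}
  {Γ κ : Param n →L[ℝ] Param n →L[ℝ] Param n} {t : Param n →ₗ[ℝ] Param n →ₗ[ℝ] Param n →ₗ[ℝ] ℝ}

/-- The cubic form `g(K(u, v), w)` of a difference tensor `K` with coefficients `κ` in the
left-invariant frame. -/
def loweredCubic (κ : Param n →L[ℝ] Param n →L[ℝ] Param n) :
    Param n →ₗ[ℝ] Param n →ₗ[ℝ] Param n →ₗ[ℝ] ℝ :=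
  κ.toLinearMap₁₂.compr₂ (metricL n).toLinearMap₁₂

theorem loweredCubic_apply (u v w : Param n) : loweredCubic κ u v w = metricL n (κ u v) w := rfl

/-- The derivation action on a cubic form `t` of the endomorphisms `Γ w`. If `t` and `Γ` are the
coefficients of a left-invariant cubic form and of a connection, this is `-∇_w t`. -/
def cubicAction (t : Param n →ₗ[ℝ] Param n →ₗ[ℝ] Param n →ₗ[ℝ] ℝ)
    (Γ : Param n →L[ℝ] Param n →L[ℝ] Param n) (w x y z : Param n) : ℝ :=
  t (Γ w x) y z + t x (Γ w y) z + t x y (Γ w z)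

/-- The Codazzi condition: the covariant derivative of the cubic form `t` along the connection with
coefficients `Γ` is symmetric in its first two arguments. For a symmetric `t` it is then totally
symmetric. -/
def IsCodazzi (t : Param n →ₗ[ℝ] Param n →ₗ[ℝ] Param n →ₗ[ℝ] ℝ)
    (Γ : Param n →L[ℝ] Param n →L[ℝ] Param n) : Prop :=
  ∀ w x y z, cubicAction t Γ w x y z = cubicAction t Γ x w y z

theorem cubicAction_coeffPencil (s : ℝ) (w x y z : Param n) :
    cubicAction t (coeffPencil Γ κ s) w x y z =
      cubicAction t Γ w x y z + s * cubicAction t κ w x y z := by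
  simp only [cubicAction, coeffPencil_apply, map_add, map_smul, LinearMap.add_apply,
    LinearMap.smul_apply, smul_eq_mul]
  ring

theorem IsCodazzi.coeffPencil_iff (hκ : IsCodazzi t κ) (s : ℝ) :
    IsCodazzi t (coeffPencil Γ κ s) ↔ IsCodazzi t Γ :=
  forall₄_congr fun w x y z => by
    rw [cubicAction_coeffPencil, cubicAction_coeffPencil, hκ w x y z, add_left_inj]

theorem cubicAction_swap₁₂ (ht : ∀ u v w, t u v w = t v u w) (w x y z : Param n) :
    cubicAction t Γ w x y z = cubicAction t Γ w y x z := by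
  rw [cubicAction, cubicAction, ht (Γ w x), ht x (Γ w y), ht x y]
  ring

theorem cubicAction_swap₂₃ (ht : ∀ u v w, t u v w = t u w v) (w x y z : Param n) :
    cubicAction t Γ w x y z = cubicAction t Γ w x z y := by
  rw [cubicAction, cubicAction, ht (Γ w x), ht x (Γ w y), ht x y]
  ring

/-- The covariant derivative of the difference tensor with respect to the Levi-Civita connection,
in the left-invariant frame. -/
def diffAction (κ : Param n →L[ℝ] Param n →L[ℝ] Param n) (x y z : Param n) : Param n :=
  lcL n x (κ y z) - κ (lcL n x y) z - κ y (lcL n x z)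

theorem metricL_diffAction (w x y z : Param n) :
    metricL n (diffAction κ w x y) z = -cubicAction (loweredCubic κ) (lcL n) w x y z := by
  rw [diffAction, (metricL n).map_sub₂, (metricL n).map_sub₂]
  simp only [cubicAction, loweredCubic_apply]
  linarith [metricL_lcL w (κ x y) z]

theorem diffAction_comm_iff : (∀ x y z, diffAction κ x y z = diffAction κ y x z) ↔
    IsCodazzi (loweredCubic κ) (lcL n) := by
  refine ⟨fun h w x y z => ?_, fun h x y z => eq_of_metricL fun u => ?_⟩
  · rw [← neg_inj, ← metricL_diffAction, ← metricL_diffAction, h]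
  · rw [metricL_diffAction, metricL_diffAction, h]

/-- The coefficients of the difference tensor of a statistical structure: a symmetric bilinear map
all of whose operators are self-adjoint. -/
structure IsStatCoeff (κ : Param n →L[ℝ] Param n →L[ℝ] Param n) : Prop where
  symm : ∀ u v, κ u v = κ v u
  selfAdjoint : ∀ u v w, metricL n (κ u v) w = metricL n v (κ u w)

namespace IsStatCoeff

theorem swap_left (h : IsStatCoeff κ) (u v w : Param n) :
    loweredCubic κ u v w = loweredCubic κ v u w := by
  rw [loweredCubic_apply, loweredCubic_apply, h.symm]

theorem swap_right (h : IsStatCoeff κ) (u v w : Param n) :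
    loweredCubic κ u v w = loweredCubic κ u w v := by
  rw [loweredCubic_apply, loweredCubic_apply, h.selfAdjoint, metricL_comm]

theorem diffAction_swap (h : IsStatCoeff κ) (x y z : Param n) :
    diffAction κ x y z = diffAction κ x z y := by
  rw [diffAction, diffAction, h.symm y z, h.symm (lcL n x y) z, h.symm y (lcL n x z)]
  abel

theorem isCodazzi (h : IsStatCoeff κ) : IsCodazzi (loweredCubic κ) κ := by
  intro w x y z
  simp only [cubicAction, loweredCubic_apply]
  rw [h.symm w x, h.selfAdjoint x (κ w y), h.selfAdjoint w (κ x y)]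
  ring

theorem exists_loweredCubic_iff (h : IsStatCoeff κ) :
    (∃ α : ℝ, ∀ x y z, loweredCubic κ x y z = -(α / 2 * cubicLin n x y z)) ↔
      IsCodazzi (loweredCubic κ) (lcL n) := by
  constructor
  · rintro ⟨α, hα⟩ w x y z
    simp only [cubicAction, hα, lcL_apply]
    linear_combination -(α / 2) * cubicLin_lcOp_comm w x y z
  · intro hcodazzi
    obtain ⟨γ, hγ⟩ :=
      (isRotationCubic_of_codazzi h.swap_left h.swap_right hcodazzi).exists_eq_mul_cubicLin
    exact ⟨-(2 * γ), fun x y z => (hγ x y z).trans (by ring)⟩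

end IsStatCoeff

theorem HasCoeff.isStatCoeff (hD : HasCoeff D (coeffPencil (lcL n) κ 1))
    (hs : IsStatistical (fisherMetric n) D) : IsStatCoeff κ := by
  have hsymm : ∀ u v, κ u v = κ v u := by
    intro u v
    have htorsion := comp_nabla_invField_sub_swap hs.1 u v 1
    rw [hD.comp_nabla (isSmooth_invField v), hD.comp_nabla (isSmooth_invField u)] at htorsion
    simp only [comp_invField, frameDeriv_comp_invField, _root_.zero_apply, zero_add,
      coeffPencil_apply, one_smul, add_sub_add_comm, add_eq_left] at htorsion
    exact sub_eq_zero.1 htorsion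
  have hcubic : ∀ u v w, cubicForm (fisherMetric n) D (invField u) (invField v) (invField w) 1 =
      -(metricL n (κ u v) w + metricL n v (κ u w)) := by
    intro u v w
    rw [hD.cubicForm_apply _ (isSmooth_invField v) (isSmooth_invField w)]
    simp only [comp_invField, coeffPencil_apply, one_smul, map_add, _root_.add_apply]
    linarith [metricL_lcL u v w]
  have hswap : ∀ u v w, metricL n u (κ v w) = metricL n v (κ u w) := by
    intro u v w
    have h : cubicForm (fisherMetric n) D (invField v) (invField u) (invField w) 1 =
        cubicForm (fisherMetric n) D (invField u) (invField v) (invField w) 1 :=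
      congrFun (hs.2 ![invField u, invField v, invField w]
        (fun i => by fin_cases i <;> exact isSmooth_invField _) (Equiv.swap 0 1)) 1
    rw [hcubic, hcubic, hsymm v u] at h
    linarith
  exact ⟨hsymm, fun u v w => by rw [metricL_comm, hsymm u v, hswap, hsymm w u]⟩

end Statistical

section Equivalence

variable {n : ℕ} {D Dhat D' : AffineConnection (Param n) (NormalFamily n)}
  {Γ κ : Param n →L[ℝ] Param n →L[ℝ] Param n} {s : ℝ} {W X Y Z : VField (Param n) (NormalFamily n)}

theorem opensDiffAt_bilin_comp (κ : Param n →L[ℝ] Param n →L[ℝ] Param n) (hX : IsSmooth X)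
    (hY : IsSmooth Y) (θ : NormalFamily n) : OpensDiffAt (fun η => κ (comp X η) (comp Y η)) θ :=
  ((opensDiffAt_comp (hX.opensDiffAt θ)).clm_comp κ).clm_apply (opensDiffAt_comp (hY.opensDiffAt θ))

theorem frameDeriv_bilin_comp {F : Type*} [NormedAddCommGroup F] [NormedSpace ℝ F]
    (B : Param n →L[ℝ] Param n →L[ℝ] F) (hX : IsSmooth X) (hY : IsSmooth Y) (θ : NormalFamily n)
    (v : Param n) :
    frameDeriv (fun η => B (comp X η) (comp Y η)) θ v =
      B (comp X θ) (frameDeriv (comp Y) θ v) + B (frameDeriv (comp X) θ v) (comp Y θ) :=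
  frameDeriv_bilin B (opensDiffAt_comp (hX.opensDiffAt θ)) (opensDiffAt_comp (hY.opensDiffAt θ)) v

theorem HasCoeff.cubicForm_eq (hD : HasCoeff D (coeffPencil (lcL n) κ 1)) (hκ : IsStatCoeff κ)
    (X : VField (Param n) (NormalFamily n)) (hY : IsSmooth Y) (hZ : IsSmooth Z)
    (θ : NormalFamily n) :
    cubicForm (fisherMetric n) D X Y Z θ =
      -2 * loweredCubic κ (comp X θ) (comp Y θ) (comp Z θ) := by
  rw [hD.cubicForm_apply X hY hZ]
  simp only [loweredCubic_apply, coeffPencil_apply, one_smul, map_add, _root_.add_apply]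
  linarith [metricL_lcL (comp X θ) (comp Y θ) (comp Z θ),
    hκ.selfAdjoint (comp X θ) (comp Y θ) (comp Z θ)]

theorem nablaCubic_cubicForm (hD : HasCoeff D (coeffPencil (lcL n) κ 1)) (hκ : IsStatCoeff κ)
    (hD' : HasCoeff D' Γ) (hW : IsSmooth W) (hX : IsSmooth X) (hY : IsSmooth Y) (hZ : IsSmooth Z)
    (θ : NormalFamily n) :
    nablaCubic D' (cubicForm (fisherMetric n) D) W X Y Z θ =
      2 * cubicAction (loweredCubic κ) Γ (comp W θ) (comp X θ) (comp Y θ) (comp Z θ) := by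
  change dirDeriv W (cubicForm (fisherMetric n) D X Y Z) θ -
    cubicForm (fisherMetric n) D (D'.nabla W X) Y Z θ -
    cubicForm (fisherMetric n) D X (D'.nabla W Y) Z θ -
    cubicForm (fisherMetric n) D X Y (D'.nabla W Z) θ = _
  have hcubic : cubicForm (fisherMetric n) D X Y Z = fun η =>
      ((-2 : ℝ) • metricL n) (κ (comp X η) (comp Y η)) (comp Z η) :=
    funext fun η => hD.cubicForm_eq hκ X hY hZ η
  rw [dirDeriv_eq_frameDeriv, hcubic, frameDeriv_bilin _ (opensDiffAt_bilin_comp κ hX hY θ)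
    (opensDiffAt_comp (hZ.opensDiffAt θ)), frameDeriv_bilin_comp κ hX hY,
    hD.cubicForm_eq hκ _ hY hZ, hD.cubicForm_eq hκ X (hD'.isSmooth_nabla hW hY) hZ,
    hD.cubicForm_eq hκ X hY (hD'.isSmooth_nabla hW hZ), hD'.comp_nabla hX, hD'.comp_nabla hY,
    hD'.comp_nabla hZ]
  simp only [cubicAction, map_add, LinearMap.add_apply, loweredCubic_apply, _root_.add_apply,
    _root_.smul_apply, smul_eq_mul]
  ring

theorem totallySymmetric_nablaCubic_iff (hD : HasCoeff D (coeffPencil (lcL n) κ 1))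
    (hκ : IsStatCoeff κ) (hD' : HasCoeff D' Γ) :
    TotallySymmetric (fun X : Fin 4 → VField (Param n) (NormalFamily n) =>
      nablaCubic D' (cubicForm (fisherMetric n) D) (X 0) (X 1) (X 2) (X 3)) ↔
    IsCodazzi (loweredCubic κ) Γ := by
  refine (totallySymmetric_iff_of_comp Function.injective_id (t := fun x =>
    2 * cubicAction (loweredCubic κ) Γ (x 0) (x 1) (x 2) (x 3)) fun X hX => funext fun θ =>
    nablaCubic_cubicForm hD hκ hD' (hX 0) (hX 1) (hX 2) (hX 3) θ).trans
    ⟨fun h w x y z => mul_left_cancel₀ two_ne_zero (h ![x, w, y, z] 0), fun h x i => ?_⟩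
  refine congrArg (2 * ·) ?_
  fin_cases i
  · exact h _ _ _ _
  · exact cubicAction_swap₁₂ hκ.swap_left _ _ _ _
  · exact cubicAction_swap₂₃ hκ.swap_right _ _ _ _

theorem comp_differenceTensor (hD : HasCoeff D (coeffPencil (lcL n) κ 1))
    (hDhat : HasCoeff Dhat (lcL n)) (X : VField (Param n) (NormalFamily n)) (hY : IsSmooth Y)
    (θ : NormalFamily n) :
    comp (differenceTensor Dhat D X Y) θ = κ (comp X θ) (comp Y θ) := by
  rw [differenceTensor, comp_sub, hD.comp_nabla hY, hDhat.comp_nabla hY, add_sub_add_left_eq_sub,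
    coeffPencil_apply, one_smul, add_sub_cancel_left]

theorem isSmooth_differenceTensor (hD : HasCoeff D (coeffPencil (lcL n) κ 1))
    (hDhat : HasCoeff Dhat (lcL n)) (hX : IsSmooth X) (hY : IsSmooth Y) :
    IsSmooth (differenceTensor Dhat D X Y) :=
  isSmooth_iff.2 ((isSmooth_iff.1 (hD.isSmooth_nabla hX hY)).sub
    (isSmooth_iff.1 (hDhat.isSmooth_nabla hX hY)))

theorem comp_nablaDifference (hD : HasCoeff D (coeffPencil (lcL n) κ 1))
    (hDhat : HasCoeff Dhat (lcL n)) (hX : IsSmooth X) (hY : IsSmooth Y) (hZ : IsSmooth Z)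
    (θ : NormalFamily n) :
    comp (nablaDifference Dhat (differenceTensor Dhat D) X Y Z) θ =
      diffAction κ (comp X θ) (comp Y θ) (comp Z θ) := by
  have hK : comp (differenceTensor Dhat D Y Z) = fun η => κ (comp Y η) (comp Z η) :=
    funext fun η => comp_differenceTensor hD hDhat Y hZ η
  rw [nablaDifference, comp_sub, comp_sub, hDhat.comp_nabla
    (isSmooth_differenceTensor hD hDhat hY hZ), hK, frameDeriv_bilin_comp κ hY hZ,
    comp_differenceTensor hD hDhat _ hZ,
    comp_differenceTensor hD hDhat _ (hDhat.isSmooth_nabla hX hZ), hDhat.comp_nabla hY,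
    hDhat.comp_nabla hZ, diffAction, map_add (κ (comp Y θ)), κ.map_add₂]
  abel

theorem totallySymmetric_nablaDifference_iff (hD : HasCoeff D (coeffPencil (lcL n) κ 1))
    (hκ : IsStatCoeff κ) (hDhat : HasCoeff Dhat (lcL n)) :
    TotallySymmetric (fun X : Fin 3 → VField (Param n) (NormalFamily n) =>
      nablaDifference Dhat (differenceTensor Dhat D) (X 0) (X 1) (X 2)) ↔
    ∀ x y z, diffAction κ x y z = diffAction κ y x z := by
  refine (totallySymmetric_iff_of_comp comp_injective (t := fun x =>
    diffAction κ (x 0) (x 1) (x 2)) fun X hX => funext fun θ =>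
    comp_nablaDifference hD hDhat (hX 0) (hX 1) (hX 2) θ).trans
    ⟨fun h x y z => h ![y, x, z] 0, fun h x i => ?_⟩
  fin_cases i
  · exact h _ _ _
  · exact hκ.diffAction_swap _ _ _

theorem HasCoeff.comp_nabla_nabla (hD : HasCoeff D Γ) (hY : IsSmooth Y)
    (hZ : IsSmooth Z) (X : VField (Param n) (NormalFamily n)) (θ : NormalFamily n) :
    comp (D.nabla X (D.nabla Y Z)) θ =
      frameDeriv (fun η => frameDeriv (comp Z) η (comp Y η)) θ (comp X θ) +
      (Γ (comp Y θ) (frameDeriv (comp Z) θ (comp X θ)) +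
        Γ (frameDeriv (comp Y) θ (comp X θ)) (comp Z θ)) +
      Γ (comp X θ) (frameDeriv (comp Z) θ (comp Y θ) + Γ (comp Y θ) (comp Z θ)) := by
  have hYZ : comp (D.nabla Y Z) = fun η =>
      frameDeriv (comp Z) η (comp Y η) + Γ (comp Y η) (comp Z η) :=
    funext fun η => hD.comp_nabla hZ Y η
  rw [hD.comp_nabla (hD.isSmooth_nabla hY hZ), hYZ, frameDeriv_add (opensDiffAt_smooth
    (contMDiff_frameDeriv (contMDiff_comp hZ) (contMDiff_comp hY)) θ)
    (opensDiffAt_bilin_comp Γ hY hZ θ), _root_.add_apply, frameDeriv_bilin_comp Γ hY hZ]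

theorem comp_curvature_sub (hD : HasCoeff D (coeffPencil (lcL n) κ s))
    (hD' : HasCoeff D' (coeffPencil (lcL n) κ (-s))) (hX : IsSmooth X) (hY : IsSmooth Y)
    (hZ : IsSmooth Z) (θ : NormalFamily n) :
    comp (curvature D X Y Z) θ - comp (curvature D' X Y Z) θ =
      (2 * s) • (diffAction κ (comp X θ) (comp Y θ) (comp Z θ) -
        diffAction κ (comp Y θ) (comp X θ) (comp Z θ)) := by
  rw [curvature, curvature, comp_sub, comp_sub, comp_sub, comp_sub, hD.comp_nabla_nabla hY hZ,
    hD.comp_nabla_nabla hX hZ, hD'.comp_nabla_nabla hY hZ, hD'.comp_nabla_nabla hX hZ,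
    hD.comp_nabla hZ, hD'.comp_nabla hZ, comp_mlieBracket (hX.opensDiffAt θ) (hY.opensDiffAt θ)]
  generalize comp X θ = x
  generalize comp Y θ = y
  generalize comp Z θ = z
  simp only [diffAction, coeffPencil_apply, map_add, map_sub, map_smul, _root_.add_apply,
    _root_.sub_apply]
  module

theorem IsConjugate.hasCoeff (h : IsConjugate (fisherMetric n) D D')
    (hD : HasCoeff D (coeffPencil (lcL n) κ s)) (hκ : IsStatCoeff κ) :
    HasCoeff D' (coeffPencil (lcL n) κ (-s)) := by
  refine hasCoeff_of_invField fun w u θ => eq_of_metricL fun v => ?_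
  have hconj := h (invField w) (invField v) (invField u) (isSmooth_invField w)
    (isSmooth_invField v) (isSmooth_invField u) θ
  rw [dirDeriv_fisherMetric_invField, fisherMetric_comp, fisherMetric_comp,
    hD.comp_nabla (isSmooth_invField v)] at hconj
  simp only [comp_invField, frameDeriv_comp_invField, _root_.zero_apply, zero_add,
    coeffPencil_apply, map_add, map_smul, _root_.add_apply, _root_.smul_apply,
    smul_eq_mul] at hconj
  rw [metricL_comm _ v, metricL_comm _ v, coeffPencil_apply, map_add, map_smul, smul_eq_mul]
  linear_combination -hconj - metricL_lcL w v u - s * hκ.selfAdjoint w v u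

theorem isConjugate_frameConnection (hD : HasCoeff D (coeffPencil (lcL n) κ s))
    (hκ : IsStatCoeff κ) :
    IsConjugate (fisherMetric n) D (frameConnection (coeffPencil (lcL n) κ (-s))) := by
  intro X Y Z _ hY hZ θ
  rw [dirDeriv_fisherMetric hY hZ, fisherMetric_comp, fisherMetric_comp, hD.comp_nabla hY,
    (hasCoeff_frameConnection _).comp_nabla hZ]
  simp only [coeffPencil_apply, map_add, map_smul, _root_.add_apply, _root_.smul_apply,
    smul_eq_mul]
  linear_combination -metricL_lcL (comp X θ) (comp Y θ) (comp Z θ) -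
    s * hκ.selfAdjoint (comp X θ) (comp Y θ) (comp Z θ)

theorem isConjugateSymmetric_iff (hD : HasCoeff D (coeffPencil (lcL n) κ 1)) (hκ : IsStatCoeff κ) :
    IsConjugateSymmetric (fisherMetric n) D ↔
      ∀ x y z, diffAction κ x y z = diffAction κ y x z := by
  constructor
  · rintro ⟨D', hconj, hcurv⟩ x y z
    have hx := isSmooth_invField x
    have hy := isSmooth_invField y
    have hz := isSmooth_invField z
    have h := comp_curvature_sub hD (hconj.hasCoeff hD hκ) hx hy hz 1
    rw [hcurv _ _ _ hx hy hz, sub_self, mul_one] at h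
    simp only [comp_invField] at h
    exact sub_eq_zero.1 ((smul_eq_zero.1 h.symm).resolve_left two_ne_zero)
  · intro hcomm
    refine ⟨frameConnection (coeffPencil (lcL n) κ (-1)), isConjugate_frameConnection hD hκ,
      fun X Y Z hX hY hZ => comp_injective <| funext fun θ => sub_eq_zero.1 ?_⟩
    rw [comp_curvature_sub hD (hasCoeff_frameConnection _) hX hY hZ, hcomm, sub_self, smul_zero]

theorem fisherMetric_nabla (hD : HasCoeff D (coeffPencil (lcL n) κ 1))
    (hDhat : HasCoeff Dhat (lcL n)) (X : VField (Param n) (NormalFamily n)) (hY : IsSmooth Y)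
    (Z : VField (Param n) (NormalFamily n)) (θ : NormalFamily n) :
    fisherMetric n θ (D.nabla X Y θ) (Z θ) = fisherMetric n θ (Dhat.nabla X Y θ) (Z θ) +
      loweredCubic κ (comp X θ) (comp Y θ) (comp Z θ) := by
  rw [fisherMetric_comp, fisherMetric_comp, hD.comp_nabla hY, hDhat.comp_nabla hY,
    coeffPencil_apply, one_smul, ← add_assoc, (metricL n).map_add₂, loweredCubic_apply]

theorem isAmariChentsov_iff (hD : HasCoeff D (coeffPencil (lcL n) κ 1))
    (hDhat : HasCoeff Dhat (lcL n)) :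
    IsAmariChentsov Dhat D ↔
      ∃ α : ℝ, ∀ x y z, loweredCubic κ x y z = -(α / 2 * cubicLin n x y z) := by
  have hpoint : ∀ (α : ℝ) {X Y Z : VField (Param n) (NormalFamily n)}, IsSmooth Y → ∀ θ,
      (fisherMetric n θ (D.nabla X Y θ) (Z θ) = fisherMetric n θ (Dhat.nabla X Y θ) (Z θ) -
        α / 2 * amariChentsovCubic θ (X θ) (Y θ) (Z θ) ↔
      loweredCubic κ (comp X θ) (comp Y θ) (comp Z θ) =
        -(α / 2 * cubicLin n (comp X θ) (comp Y θ) (comp Z θ))) := by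
    intro α X Y Z hY θ
    rw [fisherMetric_nabla hD hDhat X hY, amariChentsovCubic_eq θ (X θ) (Y θ) (Z θ),
      sub_eq_add_neg, add_right_inj]
    rfl
  refine exists_congr fun α =>
    ⟨fun h x y z => ?_, fun h X Y Z _ hY _ θ => (hpoint α hY θ).2 (h _ _ _)⟩
  simpa only [comp_invField] using (hpoint α (isSmooth_invField y) 1).1
    (h (invField x) _ (invField z) (isSmooth_invField x) (isSmooth_invField y)
      (isSmooth_invField z) 1)

theorem tfae_statistical (hDhat : IsLeviCivita (fisherMetric n) Dhat)
    (hD : IsLeftInvariantConnection D) (hs : IsStatistical (fisherMetric n) D) :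
    List.TFAE [
      IsAmariChentsov Dhat D,
      IsConjugateSymmetric (fisherMetric n) D,
      TotallySymmetric (fun X : Fin 4 → VField (Param n) (NormalFamily n) =>
        nablaCubic D (cubicForm (fisherMetric n) D) (X 0) (X 1) (X 2) (X 3)),
      TotallySymmetric (fun X : Fin 4 → VField (Param n) (NormalFamily n) =>
        nablaCubic Dhat (cubicForm (fisherMetric n) D) (X 0) (X 1) (X 2) (X 3)),
      TotallySymmetric (fun X : Fin 3 → VField (Param n) (NormalFamily n) =>
        nablaDifference Dhat (differenceTensor Dhat D) (X 0) (X 1) (X 2))] := by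
  have hL := hasCoeff_leviCivita hDhat
  obtain ⟨κ, hκ_eq⟩ := exists_coeffPencil_one_eq (lcL n) (coeffAtOne D)
  have hκD : HasCoeff D (coeffPencil (lcL n) κ 1) := hκ_eq ▸ hasCoeff_coeffAtOne hD
  have hκ := hκD.isStatCoeff hs
  rw [isAmariChentsov_iff hκD hL, hκ.exists_loweredCubic_iff,
    isConjugateSymmetric_iff hκD hκ, diffAction_comm_iff,
    totallySymmetric_nablaCubic_iff hκD hκ hκD, hκ.isCodazzi.coeffPencil_iff,
    totallySymmetric_nablaCubic_iff hκD hκ hL,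
    totallySymmetric_nablaDifference_iff hκD hκ hL, diffAction_comm_iff]
  simp only [List.tfae_cons_self, List.tfae_singleton]

end Equivalence

end NormalDist

end

theorem theorem3p4 (n : ℕ) :
    LieGroup 𝓘(ℝ, Param n) ∞ (NormalFamily n) ∧
    Group.IsSolvable (NormalFamily n) ∧
    (∃ G : Bundle.ContMDiffRiemannianMetric 𝓘(ℝ, Param n) ∞ (Param n)
        (fun θ : NormalFamily n => TangentSpace 𝓘(ℝ, Param n) θ),
      ∀ (θ : NormalFamily n) (X Y : TangentSpace 𝓘(ℝ, Param n) θ),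
        G.inner θ X Y = fisherMetric n θ X Y) ∧
    IsLeftInvariantMetric (fisherMetric n) ∧
    (∃ Dhat : AffineConnection (Param n) (NormalFamily n), IsLeviCivita (fisherMetric n) Dhat) ∧
    ∀ Dhat : AffineConnection (Param n) (NormalFamily n), IsLeviCivita (fisherMetric n) Dhat →
    ∀ D : AffineConnection (Param n) (NormalFamily n),
      IsLeftInvariantConnection D → IsStatistical (fisherMetric n) D →
      List.TFAE [
        IsAmariChentsov Dhat D,
        IsConjugateSymmetric (fisherMetric n) D,
        TotallySymmetric (fun X : Fin 4 → VField (Param n) (NormalFamily n) =>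
          nablaCubic D (cubicForm (fisherMetric n) D) (X 0) (X 1) (X 2) (X 3)),
        TotallySymmetric (fun X : Fin 4 → VField (Param n) (NormalFamily n) =>
          nablaCubic Dhat (cubicForm (fisherMetric n) D) (X 0) (X 1) (X 2) (X 3)),
        TotallySymmetric (fun X : Fin 3 → VField (Param n) (NormalFamily n) =>
          nablaDifference Dhat (differenceTensor Dhat D) (X 0) (X 1) (X 2))] :=
  ⟨lieGroup_normalFamily n, isSolvable_normalFamily n, exists_riemannianMetric n,
    isLeftInvariantMetric_fisherMetric n,
    ⟨frameConnection (lcL n), isLeviCivita_frameConnection n⟩,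
    fun _ hDhat _ hD hs => tfae_statistical hDhat hD hs⟩
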